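/- **Conventions.** $I=[0,1]$, $S^1=\mathbb R/\mathbb Z$. A $\mathbb Z_+$-category is a small category with an endomorphism $1$ of its identity functor; a $\mathbb Z_+$-functor is a functor $\Phi$ with $\Phi(1_c)=1_{\Phi(c)}$. A subset of $S^1$ is a $\mathbb Z_+$-category: its objects are its points, its morphisms $x\to y$ are homotopy classes in $S^1$ of oriented paths from $x$ to $y$ (images of nondecreasing paths in $\mathbb R$), and $1_x$ is the class of the loop of degree $1$. Let $[n]_{cyc}$ be the $\mathbb Z_+$-category $\{0,\frac1{n+1},\dots,\frac n{n+1}\}\subset S^1$, $\Lambda$ the category of all $[n]_{cyc}$, $n\ge 0$, and $\mathbb Z_+$-functors, and $\Lambda_{big}$ the category of all small $\mathbb Z_+$-categories isomorphic to some $[n]_{cyc}$. A cyclic set is a functor $X:\Lambda^{op}\to\mathrm{Sets}$. A simplicial set extends (uniquely up to unique isomorphism) to the category of all non-empty finite linearly ordered sets, and a cyclic set to $\Lambda_{big}$. There is a functor $\Delta\to\Lambda$, $[n]\mapsto[n]_{cyc}$, which sends a nondecreasing map to the $\mathbb Z_+$-functor with this map on objects that takes the shortest oriented path from $i$ to $j$,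 $i\le j$, to the shortest one between their images; so a cyclic set has an underlying simplicial set. **Realizations.** For a simplicial set $X$ put $|X|=\varinjlim_F X(\pi_0(I\setminus F))$ over the finite $F\subset I$, where $\pi_0(I\setminus F)$ carries its natural order. An element $x\in X([n])$ defines a map $\{x_1\le\dots\le x_n\}\subset I^n\to|X|$ sending $(x_1,\dots,x_n)$ to the class of $\varphi^*x$, where $\varphi:I\setminus\{x_1,\dots,x_n\}\to[n]$ is the step function equal to $i$ between $x_i$ and $x_{i+1}$ ($x_0=0$, $x_{n+1}=1$). The topology of $|X|$ is the finest one for which all these maps are continuous. For a cyclic set $X$ put $|X|=\varinjlim_F X(\pi_0(S^1\setminus F))$ over the non-empty finite $F\subset S^1$. Here $\pi_0(S^1\setminus F)\in\Lambda_{big}$ is the set of components, a morphism between two components being a homotopy class of oriented paths between their end points (for the positive direction); this is the quotient $\mathbb Z_+$-category of $S^1\setminus F$ whose restriction to each system of representatives of the components is an isomorphism. Let $\mathbf{Sim}^n_{cyc}$ be the space of $(n+1)$-tuples of points of $S^1$ in the correct cyclic order, i.e. the quotient of $\{(x_0,\dots,x_n)\in\mathbb R^{n+1}: x_0\le\dots\le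 x_n\le x_0+1\}$ by simultaneous translation by integers. A tuple defines the piecewise constant $\mathbb Z_+$-functor $\varphi:S^1\setminus\{x_0,\dots,x_n\}\to[n]_{cyc}$ which is $i$ on the arc between $x_{i-1}$ and $x_i$ (with $x_{-1}=x_n-1$) and takes a path that crosses $x_i,\dots,x_{j-1}$ to the composition $i\to i+1\to\dots\to j$. So an element $x\in X([n]_{cyc})$ defines a map $\mathbf{Sim}^n_{cyc}\to|X|$, $(x_0,\dots,x_n)\mapsto[\varphi^*x]$. The topology of $|X|$ is the finest one for which the composition of all these maps with $(x_1,\dots,x_n)\mapsto(x_1,\dots,x_n,1)$, $0\le x_1\le\dots\le x_n\le1$, is continuous. Let $\mathrm{Aut}\,I$ and $\mathrm{Aut}\,S^1$ be the groups of orientation-preserving homeomorphisms, $\mathrm{Aut}\,S^1$ being equipped with the compact-open topology. **Statement.** 1. For every simplicial set $X$ the group $\mathrm{Aut}\,I$ acts on the set $|X|$ so that $g$ sends the class of $x\in X(\pi_0(I\setminus F))$ to the class of $(g^{-1})^*x\in X(\pi_0(I\setminus g(F)))$. 2. For every cyclic set $X$: (a) $|X|$ is homeomorphic to the geometric realization of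 its underlying simplicial set, by a homeomorphism which is compatible with the maps from $\{0\le x_1\le\dots\le x_n\le1\}$ attached to all $x\in X([n]_{cyc})$, $n\ge0$; (b) $\mathrm{Aut}\,S^1$ acts on $|X|$ so that $g$ sends the class of $x\in X(\pi_0(S^1\setminus F))$ to the class of $(g^{-1})^*x\in X(\pi_0(S^1\setminus g(F)))$; (c) this action is continuous in the sense of compactly generated spaces: the map $\mathrm{Aut}\,S^1\times|X|\to|X|$ is continuous if the source carries the compactly generated topology associated with the product topology. For the ordinary product topology, its restriction to $\mathrm{Aut}\,S^1\times K$ is continuous for every compact $K\subset|X|$, and the whole map is continuous if $|X|$ is locally compact. 3. For every $n\ge0$ the map $\mathbf{Sim}^n_{cyc}\to|[n]_{cyc}|$ attached to the identity of $[n]_{cyc}$ is a homeomorphism, where $|[n]_{cyc}|$ is the geometric realization of the cyclic set represented by $[n]_{cyc}$. -/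

import Mathlib

open CategoryTheory Opposite

universe u

namespace Realization

/-- The extension of a presheaf along an equivalence of categories. -/
abbrev extendAlong {C D : Type*} [Category C] [Category D] (e : C ≌ D)
    (X : Cᵒᵖ ⥤ Type u) : Dᵒᵖ ⥤ Type u :=
  e.inverse.op ⋙ X

/-- The element `φ^* x` of the extension of `X`, for `x ∈ X(c)` and a morphism `φ` from `d` to the
image of `c`. -/
def pullback {C D : Type*} [Category C] [Category D] (e : C ≌ D)
    (X : Cᵒᵖ ⥤ Type u) {c : C} {d : D} (φ : d ⟶ e.functor.obj c) (x : X.obj (op c)) :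
    (extendAlong e X).obj (op d) :=
  X.map (e.inverse.map φ ≫ e.unitInv.app c).op x


/-- The number of indices `i` with `s i < y`. -/
noncomputable def countBelow {ι : Type} [Fintype ι] (s : ι → unitInterval) (y : unitInterval) : ℕ :=
  (Finset.univ.filter fun i => s i < y).card

theorem countBelow_mono {ι : Type} [Fintype ι] (s : ι → unitInterval) :
    Monotone (countBelow s) := fun _ _ h =>
  Finset.card_le_card fun i hi => by
    simp only [Finset.mem_filter, Finset.mem_univ, true_and] at hi ⊢
    exact hi.trans_le h

theorem countBelow_continuous {ι : Type} [Fintype ι] (s : ι → unitInterval)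
    {P : unitInterval → Prop} (hP : ∀ y, P y → ∀ i, s i ≠ y) :
    Continuous fun y : {y // P y} => countBelow s y := by
  rw [continuous_iff_continuousAt]
  intro y
  have h : ∀ᶠ z : {y // P y} in nhds y, ∀ i, (s i < z ↔ s i < y) := by
    rw [Filter.eventually_all]
    intro i
    have hc : Filter.Tendsto (fun z : {y // P y} => (z : unitInterval)) (nhds y) (nhds y) :=
      continuous_subtype_val.tendsto y
    rcases lt_or_gt_of_ne (hP y y.2 i) with h | h
    · filter_upwards [hc.eventually (lt_mem_nhds h)] with z hz
      exact ⟨fun _ => h, fun _ => hz⟩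
    · filter_upwards [hc.eventually (gt_mem_nhds h)] with z hz
      exact ⟨fun h' => absurd (h'.trans hz) (lt_irrefl _),
        fun h' => absurd (h'.trans h) (lt_irrefl _)⟩
  refine (continuousAt_const (y := countBelow s y)).congr ?_
  filter_upwards [h] with z hz
  simp only [countBelow, hz]

/-- The set `π₀(I ∖ F)`. -/
abbrev IntervalPi0 (F : Finset unitInterval) : Type :=
  _root_.ConnectedComponents {x : unitInterval // x ∉ F}

/-- The number of points of `F` to the left of a component of `I ∖ F`. -/
noncomputable def intervalIndex (F : Finset unitInterval) : IntervalPi0 F → ℕ :=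
  (countBelow_continuous (fun f : F => (f : unitInterval)) (P := fun x => x ∉ F)
    (by rintro y hy i rfl; exact hy i.2)).connectedComponentsLift

theorem intervalIndex_coe (F : Finset unitInterval) (x : {x : unitInterval // x ∉ F}) :
    intervalIndex F (x : IntervalPi0 F) = countBelow (fun f : F => (f : unitInterval)) x := rfl

theorem intervalPi0_eq_of_index_eq {F : Finset unitInterval} {x y : {x : unitInterval // x ∉ F}}
    (hxy : x ≤ y) (h : countBelow (fun f : F => (f : unitInterval)) x =
      countBelow (fun f : F => (f : unitInterval)) y) :
    (x : IntervalPi0 F) = (y : IntervalPi0 F) := by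
  have hF : ∀ z ∈ Set.Icc (x : unitInterval) y, z ∉ F := by
    intro z hz hzF
    have hzy : z < y := lt_of_le_of_ne hz.2 (by rintro rfl; exact y.2 hzF)
    refine absurd h (ne_of_lt (Finset.card_lt_card ?_))
    refine Finset.ssubset_iff.2 ⟨⟨z, hzF⟩, ?_, ?_⟩
    · simp [hz.1]
    · intro i hi
      simp only [Finset.mem_insert, Finset.mem_filter, Finset.mem_univ, true_and] at hi ⊢
      rcases hi with rfl | hi
      · exact hzy
      · exact lt_of_lt_of_le hi hxy
  have hpre : _root_.IsPreconnected (Subtype.val ⁻¹' Set.Icc (x : unitInterval) y :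
      Set {x : unitInterval // x ∉ F}) := by
    have e : (Subtype.val : {x : unitInterval // x ∉ F} → unitInterval) ''
        (Subtype.val ⁻¹' Set.Icc (x : unitInterval) y) = Set.Icc (x : unitInterval) y :=
      Set.image_preimage_eq_of_subset fun z hz => ⟨⟨z, hF z hz⟩, rfl⟩
    refine Topology.IsInducing.subtypeVal.isPreconnected_image.1 ?_
    exact (congrArg _ e).mpr isPreconnected_Icc
  rw [ConnectedComponents.coe_eq_coe']
  exact hpre.subset_connectedComponent ⟨hxy, le_rfl⟩ ⟨le_rfl, hxy⟩

theorem intervalIndex_injective (F : Finset unitInterval) :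
    Function.Injective (intervalIndex F) := by
  intro a b
  obtain ⟨x, rfl⟩ := ConnectedComponents.surjective_coe a
  obtain ⟨y, rfl⟩ := ConnectedComponents.surjective_coe b
  intro h
  rcases le_total x y with hxy | hxy
  · exact intervalPi0_eq_of_index_eq hxy h
  · exact (intervalPi0_eq_of_index_eq hxy h.symm).symm

/-- The natural order on `π₀(I ∖ F)`; it is the one for which `I ∖ F → π₀(I ∖ F)` is nondecreasing,
see `intervalPi0_coe_mono`. -/
noncomputable instance (F : Finset unitInterval) : LinearOrder (IntervalPi0 F) :=
  LinearOrder.lift' (intervalIndex F) (intervalIndex_injective F)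

theorem intervalPi0_coe_mono (F : Finset unitInterval) :
    Monotone ((↑) : {x : unitInterval // x ∉ F} → IntervalPi0 F) :=
  fun _ _ h => countBelow_mono (fun f : F => (f : unitInterval)) h

instance (F : Finset unitInterval) : Finite (IntervalPi0 F) := by
  refine Finite.of_injective (β := Fin (F.card + 1)) (fun a => ⟨intervalIndex F a, ?_⟩) ?_
  · obtain ⟨x, rfl⟩ := ConnectedComponents.surjective_coe a
    rw [intervalIndex_coe, Nat.lt_succ_iff]
    exact (Finset.card_le_univ _).trans (by simp)
  · intro a b h
    exact intervalIndex_injective F (Fin.mk.inj_iff.1 h)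

noncomputable instance (F : Finset unitInterval) : Fintype (IntervalPi0 F) := Fintype.ofFinite _

instance (F : Finset unitInterval) : Nonempty (IntervalPi0 F) := by
  have : Infinite unitInterval := Set.infinite_coe_iff.2 (Set.Icc_infinite zero_lt_one)
  obtain ⟨x, hx⟩ := Infinite.exists_notMem_finset F
  exact ⟨((⟨x, hx⟩ : {x : unitInterval // x ∉ F}) : IntervalPi0 F)⟩

/-- `π₀(I ∖ F)` as an object of the category of non-empty finite linearly ordered sets. -/
noncomputable abbrev intervalPi0 (F : Finset unitInterval) : NonemptyFinLinOrd.{0} :=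
  NonemptyFinLinOrd.of (IntervalPi0 F)

theorem monotone_on_intervalPi0 {F : Finset unitInterval} {β : Type*} [PartialOrder β]
    (h : {x : unitInterval // x ∉ F} → β) (hm : Monotone h) (k : IntervalPi0 F → β)
    (hk : ∀ x : {x : unitInterval // x ∉ F}, k (x : IntervalPi0 F) = h x) : Monotone k := by
  intro a b hab
  obtain ⟨x, rfl⟩ := ConnectedComponents.surjective_coe a
  obtain ⟨y, rfl⟩ := ConnectedComponents.surjective_coe b
  rcases le_total x y with hxy | hxy
  · rw [hk, hk]; exact hm hxy
  · exact (congrArg k (le_antisymm hab (intervalPi0_coe_mono F hxy))).le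

/-- The morphism induced on `π₀` by a continuous nondecreasing map. -/
noncomputable def intervalPi0Map {F F' : Finset unitInterval}
    (h : {x : unitInterval // x ∉ F'} → {x : unitInterval // x ∉ F})
    (hc : Continuous h) (hm : Monotone h) : intervalPi0 F' ⟶ intervalPi0 F :=
  NonemptyFinLinOrd.ofHom ⟨hc.connectedComponentsMap,
    monotone_on_intervalPi0 (fun x => (h x : IntervalPi0 F))
      (fun _ _ hxy => intervalPi0_coe_mono F (hm hxy)) _ fun _ => rfl⟩

/-- The projective system of the `π₀(I ∖ F)`, where `F` runs through the finite subsets of `I`. -/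
noncomputable def intervalPi0Functor : (Finset unitInterval)ᵒᵖ ⥤ NonemptyFinLinOrd.{0} where
  obj F := intervalPi0 F.unop
  map {F' F} i := intervalPi0Map (fun x => ⟨x.1, fun hx => x.2 (leOfHom i.unop hx)⟩)
    (by fun_prop) (fun _ _ h => h)
  map_id F := by
    refine NonemptyFinLinOrd.hom_ext (OrderHom.ext _ _ (funext fun c => ?_))
    obtain ⟨x, rfl⟩ := ConnectedComponents.surjective_coe c
    rfl
  map_comp f g := by
    refine NonemptyFinLinOrd.hom_ext (OrderHom.ext _ _ (funext fun c => ?_))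
    obtain ⟨x, rfl⟩ := ConnectedComponents.surjective_coe c
    rfl

/-- The extension of a simplicial set to non-empty finite linearly ordered sets. -/
noncomputable abbrev simplicialBig (X : SSet.{u}) : NonemptyFinLinOrd.{0}ᵒᵖ ⥤ Type u :=
  extendAlong SimplexCategory.skeletalEquivalence X

/-- The geometric realization of a simplicial set as a set: the direct limit of
`X(π₀(I ∖ F))` over the finite subsets `F` of `I = [0, 1]`. -/
noncomputable def SimplicialRealization (X : SSet.{u}) : Type u :=
  Limits.colimit (intervalPi0Functor.rightOp ⋙ simplicialBig X)

/-- The class in `|X|` of an element of `X(π₀(I ∖ F))`. -/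
noncomputable def SimplicialRealization.mk (X : SSet.{u}) (F : Finset unitInterval)
    (x : (simplicialBig X).obj (op (intervalPi0 F))) : SimplicialRealization X :=
  Limits.colimit.ι (intervalPi0Functor.rightOp ⋙ simplicialBig X) F x

/-- The group of orientation preserving (that is, increasing) homeomorphisms of `[0, 1]`. -/
def AutInterval : Subgroup (unitInterval ≃ₜ unitInterval) where
  carrier := {g | StrictMono g}
  mul_mem' {a b} ha hb := by
    show StrictMono (a ∘ b)
    exact StrictMono.comp ha hb
  one_mem' := strictMono_id
  inv_mem' {a} ha := by
    intro x y hxy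
    have ha' : StrictMono a := ha
    rw [← ha'.lt_iff_lt]
    show a (a.symm x) < a (a.symm y)
    simpa using hxy

/-- The image of a finite subset `F` under `g`. -/
noncomputable def intervalImage (g : AutInterval) (F : Finset unitInterval) :
    Finset unitInterval :=
  F.map g.1.toEquiv.toEmbedding

theorem mem_intervalImage (g : AutInterval) (F : Finset unitInterval) (z : unitInterval) :
    z ∈ intervalImage g F ↔ (g⁻¹).1 z ∈ F := by
  show z ∈ F.map g.1.toEquiv.toEmbedding ↔ g.1.symm z ∈ F
  simp

/-- The isomorphism `π₀(I ∖ F) → π₀(I ∖ F')` induced by `g` when `F' = g(F)`. -/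
noncomputable def intervalPi0Aut (g : AutInterval) {F F' : Finset unitInterval}
    (h : ∀ z, z ∈ F ↔ g.1 z ∈ F') : intervalPi0 F ⟶ intervalPi0 F' :=
  intervalPi0Map (fun x => ⟨g.1 x, fun hx => x.2 ((h _).2 hx)⟩) (by fun_prop)
    (fun _ _ hxy => (StrictMono.monotone g.2 : Monotone g.1) hxy)

/-- The standard simplex `{x₁ ≤ … ≤ x_n}` in `I^n`. -/
def Simplex (n : ℕ) : Type := {s : Fin n → unitInterval // Monotone s}

instance (n : ℕ) : TopologicalSpace (Simplex n) := inferInstanceAs (TopologicalSpace {s : Fin n → unitInterval // Monotone s})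

/-- The step function `I ∖ {x₁, …, x_n} → [n]` equal to `i` between `x_i` and `x_{i+1}`, as a morphism
from `π₀(I ∖ {x₁, …, x_n})` to `[n]`. -/
noncomputable def Simplex.step {n : ℕ} (s : Simplex n) :
    intervalPi0 (Finset.univ.image s.1) ⟶
      SimplexCategory.skeletalEquivalence.functor.obj (SimplexCategory.mk n) :=
  have hc : Continuous fun y : {y // y ∉ Finset.univ.image s.1} => (⟨countBelow s.1 y,
      Nat.lt_succ_of_le ((Finset.card_le_univ _).trans (by simp))⟩ : Fin (n + 1)) := by
    have := countBelow_continuous s.1 (P := fun y => y ∉ Finset.univ.image s.1)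
      (by rintro y hy i rfl; exact hy (by simp))
    refine continuous_discrete_rng.2 fun b => ?_
    convert! (continuous_discrete_rng.1 this) b.1 using 1
    ext y
    simp [Fin.ext_iff]
  NonemptyFinLinOrd.ofHom (Y := Fin (n + 1)) ⟨hc.connectedComponentsLift,
    monotone_on_intervalPi0 _ (fun _ _ h => countBelow_mono s.1 h) _ fun _ => rfl⟩

/-- The map from the standard simplex to `|X|` defined by an `n`-simplex `x` of `X`. -/
noncomputable def SimplicialRealization.charMap (X : SSet.{u}) {n : ℕ}
    (x : X.obj (op (SimplexCategory.mk n))) (s : Simplex n) : SimplicialRealization X :=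
  .mk X (Finset.univ.image s.1) (pullback SimplexCategory.skeletalEquivalence X s.step x)

/-- The standard topology of `|X|`: the quotient topology of the coend of `X` and the standard
simplices, i.e. the finest one for which all maps from standard simplices are continuous. -/
noncomputable instance (X : SSet.{u}) : TopologicalSpace (SimplicialRealization X) :=
  ⨆ (n : ℕ) (x : X.obj (op (SimplexCategory.mk n))),
    TopologicalSpace.coinduced (SimplicialRealization.charMap X x) inferInstance

/-- A small `ℤ₊`-category: a category with an endomorphism of its identity functor, equivalently with
a monoid morphism from `(ℕ, +)` to the endomorphisms of the identity functor. -/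
structure ZPlusCat where
  carrier : Type
  [cat : SmallCategory carrier]
  one : 𝟭 carrier ⟶ 𝟭 carrier

attribute [instance] ZPlusCat.cat

/-- A `ℤ₊`-functor. -/
@[ext]
structure ZPlusFunctor (C D : ZPlusCat) where
  functor : C.carrier ⥤ D.carrier
  map_one : ∀ c, functor.map (C.one.app c) = D.one.app (functor.obj c)

instance : Category ZPlusCat where
  Hom := ZPlusFunctor
  id C := ⟨𝟭 _, fun _ => rfl⟩
  comp Φ Ψ := ⟨Φ.functor ⋙ Ψ.functor, fun c => by
    simp only [Functor.comp_map, Φ.map_one, Ψ.map_one, Functor.comp_obj]⟩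

/-- The circle `ℝ / ℤ`. -/
abbrev Circle1 : Type := AddCircle (1 : ℝ)

/-- A homotopy class of oriented paths from `x` to `y` in the circle (an oriented path being the
image of a nondecreasing path in `ℝ`), recorded by its length: the classes with given ends are
determined by their lengths, see `homotopic_iff_len_eq` and `exists_path_of_class` below. -/
@[ext]
structure OrientedClass (x y : Circle1) where
  len : ℝ
  nonneg : 0 ≤ len
  add_eq : x + (len : Circle1) = y

/-- Objects of the category induced from the circle along `p : A → S¹`. -/
@[ext]
structure OnCircle {A : Type} (p : A → Circle1) where
  pt : A

/-- Morphisms are homotopy classes of oriented paths; composition adds lengths. -/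
instance {A : Type} (p : A → Circle1) : SmallCategory (OnCircle p) where
  Hom a b := OrientedClass (p a.pt) (p b.pt)
  id a := ⟨0, le_rfl, by simp⟩
  comp f g := ⟨f.len + g.len, add_nonneg f.nonneg g.nonneg, by
    rw [AddCircle.coe_add, ← add_assoc, f.add_eq, g.add_eq]⟩
  id_comp f := OrientedClass.ext (zero_add _)
  comp_id f := OrientedClass.ext (add_zero _)
  assoc f g h := OrientedClass.ext (add_assoc _ _ _)

/-- The set `A`, mapped to the circle by `p`, with the `ℤ₊`-category structure induced from the
circle; `1_a` is the class of the path of degree one. -/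
def onCircle {A : Type} (p : A → Circle1) : ZPlusCat where
  carrier := OnCircle p
  one :=
    { app := fun a => (⟨1, zero_le_one, by
        rw [AddCircle.coe_period, add_zero]⟩ : OrientedClass (p a.pt) (p a.pt))
      naturality := fun a b f => OrientedClass.ext (add_comm _ _) }

/-- A `ℤ₊`-functor which moves the point `p a` of the circle by `u a`. -/
def shiftFunctor {A B : Type} {p : A → Circle1} {q : B → Circle1} (φ : A → B) (u : A → ℝ)
    (hφ : ∀ a, q (φ a) = p a + (u a : Circle1))
    (hu : ∀ a b, ∀ t : ℝ, 0 ≤ t → p a + (t : Circle1) = p b → 0 ≤ t + (u b - u a)) :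
    onCircle p ⟶ onCircle q where
  functor :=
    { obj := fun a => ⟨φ a.pt⟩
      map := fun {a b} γ => (⟨γ.len + (u b.pt - u a.pt), hu _ _ _ γ.nonneg γ.add_eq, by
        have h := OrientedClass.add_eq γ
        rw [hφ, hφ, AddCircle.coe_add, AddCircle.coe_sub]
        exact (by abel : p a.pt + (u a.pt : Circle1) + ((OrientedClass.len γ : ℝ) + ((u b.pt : Circle1) - u a.pt)) = (p a.pt + (OrientedClass.len γ : ℝ)) + u b.pt).trans (congrArg (· + (u b.pt : Circle1)) h)⟩ :
          OrientedClass (q (φ a.pt)) (q (φ b.pt)))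
      map_id := fun a => OrientedClass.ext (by
        show (0 : ℝ) + (u a.pt - u a.pt) = 0
        ring)
      map_comp := fun {a b c} γ δ => OrientedClass.ext (by
        show (γ.len + δ.len) + (u c.pt - u a.pt) =
          (γ.len + (u b.pt - u a.pt)) + (δ.len + (u c.pt - u b.pt))
        ring) }
  map_one c := OrientedClass.ext (by
    show (1 : ℝ) + (u c.pt - u c.pt) = 1
    ring)

theorem shiftFunctor_congr {A B : Type} {p : A → Circle1} {q : B → Circle1} {φ φ' : A → B}
    {u u' : A → ℝ} {hφ hu hφ' hu'} (h : φ = φ') (h' : ∀ a b, u b - u a = u' b - u' a) :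
    (shiftFunctor φ u hφ hu : onCircle p ⟶ onCircle q) = shiftFunctor φ' u' hφ' hu' := by
  subst h
  refine ZPlusFunctor.ext ?_
  refine CategoryTheory.Functor.hext (fun _ => rfl) fun a b γ => heq_of_eq ?_
  exact OrientedClass.ext (by
    show γ.len + (u b.pt - u a.pt) = γ.len + (u' b.pt - u' a.pt)
    rw [h'])

theorem shiftFunctor_id {A : Type} {p : A → Circle1} {φ : A → A} {u : A → ℝ} {hφ hu}
    (h' : φ = id) (h : ∀ a b, u b - u a = 0) :
    (shiftFunctor φ u hφ hu : onCircle p ⟶ onCircle p) = 𝟙 _ := by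
  subst h'
  refine ZPlusFunctor.ext ?_
  refine CategoryTheory.Functor.hext (fun _ => rfl) fun a b γ => heq_of_eq ?_
  exact OrientedClass.ext (by
    show γ.len + (u b.pt - u a.pt) = γ.len
    rw [h, add_zero])

theorem shiftFunctor_comp {A B C : Type} {p : A → Circle1} {q : B → Circle1} {r : C → Circle1}
    {φ : A → B} {ψ : B → C} {u : A → ℝ} {v : B → ℝ} {χ : A → C} {w : A → ℝ} {hφ hu hψ hv hχ hw}
    (h : χ = ψ ∘ φ) (h' : ∀ a b, w b - w a = (u b - u a) + (v (φ b) - v (φ a))) :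
    (shiftFunctor χ w hχ hw : onCircle p ⟶ onCircle r) =
      (shiftFunctor φ u hφ hu : onCircle p ⟶ onCircle q) ≫ shiftFunctor ψ v hψ hv := by
  subst h
  refine ZPlusFunctor.ext ?_
  refine CategoryTheory.Functor.hext (fun _ => rfl) fun a b γ => heq_of_eq ?_
  exact OrientedClass.ext (by
    show γ.len + (w b.pt - w a.pt) =
      (γ.len + (u b.pt - u a.pt)) + (v (φ b.pt) - v (φ a.pt))
    rw [h']; ring)

theorem exists_int_of_coe_eq {x y : ℝ} (h : (x : Circle1) = y) : ∃ m : ℤ, x = y + m := by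
  have : ((x - y : ℝ) : Circle1) = 0 := by rw [AddCircle.coe_sub, h, sub_self]
  obtain ⟨m, hm⟩ := (AddCircle.coe_eq_zero_iff 1).1 this
  exact ⟨m, by rw [zsmul_eq_mul, mul_one] at hm; linarith⟩


/-- Two paths in the circle with lifts `f`, `f'` are homotopic iff these have the same length. -/
theorem homotopic_iff_len_eq {x y : Circle1} (γ γ' : Path x y) (f f' : C(unitInterval, ℝ))
    (hf : ∀ t, γ t = (f t : Circle1)) (hf' : ∀ t, γ' t = (f' t : Circle1)) :
    γ.Homotopic γ' ↔ f 1 - f 0 = f' 1 - f' 0 := by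
  obtain ⟨m, hm⟩ := exists_int_of_coe_eq (x := f 0) (y := f' 0)
    (by rw [← hf, ← hf', γ.source, γ'.source])
  let f'' : C(unitInterval, ℝ) := ⟨fun t => f' t + m, by fun_prop⟩
  have hm' : ((m : ℝ) : Circle1) = 0 := (AddCircle.coe_eq_zero_iff 1).2 ⟨m, by simp⟩
  have cov : IsCoveringMap ((↑) : ℝ → Circle1) := AddCircle.isCoveringMap_coe 1
  have e1 : γ.toContinuousMap = ContinuousMap.comp ⟨(↑), cov.continuous⟩ f :=
    ContinuousMap.ext hf
  have e2 : γ'.toContinuousMap = ContinuousMap.comp ⟨(↑), cov.continuous⟩ f'' :=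
    ContinuousMap.ext fun t => by
      show γ' t = ((f' t + m : ℝ) : Circle1)
      rw [hf', AddCircle.coe_add, hm', add_zero]
  have h0 : f 0 = f'' 0 := hm
  have key := cov.homotopicRel_iff_comp (f₀ := f) (f₁ := f'') (S := {0, 1}) ⟨0, by simp, h0⟩
  rw [← e1, ← e2] at key
  refine key.symm.trans ⟨fun ⟨H⟩ => ?_, fun h => ?_⟩
  · have h1 : f 1 = f'' 1 := by
      rw [← H.eq_fst 0 (by simp : (1 : unitInterval) ∈ ({0, 1} : Set unitInterval)),
        ← H.eq_snd 0 (by simp : (1 : unitInterval) ∈ ({0, 1} : Set unitInterval))]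
    have h2 : f'' 1 = f' 1 + m := rfl
    linarith
  · have h1 : f 1 = f'' 1 := by
      have h2 : f'' 1 = f' 1 + m := rfl
      linarith
    exact SimplyConnectedSpace.paths_homotopic
      (⟨f, rfl, rfl⟩ : Path (f 0) (f 1)) ⟨f'', h0.symm, h1.symm⟩

/-- Every `OrientedClass` is represented by an oriented path. -/
theorem exists_path_of_class {x y : Circle1} (c : OrientedClass x y) :
    ∃ (γ : Path x y) (f : C(unitInterval, ℝ)), Monotone f ∧ (∀ t, γ t = (f t : Circle1)) ∧
      f 1 - f 0 = c.len := by
  obtain ⟨z, rfl⟩ : ∃ z : ℝ, (z : Circle1) = x := QuotientAddGroup.mk_surjective x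
  let f : C(unitInterval, ℝ) := ⟨fun t => z + t * c.len, by fun_prop⟩
  refine ⟨⟨⟨fun t => (f t : Circle1), (AddCircle.continuous_mk' 1).comp f.continuous⟩, ?_, ?_⟩, f,
    fun s t h => ?_, fun _ => rfl, ?_⟩
  · simp [f]
  · show ((z + ((1 : unitInterval) : ℝ) * c.len : ℝ) : Circle1) = y
    rw [Set.Icc.coe_one, one_mul, AddCircle.coe_add, c.add_eq]
  · have : (s : ℝ) ≤ t := h
    have := mul_le_mul_of_nonneg_right this c.nonneg
    show z + s * c.len ≤ z + t * c.len
    linarith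
  · simp [f]

/-- The `ℤ₊`-functor defined by a nondecreasing map, where the two finite subsets of the circle are
ordered by means of lifts to intervals of length one. It sends the class of the shortest path from
`a` to `b`, for `a` before `b`, to the class of the shortest path from `φ a` to `φ b`. -/
def monotoneFunctor {A B : Type} (p : A → ℝ) (q : B → ℝ)
    (hp : ∀ a b, p a < p b + 1) (hq : ∀ a b, q a < q b + 1)
    (φ : A → B) (hφ : ∀ a b, p a ≤ p b → q (φ a) ≤ q (φ b)) :
    onCircle (fun a => (p a : Circle1)) ⟶ onCircle (fun b => (q b : Circle1)) :=
  shiftFunctor φ (fun a => q (φ a) - p a)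
    (fun a => by rw [AddCircle.coe_sub]; abel)
    (fun a b t h0 h => by
      rw [← AddCircle.coe_add] at h
      obtain ⟨m, hm⟩ := exists_int_of_coe_eq h
      have e : t + (q (φ b) - p b - (q (φ a) - p a)) = m + (q (φ b) - q (φ a)) := by
        linarith
      rw [e]
      rcases le_or_gt (p a) (p b) with hab | hab
      · have h1 : (-1 : ℝ) < m := by have := hp b a; linarith
        have h2 : (0 : ℤ) ≤ m := by
          have : (-1 : ℤ) < m := by exact_mod_cast h1
          omega
        have h3 : (0 : ℝ) ≤ m := by exact_mod_cast h2
        have := hφ a b hab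
        linarith
      · have h1 : (0 : ℝ) < m := by linarith
        have h2 : (1 : ℤ) ≤ m := by
          have : (0 : ℤ) < m := by exact_mod_cast h1
          omega
        have h3 : (1 : ℝ) ≤ m := by exact_mod_cast h2
        have := hq (φ a) (φ b)
        linarith)

theorem monotoneFunctor_id {A : Type} (p : A → ℝ) (hp : ∀ a b, p a < p b + 1) (φ : A → A)
    (hφ : ∀ a b, p a ≤ p b → p (φ a) ≤ p (φ b)) (h : φ = id) :
    monotoneFunctor p p hp hp φ hφ = 𝟙 _ :=
  shiftFunctor_id h fun a b => by simp [h]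

theorem monotoneFunctor_comp {A B C : Type} (p : A → ℝ) (q : B → ℝ) (r : C → ℝ)
    (hp : ∀ a b, p a < p b + 1) (hq : ∀ a b, q a < q b + 1) (hr : ∀ a b, r a < r b + 1)
    (φ : A → B) (hφ : ∀ a b, p a ≤ p b → q (φ a) ≤ q (φ b))
    (ψ : B → C) (hψ : ∀ a b, q a ≤ q b → r (ψ a) ≤ r (ψ b))
    (χ : A → C) (hχ : ∀ a b, p a ≤ p b → r (χ a) ≤ r (χ b)) (h : χ = ψ ∘ φ) :
    monotoneFunctor p r hp hr χ hχ =
      monotoneFunctor p q hp hq φ hφ ≫ monotoneFunctor q r hq hr ψ hψ :=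
  shiftFunctor_comp h fun a b => by subst h; simp only [Function.comp_apply]; ring

/-- The point `k / (n + 1)`. -/
noncomputable def cycPoint (n : ℕ) (k : Fin (n + 1)) : ℝ := (k : ℝ) / (n + 1)

theorem cycPoint_nonneg (n : ℕ) (k : Fin (n + 1)) : 0 ≤ cycPoint n k := by
  unfold cycPoint; positivity

theorem cycPoint_lt_one (n : ℕ) (k : Fin (n + 1)) : cycPoint n k < 1 := by
  unfold cycPoint
  rw [div_lt_one (by positivity)]
  exact_mod_cast k.2

theorem cycPoint_le_iff {n : ℕ} {k l : Fin (n + 1)} : cycPoint n k ≤ cycPoint n l ↔ k ≤ l := by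
  unfold cycPoint
  rw [div_le_div_iff_of_pos_right (by positivity)]
  exact_mod_cast Iff.rfl

theorem cycPoint_lt_add (n : ℕ) (k l : Fin (n + 1)) : cycPoint n k < cycPoint n l + 1 := by
  have := cycPoint_nonneg n l
  have := cycPoint_lt_one n k
  linarith

/-- The `ℤ₊`-category `[n]_cyc`: the set `{0, …, n}` embedded in `ℝ / ℤ` by `k ↦ k / (n + 1)`. -/
noncomputable abbrev cyc (n : ℕ) : ZPlusCat := onCircle fun k : Fin (n + 1) => (cycPoint n k : Circle1)

/-- Connes' cyclic category: the full subcategory formed by the `[n]_cyc`. -/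
abbrev Lambda : Type := InducedCategory ZPlusCat cyc

/-- Being `ℤ₊`-isomorphic to some `[n]_cyc`. -/
def isCyc : ObjectProperty ZPlusCat := fun C => ∃ n, Nonempty (C ≅ cyc n)

/-- The category of `ℤ₊`-categories which are `ℤ₊`-isomorphic to some `[n]_cyc`. -/
abbrev LambdaBig : Type 1 := isCyc.FullSubcategory

/-- The inclusion of the cyclic category. -/
noncomputable def lambdaInclusion : Lambda ⥤ LambdaBig where
  obj n := ⟨cyc n, n, ⟨Iso.refl _⟩⟩
  map f := ObjectProperty.homMk f.hom

instance : lambdaInclusion.IsEquivalence where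
  faithful := ⟨fun {a b f g} h => InducedCategory.hom_ext (congrArg (fun k => k.hom) h)⟩
  full := ⟨fun {a b} f => ⟨InducedCategory.homMk f.hom, rfl⟩⟩
  essSurj := ⟨fun C => by
    obtain ⟨n, ⟨e⟩⟩ := C.property
    exact ⟨n, ⟨ObjectProperty.isoMk _ e.symm⟩⟩⟩

/-- The inclusion of the cyclic category, as an equivalence. -/
noncomputable def lambdaEquivalence : Lambda ≌ LambdaBig := lambdaInclusion.asEquivalence

/-- Cyclic sets. -/
abbrev CyclicSet := Lambdaᵒᵖ ⥤ Type u

/-- The functor from the simplex category to the cyclic category that sends `[n]` to `[n]_cyc`. -/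
noncomputable def simplexToLambda : SimplexCategory ⥤ Lambda where
  obj n := n.len
  map {m n} f := InducedCategory.homMk
    (monotoneFunctor (cycPoint m.len) (cycPoint n.len)
      (cycPoint_lt_add _) (cycPoint_lt_add _) f.toOrderHom fun _ _ h =>
        cycPoint_le_iff.2 (f.toOrderHom.monotone (cycPoint_le_iff.1 h)))
  map_id _ := InducedCategory.hom_ext (monotoneFunctor_id _ (cycPoint_lt_add _) _ (fun _ _ h => h) rfl)
  map_comp f g := InducedCategory.hom_ext (monotoneFunctor_comp _ _ _
    (cycPoint_lt_add _) (cycPoint_lt_add _) (cycPoint_lt_add _)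
    _ (fun _ _ h => cycPoint_le_iff.2 (f.toOrderHom.monotone (cycPoint_le_iff.1 h)))
    _ (fun _ _ h => cycPoint_le_iff.2 (g.toOrderHom.monotone (cycPoint_le_iff.1 h)))
    _ (fun _ _ h => cycPoint_le_iff.2 ((f ≫ g).toOrderHom.monotone (cycPoint_le_iff.1 h))) rfl)

theorem isCyc_onCircle {A : Type} [Finite A] [Nonempty A] {p : A → Circle1}
    (hp : Function.Injective p) : isCyc (onCircle p) := by
  have := Fintype.ofFinite A
  obtain ⟨p', hp', hmem⟩ : ∃ p' : A → ℝ, p = (fun a => (p' a : Circle1)) ∧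
      ∀ a, p' a ∈ Set.Ico (0 : ℝ) 1 :=
    ⟨fun a => AddCircle.equivIco 1 0 (p a), funext fun a => AddCircle.coe_equivIco.symm,
      fun a => by simpa using (AddCircle.equivIco 1 0 (p a)).2⟩
  subst hp'
  have hp1 : ∀ a b, p' a < p' b + 1 := fun a b => by
    have := (hmem a).2; have := (hmem b).1; linarith
  have hinj : Function.Injective p' := fun a b h => hp (congrArg _ h)
  let _ : LinearOrder A := LinearOrder.lift' p' hinj
  obtain ⟨n, hn⟩ : ∃ n, Fintype.card A = n + 1 :=
    Nat.exists_eq_succ_of_ne_zero Fintype.card_ne_zero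
  let e : Fin (n + 1) ≃o A := Fintype.orderIsoFinOfCardEq A hn
  have h1 : ∀ a b, p' a ≤ p' b → cycPoint n (e.symm a) ≤ cycPoint n (e.symm b) :=
    fun a b h => cycPoint_le_iff.2 (e.symm.monotone h)
  have h2 : ∀ a b, cycPoint n a ≤ cycPoint n b → p' (e a) ≤ p' (e b) :=
    fun a b h => e.monotone (cycPoint_le_iff.1 h)
  refine ⟨n, ⟨⟨monotoneFunctor p' (cycPoint n) hp1 (cycPoint_lt_add n) e.symm h1,
    monotoneFunctor (cycPoint n) p' (cycPoint_lt_add n) hp1 e h2, ?_, ?_⟩⟩⟩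
  · exact (monotoneFunctor_comp _ _ _ hp1 (cycPoint_lt_add n) hp1 _ h1 _ h2 id (fun _ _ h => h)
      (by funext; simp)).symm.trans (monotoneFunctor_id _ hp1 _ (fun _ _ h => h) rfl)
  · exact (monotoneFunctor_comp _ _ _ (cycPoint_lt_add n) hp1 (cycPoint_lt_add n) _ h2 _ h1 id
      (fun _ _ h => h) (by funext; simp)).symm.trans
        (monotoneFunctor_id _ (cycPoint_lt_add n) _ (fun _ _ h => h) rfl)


/-- The length of the shortest oriented path from `x` to `y`, in `[0, 1)`. -/
noncomputable def fwd (x y : Circle1) : ℝ := AddCircle.equivIco 1 0 (y - x)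

theorem fwd_nonneg (x y : Circle1) : 0 ≤ fwd x y := (AddCircle.equivIco 1 0 (y - x)).2.1

theorem fwd_lt_one (x y : Circle1) : fwd x y < 1 :=
  (AddCircle.equivIco 1 0 (y - x)).2.2.trans_eq (zero_add 1)

theorem add_fwd (x y : Circle1) : x + (fwd x y : Circle1) = y := by
  rw [fwd, AddCircle.coe_equivIco]; abel

theorem fwd_le {x y : Circle1} {t : ℝ} (ht : 0 ≤ t) (h : x + (t : Circle1) = y) : fwd x y ≤ t := by
  have h' : ((t : ℝ) : Circle1) = (fwd x y : ℝ) := by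
    apply add_left_cancel (a := x); rw [h, add_fwd]
  obtain ⟨m, hm⟩ := exists_int_of_coe_eq h'
  have h1 : (-1 : ℝ) < m := by have := fwd_lt_one x y; linarith
  have h2 : (0 : ℤ) ≤ m := by
    have : (-1 : ℤ) < m := by exact_mod_cast h1
    omega
  have h3 : (0 : ℝ) ≤ m := by exact_mod_cast h2
  linarith

theorem fwd_pos {x y : Circle1} (h : x ≠ y) : 0 < fwd x y := by
  refine lt_of_le_of_ne (fwd_nonneg x y) fun h0 => h ?_
  have := add_fwd x y
  rwa [← h0, AddCircle.coe_zero, add_zero] at this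

/-- Non-empty finite subsets of the circle. -/
abbrev CircleFinset : Type := {F : Finset Circle1 // F.Nonempty}

/-- The length of the shortest oriented path from `x` to a point of `F`. -/
noncomputable def gap (F : CircleFinset) (x : Circle1) : ℝ := F.1.inf' F.2 (fwd x)

theorem gap_nonneg (F : CircleFinset) (x : Circle1) : 0 ≤ gap F x :=
  (Finset.le_inf'_iff F.2 _).2 fun f _ => fwd_nonneg x f

theorem gap_le {F : CircleFinset} {x : Circle1} {t : ℝ} (ht : 0 ≤ t)
    (h : x + (t : Circle1) ∈ F.1) : gap F x ≤ t :=
  (Finset.inf'_le _ h).trans (fwd_le ht rfl)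

theorem add_gap_mem (F : CircleFinset) (x : Circle1) : x + (gap F x : Circle1) ∈ F.1 := by
  obtain ⟨f, hf, h⟩ := Finset.exists_mem_eq_inf' F.2 (fwd x)
  rw [gap, h, add_fwd]; exact hf

theorem gap_lt_one (F : CircleFinset) (x : Circle1) : gap F x < 1 := by
  obtain ⟨f, hf, h⟩ := Finset.exists_mem_eq_inf' F.2 (fwd x)
  rw [gap, h]; exact fwd_lt_one x f

theorem gap_pos {F : CircleFinset} {x : Circle1} (hx : x ∉ F.1) : 0 < gap F x := by
  refine lt_of_le_of_ne (gap_nonneg F x) fun h0 => hx ?_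
  have := add_gap_mem F x
  rwa [← h0, AddCircle.coe_zero, add_zero] at this

theorem gap_le_add (F : CircleFinset) {x y : Circle1} {t : ℝ} (ht : 0 ≤ t)
    (h : x + (t : Circle1) = y) : gap F x ≤ t + gap F y := by
  refine gap_le (add_nonneg ht (gap_nonneg F y)) ?_
  rw [AddCircle.coe_add, ← add_assoc, h]
  exact add_gap_mem F y

theorem gap_add_of_le (F : CircleFinset) {x y : Circle1} {t : ℝ} (ht : 0 ≤ t)
    (h : x + (t : Circle1) = y) (hle : t ≤ gap F x) : gap F y = gap F x - t := by
  refine le_antisymm (gap_le (sub_nonneg.2 hle) ?_) (by linarith [gap_le_add F ht h])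
  rw [← h, AddCircle.coe_sub, add_add_sub_cancel]
  exact add_gap_mem F x

theorem gap_anti {F F' : CircleFinset} (h : F ≤ F') (x : Circle1) : gap F' x ≤ gap F x :=
  gap_le (gap_nonneg F x) (h (add_gap_mem F x))

theorem gap_eq_add {F F' : CircleFinset} (h : F ≤ F') (x : Circle1) :
    gap F x = gap F' x + gap F (x + (gap F' x : Circle1)) := by
  rw [gap_add_of_le F (gap_nonneg F' x) rfl (gap_anti h x)]; ring

theorem continuous_fwd (f : Circle1) : ContinuousOn (fun x => fwd x f) {x | x ≠ f} := by
  intro x hx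
  have h : ContinuousAt (AddCircle.equivIco 1 (0 : ℝ)) (f - x) :=
    AddCircle.continuousAt_equivIco 1 0 (by
      rw [AddCircle.coe_zero, Ne, sub_eq_zero]; exact fun h => hx h.symm)
  have h2 : ContinuousAt (fun x : Circle1 => AddCircle.equivIco 1 (0 : ℝ) (f - x)) x :=
    ContinuousAt.comp (f := fun x : Circle1 => f - x) h (by fun_prop)
  exact (continuous_subtype_val.continuousAt.comp h2).continuousWithinAt

theorem continuous_gap (F : CircleFinset) :
    Continuous fun x : {x : Circle1 // x ∉ F.1} => gap F x := by
  unfold gap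
  refine Continuous.finset_inf'_apply F.2 fun f hf => ?_
  exact (continuous_fwd f).comp_continuous continuous_subtype_val
    fun x => by rintro rfl; exact x.2 hf

/-- The set `π₀(S¹ ∖ F)`. -/
abbrev CirclePi0 (F : CircleFinset) : Type := _root_.ConnectedComponents {x : Circle1 // x ∉ F.1}

/-- The end point (in the positive direction) of a component of `S¹ ∖ F`. -/
noncomputable def endPoint (F : CircleFinset) : CirclePi0 F → F.1 :=
  (Continuous.subtype_mk (continuous_subtype_val.add
    ((AddCircle.continuous_mk' 1).comp (continuous_gap F)))
    fun x : {x : Circle1 // x ∉ F.1} => add_gap_mem F x).connectedComponentsLift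

theorem endPoint_coe (F : CircleFinset) (x : {x : Circle1 // x ∉ F.1}) :
    (endPoint F (x : CirclePi0 F) : Circle1) = x + (gap F x : Circle1) := rfl

theorem circlePi0_eq_of_lt_gap (F : CircleFinset) (x y : {x : Circle1 // x ∉ F.1}) {t : ℝ}
    (ht : 0 ≤ t) (h : (x : Circle1) + (t : Circle1) = y) (hlt : t < gap F x) :
    (x : CirclePi0 F) = (y : CirclePi0 F) := by
  have hF : ∀ s : Set.Icc 0 t, (x : Circle1) + ((s : ℝ) : Circle1) ∉ F.1 := fun s hs => by
    have := gap_le s.2.1 hs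
    have := s.2.2
    linarith
  let c : Set.Icc 0 t → {x : Circle1 // x ∉ F.1} := fun s => ⟨x + ((s : ℝ) : Circle1), hF s⟩
  have hc : Continuous c := Continuous.subtype_mk
    (continuous_const.add ((AddCircle.continuous_mk' 1).comp continuous_subtype_val)) _
  have hpre : _root_.IsPreconnected (Set.range c) := by
    have : PreconnectedSpace (Set.Icc 0 t) := Subtype.preconnectedSpace isPreconnected_Icc
    exact isPreconnected_range hc
  rw [ConnectedComponents.coe_eq_coe']
  exact hpre.subset_connectedComponent
    ⟨⟨t, ht, le_rfl⟩, Subtype.ext h⟩ ⟨⟨0, le_rfl, ht⟩, Subtype.ext (by simp [c])⟩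

theorem endPoint_injective (F : CircleFinset) : Function.Injective (endPoint F) := by
  intro a b
  obtain ⟨x, rfl⟩ := ConnectedComponents.surjective_coe a
  obtain ⟨y, rfl⟩ := ConnectedComponents.surjective_coe b
  intro h
  have h' : (x : Circle1) + (gap F x : Circle1) = y + (gap F y : Circle1) := congrArg Subtype.val h
  have key : ∀ x y : {x : Circle1 // x ∉ F.1},
      (x : Circle1) + (gap F x : Circle1) = y + (gap F y : Circle1) → gap F y ≤ gap F x →
      (x : CirclePi0 F) = (y : CirclePi0 F) := fun x y h hle =>
    circlePi0_eq_of_lt_gap F x y (t := gap F x - gap F y) (by linarith)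
      (by rw [AddCircle.coe_sub, ← add_sub_assoc, h, add_sub_cancel_right])
      (by linarith [gap_pos y.2])
  rcases le_total (gap F y) (gap F x) with hle | hle
  · exact key x y h' hle
  · exact (key y x h'.symm hle).symm

instance (F : CircleFinset) : Finite (CirclePi0 F) :=
  Finite.of_injective _ (endPoint_injective F)

instance (F : CircleFinset) : Nonempty (CirclePi0 F) := by
  have : Infinite Circle1 := (AddCircle.equivIco 1 (0 : ℝ)).infinite_iff.2
    (Set.infinite_coe_iff.2 (Set.Ico_infinite (by simp)))
  obtain ⟨x, hx⟩ := Infinite.exists_notMem_finset F.1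
  exact ⟨((⟨x, hx⟩ : {x : Circle1 // x ∉ F.1}) : CirclePi0 F)⟩

/-- The `ℤ₊`-category `π₀(S¹ ∖ F)`. Its objects are the components of `S¹ ∖ F`; morphisms between two
components are homotopy classes of oriented paths between their end points. Up to a unique
isomorphism it is the quotient of `S¹ ∖ F` which restricts to an isomorphism on every system of
representatives of the components, see `circlePi0Proj_bijective`. -/
noncomputable def circlePi0 (F : CircleFinset) : LambdaBig where
  obj := onCircle fun c : CirclePi0 F => (endPoint F c : Circle1)
  property := isCyc_onCircle (Subtype.val_injective.comp (endPoint_injective F))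

/-- The `ℤ₊`-functor `π_F : S¹ ∖ F → π₀(S¹ ∖ F)`. -/
noncomputable def circlePi0Proj (F : CircleFinset) :
    onCircle (Subtype.val : {x : Circle1 // x ∉ F.1} → Circle1) ⟶ (circlePi0 F).obj :=
  shiftFunctor (fun x => (x : CirclePi0 F)) (fun x => gap F x) (endPoint_coe F)
    fun _ _ _ ht h => by linarith [gap_le_add F ht h]

/-- The restriction of `π_F` to any system of representatives of the components is an isomorphism. -/
theorem circlePi0Proj_bijective (F : CircleFinset) {R : Type} (r : R → {x : Circle1 // x ∉ F.1})
    (hr : Function.Bijective fun a => (r a : CirclePi0 F)) :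
    Function.Bijective (fun a => (circlePi0Proj F).functor.obj ⟨r a⟩) ∧
      ∀ a b, Function.Bijective
        ((circlePi0Proj F).functor.map : ((⟨r a⟩ : OnCircle Subtype.val) ⟶ ⟨r b⟩) → _) := by
  refine ⟨⟨fun a b h => hr.1 (congrArg OnCircle.pt h), fun c => ?_⟩, fun a b => ⟨?_, ?_⟩⟩
  · obtain ⟨a, ha⟩ := hr.2 c.pt
    exact ⟨a, OnCircle.ext ha⟩
  · intro γ δ h
    have h' : γ.len + (gap F (r b) - gap F (r a)) = δ.len + (gap F (r b) - gap F (r a)) :=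
      congrArg OrientedClass.len h
    exact OrientedClass.ext (by linarith)
  · intro γ
    have hγ : (r a : Circle1) + (gap F (r a) : Circle1) + (OrientedClass.len γ : Circle1) =
      (r b : Circle1) + (gap F (r b) : Circle1) := OrientedClass.add_eq γ
    have h0 : 0 ≤ OrientedClass.len γ := OrientedClass.nonneg γ
    have hpos : 0 ≤ OrientedClass.len γ - (gap F (r b) - gap F (r a)) := by
      by_cases hab : a = b
      · subst hab; simpa using h0
      by_contra hneg
      push Not at hneg
      by_cases hlt : gap F (r b) ≤ OrientedClass.len γ
      · linarith [gap_nonneg F (r a)]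
      · push Not at hlt
        have h1 : (r b : Circle1) + ((gap F (r b) - OrientedClass.len γ : ℝ) : Circle1) =
            (r a : Circle1) + (gap F (r a) : Circle1) := by
          rw [AddCircle.coe_sub, ← add_sub_assoc, ← hγ, add_sub_cancel_right]
        have h2 := gap_le (F := F) (by linarith : 0 ≤ gap F (r b) - OrientedClass.len γ)
          (h1 ▸ add_gap_mem F (r a))
        have h3 : OrientedClass.len γ = 0 := by linarith
        rw [h3, sub_zero] at h1
        exact hab (hr.1 (endPoint_injective F (Subtype.ext h1.symm)))
    refine ⟨(⟨_, hpos, ?_⟩ : OrientedClass (r a : Circle1) (r b)), OrientedClass.ext ?_⟩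
    · rw [AddCircle.coe_sub, AddCircle.coe_sub]
      apply add_right_cancel (b := (gap F (r b) : Circle1))
      rw [← hγ]; abel
    · show OrientedClass.len γ - (gap F (r b) - gap F (r a)) + (gap F (r b) - gap F (r a)) = _
      ring

/-- Components of `S¹ ∖ F'` are contained in components of `S¹ ∖ F`. -/
def circlePi0Incl {F F' : CircleFinset} (h : F ≤ F') : CirclePi0 F' → CirclePi0 F :=
  Continuous.connectedComponentsMap
    (f := fun x : {x : Circle1 // x ∉ F'.1} => (⟨x, fun hx => x.2 (h hx)⟩ : {x // x ∉ F.1}))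
    (by fun_prop)

theorem endPoint_incl {F F' : CircleFinset} (h : F ≤ F') (c : CirclePi0 F') :
    (endPoint F (circlePi0Incl h c) : Circle1) =
      endPoint F' c + (gap F (endPoint F' c) : Circle1) := by
  obtain ⟨x, rfl⟩ := ConnectedComponents.surjective_coe c
  show (x : Circle1) + (gap F x : Circle1) = _
  rw [gap_eq_add h, AddCircle.coe_add, ← add_assoc]
  rfl

/-- The underlying `ℤ₊`-functor of `circlePi0Map`. -/
noncomputable def circlePi0MapHom {F F' : CircleFinset} (h : F ≤ F') :
    onCircle (fun c : CirclePi0 F' => (endPoint F' c : Circle1)) ⟶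
      onCircle fun c : CirclePi0 F => (endPoint F c : Circle1) :=
  shiftFunctor (circlePi0Incl h) (fun c => gap F (endPoint F' c)) (endPoint_incl h)
    fun _ _ _ ht h => by linarith [gap_le_add F ht h]

theorem circlePi0MapHom_refl (F : CircleFinset) : circlePi0MapHom (le_refl F) = 𝟙 _ := by
  refine shiftFunctor_id ?_ ?_
  · funext c
    obtain ⟨x, rfl⟩ := ConnectedComponents.surjective_coe c
    rfl
  · intro a b
    have : ∀ c, gap F (endPoint F c) = 0 := fun c =>
      le_antisymm (gap_le le_rfl (by simp)) (gap_nonneg _ _)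
    simp [this]

theorem circlePi0MapHom_trans {F F' F'' : CircleFinset} (h : F ≤ F') (h' : F' ≤ F'') :
    circlePi0MapHom (h.trans h') = circlePi0MapHom h' ≫ circlePi0MapHom h := by
  refine shiftFunctor_comp ?_ ?_
  · funext c
    obtain ⟨x, rfl⟩ := ConnectedComponents.surjective_coe c
    rfl
  · have : ∀ c, gap F (endPoint F'' c) =
        gap F' (endPoint F'' c) + gap F (endPoint F' (circlePi0Incl h' c)) := fun c => by
      rw [endPoint_incl, ← gap_eq_add h]
    intro a b
    rw [this a, this b]
    ring

/-- The `ℤ₊`-functor `Φ : π₀(S¹ ∖ F') → π₀(S¹ ∖ F)` for `F ⊆ F'`. -/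
noncomputable def circlePi0Map {F F' : CircleFinset} (h : F ≤ F') : circlePi0 F' ⟶ circlePi0 F :=
  ObjectProperty.homMk (circlePi0MapHom h)

/-- The functor `Φ` satisfies `Φ π_{F'} = π_F` on `S¹ ∖ F'`. -/
theorem circlePi0Proj_map {F F' : CircleFinset} (h : F ≤ F') :
    circlePi0Proj F' ≫ (circlePi0Map h).hom =
      shiftFunctor (p := (Subtype.val : {x : Circle1 // x ∉ F'.1} → Circle1))
        (q := (Subtype.val : {x : Circle1 // x ∉ F.1} → Circle1))
        (fun x => ⟨x, fun hx => x.2 (h hx)⟩) 0 (by simp) (fun _ _ _ ht _ => by simpa using ht) ≫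
          circlePi0Proj F := by
  refine (shiftFunctor_comp (χ := fun x : {x : Circle1 // x ∉ F'.1} => circlePi0Incl h x) (w := fun x => gap F x)
    (hχ := fun x => rfl) (hw := fun _ _ _ ht h => by linarith [gap_le_add F ht h])
    rfl fun a b => ?_).symm.trans (shiftFunctor_comp rfl fun a b => ?_)
  · simp only [endPoint_coe]
    rw [gap_eq_add h a, gap_eq_add h b]; ring
  · simp

/-- The projective system of the `π₀(S¹ ∖ F)`, where `F` runs through the non-empty finite subsets. -/
noncomputable def circlePi0Functor : CircleFinsetᵒᵖ ⥤ LambdaBig where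
  obj F := circlePi0 F.unop
  map i := circlePi0Map (leOfHom i.unop)
  map_id F := ObjectProperty.hom_ext _ (circlePi0MapHom_refl F.unop)
  map_comp i j := ObjectProperty.hom_ext _ (circlePi0MapHom_trans (leOfHom j.unop) (leOfHom i.unop))

/-- The displacement, as a function on the circle, of a nondecreasing map `ℝ → ℝ` which commutes with
`x ↦ x + 1`. -/
noncomputable def degShift (f : CircleDeg1Lift) (z : Circle1) : ℝ :=
  f (AddCircle.equivIco 1 0 z) - AddCircle.equivIco 1 0 z

theorem degShift_coe (f : CircleDeg1Lift) (x : ℝ) : degShift f x = f x - x := by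
  have h : (((AddCircle.equivIco 1 0 (x : Circle1) : ℝ)) : Circle1) = x := AddCircle.coe_equivIco
  obtain ⟨m, hm⟩ := exists_int_of_coe_eq h
  rw [degShift, hm, f.map_add_int]; ring

theorem degShift_le (f : CircleDeg1Lift) {x y : Circle1} {t : ℝ} (ht : 0 ≤ t)
    (h : x + (t : Circle1) = y) : 0 ≤ t + (degShift f y - degShift f x) := by
  induction x using QuotientAddGroup.induction_on with
  | H x =>
    have h' : y = ((x + t : ℝ) : Circle1) := h.symm
    rw [h', degShift_coe, show degShift f ((x : ℝ) : Circle1) = f x - x from degShift_coe f x]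
    have := f.monotone (by linarith : x ≤ x + t)
    linarith

/-- The group of orientation preserving homeomorphisms of the circle: those which lift to an
increasing homeomorphism of the line commuting with `x ↦ x + 1`. -/
def AutCircle : Subgroup (Circle1 ≃ₜ Circle1) where
  carrier := {g | ∃ f : ℝ ≃o ℝ, (∀ x, f (x + 1) = f x + 1) ∧ ∀ x : ℝ, g x = (f x : ℝ)}
  mul_mem' := by
    rintro a b ⟨f, hf, hfa⟩ ⟨f', hf', hfb⟩
    refine ⟨f'.trans f, fun x => by simp [hf, hf'], fun x => ?_⟩
    show a (b x) = _
    rw [hfb, hfa]; rfl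
  one_mem' := ⟨OrderIso.refl ℝ, fun _ => rfl, fun _ => rfl⟩
  inv_mem' := by
    rintro a ⟨f, hf, hfa⟩
    refine ⟨f.symm, fun x => ?_, fun x => ?_⟩
    · rw [OrderIso.symm_apply_eq, hf, OrderIso.apply_symm_apply]
    · show a.symm x = _
      rw [Homeomorph.symm_apply_eq, hfa, OrderIso.apply_symm_apply]

/-- An increasing lift to the line of an orientation preserving homeomorphism. -/
noncomputable def circleLift (g : AutCircle) : ℝ ≃o ℝ := g.2.choose

/-- The same lift, as a nondecreasing map of degree one. -/
noncomputable def circleLiftDeg (g : AutCircle) : CircleDeg1Lift where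
  toFun := circleLift g
  monotone' := (circleLift g).monotone
  map_add_one' := g.2.choose_spec.1

theorem circleLift_coe (g : AutCircle) (x : ℝ) : g.1 x = (circleLift g x : ℝ) :=
  g.2.choose_spec.2 x

theorem autCircle_apply (g : AutCircle) (z : Circle1) :
    g.1 z = z + (degShift (circleLiftDeg g) z : Circle1) := by
  induction z using QuotientAddGroup.induction_on with
  | H x =>
    show g.1 ((x : ℝ) : Circle1) =
      ((x : ℝ) : Circle1) + ((degShift (circleLiftDeg g) ((x : ℝ) : Circle1) : ℝ) : Circle1)
    rw [degShift_coe, circleLift_coe, AddCircle.coe_sub]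
    exact (add_sub_cancel _ _).symm

theorem gap_autCircle (g : AutCircle) {F F' : CircleFinset} (h : ∀ z, z ∈ F.1 ↔ g.1 z ∈ F'.1)
    (z : Circle1) : gap F' (g.1 z) = gap F z +
      (degShift (circleLiftDeg g) (z + (gap F z : Circle1)) - degShift (circleLiftDeg g) z) := by
  refine le_antisymm (gap_le (degShift_le _ (gap_nonneg F z) rfl) ?_) ?_
  · have e : g.1 z + ((gap F z + (degShift (circleLiftDeg g) (z + (gap F z : Circle1)) -
        degShift (circleLiftDeg g) z) : ℝ) : Circle1) = g.1 (z + (gap F z : Circle1)) := by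
      rw [autCircle_apply, autCircle_apply g (z + _), AddCircle.coe_add, AddCircle.coe_sub]; abel
    rw [e]
    exact (h _).1 (add_gap_mem F z)
  · induction z using QuotientAddGroup.induction_on with
    | H x =>
      have key : ∀ s : ℝ, 0 ≤ s → g.1 ((x : ℝ) : Circle1) + (s : Circle1) ∈ F'.1 →
          circleLift g (x + gap F ((x : ℝ) : Circle1)) - circleLift g x ≤ s := by
        intro s hs hmem
        let y := (circleLift g).symm (circleLift g x + s)
        have hy : circleLift g y = circleLift g x + s := OrderIso.apply_symm_apply _ _
        have hxy : x ≤ y := by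
          rw [← (circleLift g).le_iff_le, hy]; linarith
        have hyF : ((y : ℝ) : Circle1) ∈ F.1 := by
          rw [h, circleLift_coe, hy, AddCircle.coe_add, ← circleLift_coe]; exact hmem
        have hle : gap F ((x : ℝ) : Circle1) ≤ y - x :=
          gap_le (by linarith) (by rw [← AddCircle.coe_add, add_sub_cancel]; exact hyF)
        have := (circleLift g).monotone (by linarith : x + gap F ((x : ℝ) : Circle1) ≤ y)
        linarith
      refine le_trans (le_of_eq ?_) (key _ (gap_nonneg _ _) (add_gap_mem F' _))
      show gap F ((x : ℝ) : Circle1) + (degShift (circleLiftDeg g) (((x : ℝ) : Circle1) +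
        ((gap F ((x : ℝ) : Circle1) : ℝ) : Circle1)) - degShift (circleLiftDeg g) ((x : ℝ) : Circle1)) = _
      rw [← AddCircle.coe_add, degShift_coe, degShift_coe]
      show _ + (circleLift g _ - _ - (circleLift g _ - _)) = _
      ring

/-- `g` maps components of `S¹ ∖ F` to components of `S¹ ∖ g(F)`. -/
def circlePi0AutFun (g : AutCircle) {F F' : CircleFinset} (h : ∀ z, z ∈ F.1 ↔ g.1 z ∈ F'.1) :
    CirclePi0 F → CirclePi0 F' :=
  Continuous.connectedComponentsMap
    (f := fun x : {x : Circle1 // x ∉ F.1} =>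
      (⟨g.1 x, fun hx => x.2 ((h _).2 hx)⟩ : {x // x ∉ F'.1})) (by fun_prop)

theorem endPoint_aut (g : AutCircle) {F F' : CircleFinset} (h : ∀ z, z ∈ F.1 ↔ g.1 z ∈ F'.1)
    (c : CirclePi0 F) : (endPoint F' (circlePi0AutFun g h c) : Circle1) =
      endPoint F c + (degShift (circleLiftDeg g) (endPoint F c) : Circle1) := by
  obtain ⟨x, rfl⟩ := ConnectedComponents.surjective_coe c
  show g.1 (x : Circle1) + (gap F' (g.1 x) : Circle1) = _
  rw [gap_autCircle g h, autCircle_apply, endPoint_coe, AddCircle.coe_add, AddCircle.coe_sub]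
  abel

/-- The isomorphism `π₀(S¹ ∖ F) → π₀(S¹ ∖ F')` induced by `g` when `F' = g(F)`. -/
noncomputable def circlePi0Aut (g : AutCircle) {F F' : CircleFinset}
    (h : ∀ z, z ∈ F.1 ↔ g.1 z ∈ F'.1) : circlePi0 F ⟶ circlePi0 F' :=
  ObjectProperty.homMk (shiftFunctor (circlePi0AutFun g h)
    (fun c => degShift (circleLiftDeg g) (endPoint F c)) (endPoint_aut g h)
    fun _ _ _ ht h => degShift_le _ ht h)

/-- `circlePi0Aut g` is the map induced on the quotients `π_F`, `π_{F'}` by the `ℤ₊`-functor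
`S¹ ∖ F → S¹ ∖ F'` given by `g`. -/
theorem circlePi0Proj_aut (g : AutCircle) {F F' : CircleFinset}
    (h : ∀ z, z ∈ F.1 ↔ g.1 z ∈ F'.1) :
    circlePi0Proj F ≫ (circlePi0Aut g h).hom =
      shiftFunctor (p := (Subtype.val : {x : Circle1 // x ∉ F.1} → Circle1))
        (q := (Subtype.val : {x : Circle1 // x ∉ F'.1} → Circle1))
        (fun x => ⟨g.1 x, fun hx => x.2 ((h _).2 hx)⟩)
        (fun x => degShift (circleLiftDeg g) x) (fun x => autCircle_apply g x)
        (fun _ _ _ ht h => degShift_le _ ht h) ≫ circlePi0Proj F' := by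
  have e : ∀ x : {x : Circle1 // x ∉ F.1},
      gap F x + degShift (circleLiftDeg g) (endPoint F (x : CirclePi0 F)) =
        degShift (circleLiftDeg g) x + gap F' (g.1 x) := fun x => by
    rw [gap_autCircle g h, endPoint_coe]; ring
  refine (shiftFunctor_comp (χ := fun x : {x : Circle1 // x ∉ F.1} => circlePi0AutFun g h x)
    (w := fun x => gap F x + degShift (circleLiftDeg g) (endPoint F (x : CirclePi0 F)))
    (hχ := fun x => ?_) (hw := fun a b t ht hab => ?_) rfl fun a b => by ring).symm.trans
      (shiftFunctor_comp rfl fun a b => ?_)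
  · rw [endPoint_aut, AddCircle.coe_add, ← add_assoc, endPoint_coe]
  · have h1 := gap_le_add F ht hab
    have h2 := degShift_le (circleLiftDeg g) (x := endPoint F (a : CirclePi0 F))
      (y := endPoint F (b : CirclePi0 F)) (t := t + (gap F b - gap F a)) (by linarith) (by
        rw [endPoint_coe, endPoint_coe, ← hab, AddCircle.coe_add, AddCircle.coe_sub]; abel)
    linarith
  · rw [e, e]; ring

/-- The image of `F` under `g`. -/
noncomputable def circleImage (g : AutCircle) (F : CircleFinset) : CircleFinset :=
  ⟨F.1.map g.1.toEquiv.toEmbedding, F.2.map⟩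

theorem mem_circleImage (g : AutCircle) (F : CircleFinset) (z : Circle1) :
    z ∈ (circleImage g F).1 ↔ (g⁻¹).1 z ∈ F.1 := by
  show z ∈ F.1.map g.1.toEquiv.toEmbedding ↔ g.1.symm z ∈ F.1
  simp

/-- The compact-open topology. -/
noncomputable instance : TopologicalSpace AutCircle :=
  TopologicalSpace.induced (fun g => (⟨g.1, g.1.continuous⟩ : C(Circle1, Circle1)))
    ContinuousMap.compactOpen

/-- Lifts to the line of `n + 1` points of the circle in the correct cyclic order. -/
def SimLift (n : ℕ) : Type :=
  {x : Fin (n + 1) → ℝ // Monotone x ∧ x (Fin.last n) ≤ x 0 + 1}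

instance (n : ℕ) : TopologicalSpace (SimLift n) :=
  inferInstanceAs (TopologicalSpace {x : Fin (n + 1) → ℝ // Monotone x ∧ x (Fin.last n) ≤ x 0 + 1})

/-- Two lifts are equivalent if they differ by an integral translation. -/
def simSetoid (n : ℕ) : Setoid (SimLift n) where
  r x y := ∃ m : ℤ, ∀ i, y.1 i = x.1 i + m
  iseqv :=
    { refl := fun x => ⟨0, by simp⟩
      symm := fun ⟨m, h⟩ => ⟨-m, fun i => by rw [h i]; push_cast; ring⟩
      trans := fun ⟨m, h⟩ ⟨m', h'⟩ => ⟨m + m', fun i => by rw [h' i, h i]; push_cast; ring⟩ }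

/-- The space of `(n + 1)`-tuples of points of the circle in the correct cyclic order: tuples
`x₀ ≤ … ≤ x_n ≤ x₀ + 1` of real numbers up to simultaneous translation by an integer. -/
def SimCyc (n : ℕ) : Type := Quotient (simSetoid n)

instance (n : ℕ) : TopologicalSpace (SimCyc n) :=
  inferInstanceAs (TopologicalSpace (Quotient (simSetoid n)))

/-- The set `{x₀, …, x_n}` in the circle. -/
noncomputable def simPoints {n : ℕ} (x : SimLift n) : CircleFinset :=
  open Classical in ⟨Finset.univ.image fun i => (x.1 i : Circle1), Finset.univ_nonempty.image _⟩

/-- The nondecreasing step function on the line, with `stepIndex x (y + 1) = stepIndex x y + n + 1`,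
which is equal to `i` for `x_{i-1} < y < x_i` (where `x_{-1} = x_n - 1`). It is left continuous. -/
noncomputable def stepIndex {n : ℕ} (x : SimLift n) (y : ℝ) : ℤ := ∑ i, ⌈y - x.1 i⌉

theorem stepIndex_mono {n : ℕ} (x : SimLift n) : Monotone (stepIndex x) := fun _ _ h =>
  Finset.sum_le_sum fun _ _ => Int.ceil_mono (by linarith)

theorem stepIndex_add_one {n : ℕ} (x : SimLift n) (y : ℝ) :
    stepIndex x (y + 1) = stepIndex x y + (n + 1) := by
  have : ∀ i, ⌈y + 1 - x.1 i⌉ = ⌈y - x.1 i⌉ + 1 := fun i => by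
    rw [← Int.ceil_add_one]; congr 1; ring
  simp [stepIndex, this, Finset.sum_add_distrib]

/-- `stepIndex` divided by `n + 1`. -/
noncomputable def stepDeg {n : ℕ} (x : SimLift n) : CircleDeg1Lift where
  toFun y := (stepIndex x y : ℝ) / (n + 1)
  monotone' _ _ h := div_le_div_of_nonneg_right (by exact_mod_cast stepIndex_mono x h) (by positivity)
  map_add_one' y := by
    rw [stepIndex_add_one]; push_cast; field_simp

/-- The residue of an integer modulo `n + 1`. -/
noncomputable def finOfInt (n : ℕ) (k : ℤ) : Fin (n + 1) :=
  ⟨(k % (n + 1 : ℕ)).toNat, by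
    have := Int.emod_nonneg k (by omega : ((n + 1 : ℕ) : ℤ) ≠ 0)
    have := Int.emod_lt_of_pos k (by omega : (0 : ℤ) < ((n + 1 : ℕ) : ℤ))
    omega⟩

theorem cycPoint_finOfInt (n : ℕ) (k : ℤ) :
    (cycPoint n (finOfInt n k) : Circle1) = ((k / (n + 1) : ℝ) : Circle1) := by
  have h0 := Int.emod_nonneg k (by omega : ((n + 1 : ℕ) : ℤ) ≠ 0)
  have h : ((k : ℝ) / (n + 1)) = cycPoint n (finOfInt n k) + ((k / (n + 1 : ℕ) : ℤ) : ℝ) := by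
    have h1 : ((finOfInt n k : ℕ) : ℝ) = ((k % (n + 1 : ℕ) : ℤ) : ℝ) := by
      show (((k % (n + 1 : ℕ)).toNat : ℕ) : ℝ) = _
      exact_mod_cast congrArg (fun z : ℤ => (z : ℝ)) (Int.toNat_of_nonneg h0)
    have h2 : (k : ℝ) = ((k % (n + 1 : ℕ) : ℤ) : ℝ) + (n + 1) * ((k / (n + 1 : ℕ) : ℤ) : ℝ) := by
      have := Int.emod_add_mul_ediv k (n + 1 : ℕ)
      exact_mod_cast this.symm
    rw [cycPoint, h1]
    field_simp
    linarith
  rw [h, AddCircle.coe_add]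
  have : (((k / (n + 1 : ℕ) : ℤ) : ℝ) : Circle1) = 0 :=
    (AddCircle.coe_eq_zero_iff 1).2 ⟨k / (n + 1 : ℕ), by simp⟩
  rw [this, add_zero]

/-- The value of the step function on a component of `S¹ ∖ {x₀, …, x_n}`, computed at its end point
(by left continuity), modulo `n + 1`; see `stepFun_coe`. -/
noncomputable def stepFun {n : ℕ} (x : SimLift n) (c : CirclePi0 (simPoints x)) : Fin (n + 1) :=
  finOfInt n (stepIndex x (AddCircle.equivIco 1 0 (endPoint (simPoints x) c : Circle1)))

/-- The piecewise constant `ℤ₊`-functor `S¹ ∖ {x₀, …, x_n} → [n]_cyc` attached to `(x₀, …, x_n)`, as a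
morphism from `π₀(S¹ ∖ {x₀, …, x_n})` to `[n]_cyc`. It sends the arc between `x_{i-1}` and `x_i` to `i`,
and an oriented path which crosses `x_i, …, x_{j-1}` to the composition `i → i + 1 → … → j`. -/
noncomputable def simStep {n : ℕ} (x : SimLift n) :
    circlePi0 (simPoints x) ⟶ lambdaEquivalence.functor.obj n :=
  ObjectProperty.homMk (shiftFunctor (stepFun x)
    (fun c => degShift (stepDeg x) (endPoint (simPoints x) c))
    (fun c => by
      rw [stepFun, cycPoint_finOfInt, degShift, AddCircle.coe_sub, AddCircle.coe_equivIco,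
        add_sub_cancel]
      rfl)
    fun _ _ _ ht h => degShift_le _ ht h)

theorem finOfInt_add (n : ℕ) (k m : ℤ) : finOfInt n (k + m * (n + 1)) = finOfInt n k := by
  refine Fin.ext ?_
  show ((k + m * (n + 1)) % (n + 1 : ℕ)).toNat = (k % (n + 1 : ℕ)).toNat
  rw [show (k + m * (n + 1) : ℤ) = k + (n + 1 : ℕ) * m by push_cast; ring,
    Int.add_mul_emod_self_left]

theorem stepIndex_add_int {n : ℕ} (x : SimLift n) (y : ℝ) (m : ℤ) :
    stepIndex x (y + m) = stepIndex x y + m * (n + 1) := by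
  have : ∀ i, ⌈y + m - x.1 i⌉ = ⌈y - x.1 i⌉ + m := fun i => by
    rw [← Int.ceil_add_intCast]; congr 1; ring
  simp [stepIndex, this, Finset.sum_add_distrib]; ring

/-- The component of a point `y` is sent to the value of the step function at `y`. -/
theorem stepFun_coe {n : ℕ} (x : SimLift n) (y : ℝ) (hy : (y : Circle1) ∉ (simPoints x).1) :
    stepFun x ((⟨y, hy⟩ : {z : Circle1 // z ∉ (simPoints x).1}) : CirclePi0 (simPoints x)) =
      finOfInt n (stepIndex x y) := by
  have h1 : ((AddCircle.equivIco 1 (0 : ℝ) (((y : Circle1) +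
      (gap (simPoints x) (y : Circle1) : Circle1))) : ℝ) : Circle1) =
      ((y + gap (simPoints x) (y : Circle1) : ℝ) : Circle1) := by
    rw [AddCircle.coe_equivIco, AddCircle.coe_add]
  obtain ⟨m, hm⟩ := exists_int_of_coe_eq h1
  rw [stepFun, endPoint_coe, hm, stepIndex_add_int, finOfInt_add]
  congr 1
  refine Finset.sum_congr rfl fun i _ => le_antisymm ?_ (Int.ceil_mono (by
    linarith [gap_nonneg (simPoints x) (y : Circle1)]))
  rw [Int.ceil_le]
  by_contra hlt
  push Not at hlt
  have h2 := Int.le_ceil (y - x.1 i)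
  have h3 : (y : Circle1) + ((x.1 i + ⌈y - x.1 i⌉ - y : ℝ) : Circle1) ∈ (simPoints x).1 := by
    rw [← AddCircle.coe_add, add_sub_cancel, AddCircle.coe_add]
    have : (((⌈y - x.1 i⌉ : ℤ) : ℝ) : Circle1) = 0 :=
      (AddCircle.coe_eq_zero_iff 1).2 ⟨⌈y - x.1 i⌉, by simp⟩
    rw [this, add_zero]
    simp [simPoints]
  have := gap_le (by linarith) h3
  linarith

/-- The extension of a cyclic set to all `ℤ₊`-categories isomorphic to some `[n]_cyc`. -/
noncomputable abbrev cyclicBig (X : CyclicSet.{u}) : LambdaBigᵒᵖ ⥤ Type u :=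
  extendAlong lambdaEquivalence X

/-- The geometric realization of a cyclic set as a set: the direct limit of `X(π₀(S¹ ∖ F))` over the
non-empty finite subsets `F` of the circle. -/
noncomputable def CyclicRealization (X : CyclicSet.{u}) : Type u :=
  Limits.colimit (circlePi0Functor.rightOp ⋙ cyclicBig X)

/-- The class in `|X|` of an element of `X(π₀(S¹ ∖ F))`. -/
noncomputable def CyclicRealization.mk (X : CyclicSet.{u}) (F : CircleFinset)
    (x : (cyclicBig X).obj (op (circlePi0 F))) : CyclicRealization X :=
  Limits.colimit.ι (circlePi0Functor.rightOp ⋙ cyclicBig X) F x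

/-- The map `(x₀, …, x_n) ↦ [φ^* x]` to `|X|` defined by `x ∈ X([n]_cyc)`, where `φ` is the piecewise
constant functor attached to `(x₀, …, x_n)`. -/
noncomputable def CyclicRealization.charMap (X : CyclicSet.{u}) {n : ℕ}
    (x : X.obj (op (n : Lambda))) (s : SimLift n) : CyclicRealization X :=
  .mk X (simPoints s) (pullback lambdaEquivalence X (simStep s) x)

/-- The point `(x₁, …, x_n)` of the standard simplex gives `n + 1` points `x₁ ≤ … ≤ x_n ≤ 1`; the
attached functor on the circle is the step function on `[0, 1]` equal to `i` on `(x_i, x_{i+1})`. -/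
def Simplex.toSimLift {n : ℕ} (s : Simplex n) : SimLift n :=
  ⟨Fin.snoc (α := fun _ => ℝ) (fun i => (s.1 i : ℝ)) 1, by
    intro i j hij
    induction j using Fin.lastCases with
    | last =>
      induction i using Fin.lastCases with
      | last => exact le_rfl
      | cast i => simpa using (s.1 i).2.2
    | cast j =>
      induction i using Fin.lastCases with
      | last => exact absurd hij (not_le_of_gt (Fin.castSucc_lt_last j))
      | cast i => simpa using s.2 (Fin.castSucc_le_castSucc_iff.1 hij), by
    have h : ∀ i, (0 : ℝ) ≤ Fin.snoc (α := fun _ => ℝ) (fun i => (s.1 i : ℝ)) 1 i := fun i => by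
      induction i using Fin.lastCases with
      | last => simp
      | cast i => simpa using (s.1 i).2.1
    rw [Fin.snoc_last]
    linarith [h 0]⟩

/-- The standard topology of `|X|`: the finest one for which the maps from the standard simplices
given by the simplices of the underlying simplicial set are continuous. -/
noncomputable instance (X : CyclicSet.{u}) : TopologicalSpace (CyclicRealization X) :=
  ⨆ (n : ℕ) (x : X.obj (op (n : Lambda))),
    TopologicalSpace.coinduced (fun s : Simplex n => CyclicRealization.charMap X x s.toSimLift)
      inferInstance

/-- A cyclic set considered as a simplicial set. -/
noncomputable def underlyingSSet (X : CyclicSet.{u}) : SSet.{u} := simplexToLambda.op ⋙ X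

/-- The cyclic set represented by `[n]_cyc`. -/
noncomputable abbrev cyclicSimplex (n : ℕ) : CyclicSet.{0} :=
  (yoneda : Lambda ⥤ CyclicSet.{0}).obj n

/-- The identity of `[n]_cyc`, as an element of the cyclic set represented by it. -/
noncomputable def cyclicSimplexId (n : ℕ) : (cyclicSimplex n).obj (op (n : Lambda)) :=
  CategoryStruct.id (obj := Lambda) n

end Realization

open Realization

/-! A point `x₁ ≤ … ≤ xₙ` of a standard simplex is the same thing as its step function on the
interval, and the simplicial operators act by composing this step function with a monotone map
(`Simplex.index_map`). Sorting the points of a finite set `G` that lie in the open interval gives an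
interior point of a simplex, whose step function identifies `π₀(I ∖ G)` with `[k]`. Hence every
element of the direct limit is given by a simplex of `X` and a point of a standard simplex, and two
such pairs agree exactly when both are obtained from one point by operators that pull the two
simplices back to the same one. This is the usual coend description, isolated as
`IsSimplexQuotient`.

On the circle, a cyclically ordered tuple is encoded by a nondecreasing step function from the line
to the integers that grows by `n + 1` over each period, and morphisms `[k]_cyc → [n]_cyc` come from
periodic monotone maps of integers, again acting by composition (`stepMor_cycHom`,
`CyclicRealization.charMap_cycHom`). Finite sets containing the base point are cofinal, and cutting
the circle there reduces to the interval. So the cyclic realization is an `IsSimplexQuotient` of the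
underlying simplicial set, and two quotients of one simplicial set are canonically homeomorphic.

A homeomorphism `g` acts because it carries the system of the `π₀` of complements to itself. Its
lift to the line is fixed only up to an integer, but `ℤ₊`-functors see only differences of
displacements. On characteristic maps `g` simply moves the tuple. Continuity on `Aut S¹ × Δⁿ` rests
on two facts: characteristic maps are continuous on all cyclic tuples, since locally a tuple can be
rolled into a simplex of dimension `n + 1`; and both the point `g(0)` of the circle and the
increments of a lift depend continuously on `g`. The passage to compact `K` uses that characteristic
maps are proper and that `K` lies in finitely many simplices.

For the represented cyclic set, surjectivity comes from pushing tuples forward along periodic maps,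
injectivity from the adjunction `stepIndex_le_iff`, which recovers a tuple from its step function.
The map is closed because the integral translations have a compact fundamental domain. -/

namespace Realization

/-! ### The cosimplicial structure of the standard simplices -/

theorem countBelow_le {n : ℕ} (s : Fin n → unitInterval) (y : unitInterval) :
    countBelow s y ≤ n :=
  (Finset.card_le_univ _).trans (by simp)

/-- The indices with `s i < y` form an initial segment, so their number decides membership. -/
theorem lt_iff_lt_countBelow {n : ℕ} {s : Fin n → unitInterval} (hs : Monotone s) (i : Fin n)
    (y : unitInterval) : s i < y ↔ (i : ℕ) < countBelow s y := by
  constructor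
  · intro h
    have : (Finset.Iic i).card ≤ countBelow s y := Finset.card_le_card fun j hj => by
      simp only [Finset.mem_filter, Finset.mem_univ, true_and]
      exact (hs (Finset.mem_Iic.1 hj)).trans_lt h
    rw [Fin.card_Iic] at this
    omega
  · intro h
    by_contra hlt
    have : countBelow s y ≤ (Finset.Iio i).card := Finset.card_le_card fun j hj => by
      simp only [Finset.mem_filter, Finset.mem_univ, true_and] at hj
      refine Finset.mem_Iio.2 (lt_of_not_ge fun hij => hlt ((hs hij).trans_lt hj))
    rw [Fin.card_Iio] at this
    omega

/-- The sequence `0, x₁, …, x_n, 1, 1, …`. -/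
def Simplex.vertex {n : ℕ} (s : Simplex n) (l : ℕ) : unitInterval :=
  if l = 0 then 0 else if h : l - 1 < n then s.1 ⟨l - 1, h⟩ else 1

theorem Simplex.vertex_zero {n : ℕ} (s : Simplex n) : s.vertex 0 = 0 := rfl

theorem Simplex.vertex_succ {n : ℕ} (s : Simplex n) (i : Fin n) : s.vertex (i + 1) = s.1 i := by
  simp [vertex]

theorem Simplex.vertex_of_lt {n : ℕ} (s : Simplex n) {l : ℕ} (h : n < l) : s.vertex l = 1 := by
  rw [vertex, if_neg (by omega), dif_neg (by omega)]

theorem Simplex.vertex_mono {n : ℕ} (s : Simplex n) : Monotone s.vertex := by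
  intro a b h
  by_cases ha : a = 0
  · subst ha; exact unitInterval.nonneg'
  by_cases hb : n < b
  · rw [s.vertex_of_lt hb]; exact unitInterval.le_one'
  obtain ⟨i, rfl⟩ : ∃ i : Fin n, a = i + 1 := ⟨⟨a - 1, by omega⟩, by simp; omega⟩
  obtain ⟨j, rfl⟩ : ∃ i : Fin n, b = i + 1 := ⟨⟨b - 1, by omega⟩, by simp; omega⟩
  rw [vertex_succ, vertex_succ]
  exact s.2 (by rw [Fin.le_def]; omega)

theorem Simplex.continuous_vertex (n l : ℕ) : Continuous fun s : Simplex n => s.vertex l := by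
  unfold vertex
  split_ifs with h h'
  · exact continuous_const
  · exact (continuous_apply (⟨l - 1, h'⟩ : Fin n)).comp continuous_subtype_val
  · exact continuous_const

/-- The only excluded case is `l = 0`, `y = 0`, where the added vertex `0` is not below `y` although
`0 ≤ countBelow s.1 y`. -/
theorem Simplex.vertex_lt_iff {n : ℕ} (s : Simplex n) (l : ℕ) {y : unitInterval}
    (h : l ≠ 0 ∨ 0 < y) : s.vertex l < y ↔ l ≤ countBelow s.1 y := by
  by_cases hl : l = 0
  · subst hl
    simpa [vertex_zero] using h
  by_cases hn : n < l
  · rw [s.vertex_of_lt hn]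
    have := countBelow_le s.1 y
    exact ⟨fun h => absurd h (not_lt_of_ge unitInterval.le_one'), fun h => by omega⟩
  obtain ⟨i, rfl⟩ : ∃ i : Fin n, l = i + 1 := ⟨⟨l - 1, by omega⟩, by simp; omega⟩
  rw [vertex_succ, lt_iff_lt_countBelow s.2]
  rfl

/-- If two coordinates differed, the open interval between them would be infinite, hence would
contain a point outside `G` that only one of the two step functions counts at that index. -/
theorem Simplex.eq_of_countBelow_eq {n : ℕ} {s t : Simplex n} {G : Set unitInterval}
    (hG : G.Finite) (h : ∀ y, y ∉ G → countBelow s.1 y = countBelow t.1 y) : s = t := by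
  have key : ∀ s t : Simplex n, (∀ y, y ∉ G → countBelow s.1 y = countBelow t.1 y) →
      ∀ i, s.1 i ≤ t.1 i := by
    intro s t h i
    by_contra hlt
    push Not at hlt
    obtain ⟨y, hy, hyG⟩ := (Set.Ioo_infinite hlt).exists_notMem_finite hG
    have h1 := (lt_iff_lt_countBelow t.2 i y).1 hy.1
    rw [← h y hyG, ← lt_iff_lt_countBelow s.2 i y] at h1
    exact lt_asymm h1 hy.2
  exact Subtype.ext (funext fun i => le_antisymm (key s t h i) (key t s (fun y hy => (h y hy).symm) i))

/-- The map of standard simplices given by a morphism of the simplex category. -/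
def Simplex.map {k m : ℕ} (α : SimplexCategory.mk k ⟶ SimplexCategory.mk m) (r : Simplex k) :
    Simplex m :=
  ⟨fun i => r.vertex (Finset.univ.filter fun j : Fin (k + 1) => α.toOrderHom j ≤ i.castSucc).card,
    fun _ _ h => r.vertex_mono (Finset.card_le_card fun j hj => by
      simp only [Finset.mem_filter, Finset.mem_univ, true_and] at hj ⊢
      exact hj.trans (Fin.castSucc_le_castSucc_iff.2 h))⟩

theorem Simplex.continuous_map {k m : ℕ} (α : SimplexCategory.mk k ⟶ SimplexCategory.mk m) :
    Continuous (Simplex.map α) :=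
  Continuous.subtype_mk (continuous_pi fun _ => continuous_vertex _ _) _

/-- The number of points below `y`, as an element of `[n]`. -/
noncomputable def Simplex.index {n : ℕ} (s : Simplex n) (y : unitInterval) : Fin (n + 1) :=
  ⟨countBelow s.1 y, Nat.lt_succ_of_le (countBelow_le _ _)⟩

/-- For monotone `α` the cardinality is the first index whose image exceeds `i`. This adjunction
explains the form of `Simplex.map`. -/
theorem card_filter_le_iff {k m : ℕ} (α : Fin (k + 1) →o Fin (m + 1)) (i : Fin (m + 1))
    (c : Fin (k + 1)) : (Finset.univ.filter fun j => α j ≤ i).card ≤ (c : ℕ) ↔ i < α c := by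
  constructor
  · intro h
    by_contra hlt
    have : (Finset.Iic c).card ≤ (Finset.univ.filter fun j => α j ≤ i).card :=
      Finset.card_le_card fun j hj => by
        simp only [Finset.mem_filter, Finset.mem_univ, true_and]
        exact (α.monotone (Finset.mem_Iic.1 hj)).trans (not_lt.1 hlt)
    rw [Fin.card_Iic] at this
    omega
  · intro h
    have : (Finset.univ.filter fun j => α j ≤ i).card ≤ (Finset.Iio c).card :=
      Finset.card_le_card fun j hj => by
        simp only [Finset.mem_filter, Finset.mem_univ, true_and] at hj
        exact Finset.mem_Iio.2 (lt_of_not_ge fun hcj => absurd (α.monotone hcj)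
          (not_le_of_gt (hj.trans_lt h)))
    rwa [Fin.card_Iio] at this

/-- Both step functions are compared through the sets of `i` they exceed, by `Simplex.vertex_lt_iff`
and the adjunction above. At `y = 0` the identity can fail: if `α` does not start at `0`, the image
has vertices at `0`, which the strict count ignores. -/
theorem Simplex.index_map {k m : ℕ} (α : SimplexCategory.mk k ⟶ SimplexCategory.mk m)
    (r : Simplex k) {y : unitInterval} (h : 0 < y ∨ ∀ i, (r.map α).1 i ≠ y) :
    (r.map α).index y = α.toOrderHom (r.index y) := by
  have key : ∀ i : Fin m, (r.map α).1 i < y ↔ i.castSucc < α.toOrderHom (r.index y) := by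
    intro i
    rw [← card_filter_le_iff α.toOrderHom i.castSucc (r.index y)]
    refine r.vertex_lt_iff _ ?_
    rcases h with h | h
    · exact Or.inr h
    · by_contra hc
      push Not at hc
      have h0 : y = 0 := le_antisymm hc.2 unitInterval.nonneg'
      refine h i ?_
      rw [h0]
      show r.vertex _ = 0
      rw [hc.1, vertex_zero]
  refine Fin.ext ?_
  have hc : ((Finset.univ.filter fun i : Fin m => i.castSucc < α.toOrderHom (r.index y)).card) =
      ((α.toOrderHom (r.index y) : Fin (m + 1)) : ℕ) := by
    generalize α.toOrderHom (r.index y) = c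
    have hle : (c : ℕ) < m + 1 := c.2
    rw [← Finset.card_map Fin.castSuccEmb]
    rw [show (Finset.univ.filter fun i : Fin m => i.castSucc < c).map Fin.castSuccEmb =
      Finset.Iio c from ?_, Fin.card_Iio]
    ext j
    simp only [Finset.mem_map, Finset.mem_filter, Finset.mem_univ, true_and, Finset.mem_Iio]
    constructor
    · rintro ⟨i, hi, rfl⟩; exact hi
    · intro hj
      have : (j : ℕ) < c := hj
      exact ⟨⟨j, by omega⟩, hj, rfl⟩
  rw [← hc]
  show (Finset.univ.filter fun i => (r.map α).1 i < y).card = _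
  simp only [key]

/-- A simplex whose vertices occur among those of `r` is an image of `r`. -/
theorem Simplex.exists_map_eq {k m : ℕ} (r : Simplex k) (s : Simplex m)
    (h : ∀ i, ∃ l, s.1 i = r.vertex l) :
    ∃ α : SimplexCategory.mk k ⟶ SimplexCategory.mk m, r.map α = s := by
  -- The step function of `s` is constant on each gap of `r` and left continuous, so its value on
  -- the gap with index `j` can be read at the right end `r.vertex (j + 1)`.
  let a : Fin (k + 1) →o Fin (m + 1) := ⟨fun j => s.index (r.vertex (j + 1)), fun _ _ hij =>
    countBelow_mono s.1 (r.vertex_mono (Nat.succ_le_succ hij))⟩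
  refine ⟨SimplexCategory.mkHom a, eq_of_countBelow_eq (G := {0}) (Set.finite_singleton _) ?_⟩
  intro y hy
  have hy0 : 0 < y := unitInterval.pos_iff_ne_zero.2 hy
  have h1 := congrArg Fin.val (index_map (SimplexCategory.mkHom a) r (y := y) (Or.inl hy0))
  refine h1.trans ?_
  show countBelow s.1 (r.vertex (countBelow r.1 y + 1)) = countBelow s.1 y
  unfold countBelow
  congr 1
  refine Finset.filter_congr fun i _ => ?_
  obtain ⟨l, hl⟩ := h i
  rw [hl]
  have hle : y ≤ r.vertex (countBelow r.1 y + 1) := by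
    by_contra hlt
    have := (r.vertex_lt_iff _ (Or.inr hy0)).1 (not_le.1 hlt)
    omega
  refine ⟨fun hlt => ?_, fun hlt => hlt.trans_le hle⟩
  refine (r.vertex_lt_iff l (Or.inr hy0)).2 ?_
  by_contra hc
  exact absurd (r.vertex_mono (by omega : countBelow r.1 y + 1 ≤ l)) (not_le_of_gt hlt)

/-- The interior of the standard simplex. -/
def Simplex.IsInterior {n : ℕ} (s : Simplex n) : Prop :=
  StrictMono s.1 ∧ ∀ i, 0 < s.1 i ∧ s.1 i < 1

/-- The points of a finite subset of the open interval are the vertices of an interior point. -/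
theorem exists_isInterior (F : Finset unitInterval) :
    ∃ (k : ℕ) (r : Simplex k), r.IsInterior ∧ k ≤ F.card ∧
      ∀ y, (∃ i, r.1 i = y) ↔ y ∈ F ∧ y ≠ 0 ∧ y ≠ 1 := by
  classical
  let F' := F.filter fun y => y ≠ 0 ∧ y ≠ 1
  have hr : ∀ y, (∃ i, F'.orderEmbOfFin rfl i = y) ↔ y ∈ F ∧ y ≠ 0 ∧ y ≠ 1 := fun y => by
    have : (∃ i, F'.orderEmbOfFin rfl i = y) ↔ y ∈ Set.range (F'.orderEmbOfFin rfl) := Iff.rfl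
    rw [this, Finset.range_orderEmbOfFin]
    simp [F']
  refine ⟨F'.card, ⟨F'.orderEmbOfFin rfl, (F'.orderEmbOfFin rfl).monotone⟩,
    ⟨(F'.orderEmbOfFin rfl).strictMono, fun i => ?_⟩, Finset.card_filter_le _ _, hr⟩
  have := (hr _).1 ⟨i, rfl⟩
  exact ⟨unitInterval.pos_iff_ne_zero.2 this.2.1, unitInterval.lt_one_iff_ne_one.2 this.2.2⟩

theorem Simplex.exists_vertex_eq {k : ℕ} {r : Simplex k} {F : Finset unitInterval}
    (h : ∀ y, (∃ i, r.1 i = y) ↔ y ∈ F ∧ y ≠ 0 ∧ y ≠ 1) {y : unitInterval} (hy : y ∈ F) :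
    ∃ l, y = r.vertex l := by
  by_cases h0 : y = 0
  · exact ⟨0, h0⟩
  by_cases h1 : y = 1
  · exact ⟨k + 1, by rw [r.vertex_of_lt (by omega), h1]⟩
  obtain ⟨i, hi⟩ := (h y).2 ⟨hy, h0, h1⟩
  exact ⟨i + 1, by rw [vertex_succ, hi]⟩

/-- Consecutive vertices of an interior point, with `0` and `1` added at the ends, bound non-empty
open intervals, and each such interval is infinite. -/
theorem Simplex.IsInterior.exists_index_eq {n : ℕ} {s : Simplex n} (hs : s.IsInterior)
    {G : Set unitInterval} (hG : G.Finite) (c : Fin (n + 1)) :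
    ∃ y, y ∉ G ∧ 0 < y ∧ y < 1 ∧ s.index y = c := by
  have hlt : s.vertex c < s.vertex (c + 1) := by
    rcases eq_or_ne (c : ℕ) 0 with h0 | h0
    · rw [h0, vertex_zero]
      by_cases hn : n = 0
      · rw [s.vertex_of_lt (by omega)]; exact zero_lt_one
      · have := s.vertex_succ ⟨0, by omega⟩
        rw [this]; exact (hs.2 _).1
    · have e := s.vertex_succ ⟨c - 1, by omega⟩
      have e' : (c : ℕ) - 1 + 1 = c := by omega
      rw [e'] at e
      rw [e]
      by_cases hn : (c : ℕ) = n
      · rw [s.vertex_of_lt (by omega)]; exact (hs.2 _).2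
      · rw [s.vertex_succ ⟨c, by omega⟩]
        exact hs.1 (by rw [Fin.lt_def]; show (c : ℕ) - 1 < c; omega)
  obtain ⟨y, hy, hyG⟩ := (Set.Ioo_infinite hlt).exists_notMem_finite hG
  have hy0 : 0 < y := unitInterval.nonneg'.trans_lt hy.1
  refine ⟨y, hyG, hy0, hy.2.trans_le unitInterval.le_one', Fin.ext ?_⟩
  have h1 := (s.vertex_lt_iff c (Or.inr hy0)).1 hy.1
  have h2 := mt (s.vertex_lt_iff (c + 1) (Or.inr hy0)).2 (not_lt_of_gt hy.2)
  show countBelow s.1 y = c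
  omega

theorem Simplex.IsInterior.surjective_of_map_eq {k n : ℕ} {s : Simplex n} (hs : s.IsInterior)
    {α : SimplexCategory.mk k ⟶ SimplexCategory.mk n} {r : Simplex k} (h : r.map α = s) :
    Function.Surjective α.toOrderHom := by
  intro c
  obtain ⟨y, -, hy0, -, hy⟩ := hs.exists_index_eq Set.finite_empty c
  exact ⟨r.index y, by rw [← index_map α r (Or.inl hy0), h, hy]⟩

/-- Every point lies in an open face: drop repetitions and the values `0` and `1`. The bound `k ≤ n`
leaves finitely many pairs `(k, α)` to consider. -/
theorem Simplex.exists_isInterior_map_eq {n : ℕ} (s : Simplex n) :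
    ∃ k ≤ n, ∃ (α : SimplexCategory.mk k ⟶ SimplexCategory.mk n) (r : Simplex k),
      r.IsInterior ∧ r.map α = s := by
  classical
  obtain ⟨k, r, hr, hk, h⟩ := exists_isInterior (Finset.univ.image s.1)
  obtain ⟨α, hα⟩ := r.exists_map_eq s fun i => exists_vertex_eq h (y := s.1 i) (by simp)
  exact ⟨k, hk.trans (Finset.card_image_le.trans (by simp)), α, r, hr, hα⟩

/-! ### Quotients of the disjoint union of the simplices of a simplicial set -/

/-- The maps `ch` from the standard simplices identify `Y` with the quotient of the disjoint union of
the simplices of `X` by the usual relation. -/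
structure IsSimplexQuotient (X : SSet.{u}) {Y : Type u}
    (ch : ∀ n : ℕ, X.obj (op (SimplexCategory.mk n)) → Simplex n → Y) : Prop where
  surj : ∀ y, ∃ n x s, ch n x s = y
  nat : ∀ {k m : ℕ} (α : SimplexCategory.mk k ⟶ SimplexCategory.mk m)
    (x : X.obj (op (SimplexCategory.mk m))) (r : Simplex k),
    ch m x (r.map α) = ch k (X.map α.op x) r
  exact : ∀ {m n : ℕ} (x : X.obj (op (SimplexCategory.mk m)))
    (x' : X.obj (op (SimplexCategory.mk n))) (s : Simplex m) (s' : Simplex n),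
    ch m x s = ch n x' s' → ∃ (k : ℕ) (α : SimplexCategory.mk k ⟶ SimplexCategory.mk m)
      (β : SimplexCategory.mk k ⟶ SimplexCategory.mk n) (r : Simplex k),
      r.map α = s ∧ r.map β = s' ∧ X.map α.op x = X.map β.op x'

/-- Functoriality is clear for step functions, and these determine the points. -/
theorem Simplex.map_comp {k l m : ℕ} (α : SimplexCategory.mk k ⟶ SimplexCategory.mk l)
    (β : SimplexCategory.mk l ⟶ SimplexCategory.mk m) (r : Simplex k) :
    r.map (α ≫ β) = (r.map α).map β := by
  refine eq_of_countBelow_eq (G := {0}) (Set.finite_singleton _) fun y hy => ?_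
  have hy0 : 0 < y := unitInterval.pos_iff_ne_zero.2 hy
  refine congrArg Fin.val (?_ : (r.map (α ≫ β)).index y = ((r.map α).map β).index y)
  rw [index_map _ _ (Or.inl hy0), index_map _ _ (Or.inl hy0), index_map _ _ (Or.inl hy0)]
  rfl

instance (n : ℕ) : CompactSpace (Simplex n) :=
  isCompact_iff_compactSpace.1 (IsClosed.isCompact (isClosed_monotone))

instance (n : ℕ) : T2Space (Simplex n) :=
  inferInstanceAs (T2Space {s : Fin n → unitInterval // Monotone s})

/-- Any choice of preimages under a monotone surjection is automatically monotone. -/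
theorem exists_section_of_surjective {k l : ℕ} {α : SimplexCategory.mk k ⟶ SimplexCategory.mk l}
    (h : Function.Surjective α.toOrderHom) :
    ∃ σ : SimplexCategory.mk l ⟶ SimplexCategory.mk k, σ ≫ α = 𝟙 _ := by
  choose q hq using h
  have hqm : Monotone q := fun a b hab => le_of_not_gt fun hlt => by
    have h1 := α.toOrderHom.monotone hlt.le
    rw [hq, hq] at h1
    have := le_antisymm hab h1
    subst this
    exact lt_irrefl _ hlt
  exact ⟨SimplexCategory.mkHom ⟨q, hqm⟩,
    SimplexCategory.Hom.ext _ _ (OrderHom.ext _ _ (funext hq))⟩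

/-- Two monotone maps out of `[k]` factor through a surjection of `[k]` such that they become jointly
injective. -/
theorem exists_jointly_injective {k m n : ℕ} (α : SimplexCategory.mk k ⟶ SimplexCategory.mk m)
    (β : SimplexCategory.mk k ⟶ SimplexCategory.mk n) :
    ∃ (l : ℕ) (π : SimplexCategory.mk k ⟶ SimplexCategory.mk l)
      (σ : SimplexCategory.mk l ⟶ SimplexCategory.mk k), l < (m + 1) * (n + 1) ∧
      π ≫ σ ≫ α = α ∧ π ≫ σ ≫ β = β := by
  classical
  let f : Fin (k + 1) → Fin (m + 1) × Fin (n + 1) := fun j => (α.toOrderHom j, β.toOrderHom j)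
  have hf : Monotone f := fun _ _ h => ⟨α.toOrderHom.monotone h, β.toOrderHom.monotone h⟩
  -- The image of a monotone map from a chain to the product is a chain with at most `(m + 1) * (n +
  -- 1)` elements. It plays the role of `[l]`, and any choice of preimages gives `σ`.
  let S := Finset.univ.image f
  have hchain : ∀ a ∈ S, ∀ b ∈ S, a ≤ b ∨ b ≤ a := by
    intro a ha b hb
    obtain ⟨i, -, rfl⟩ := Finset.mem_image.1 ha
    obtain ⟨j, -, rfl⟩ := Finset.mem_image.1 hb
    exact (le_total i j).imp (fun h => hf h) fun h => hf h
  let _ : LinearOrder S :=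
    { (inferInstance : PartialOrder S) with
      le_total := fun a b => hchain a.1 a.2 b.1 b.2
      toDecidableLE := Classical.decRel _ }
  obtain ⟨l, hl⟩ : ∃ l, Fintype.card S = l + 1 :=
    Nat.exists_eq_succ_of_ne_zero (Fintype.card_pos_iff.2 ⟨⟨f 0, Finset.mem_image_of_mem _ (Finset.mem_univ _)⟩⟩).ne'
  let e : Fin (l + 1) ≃o S := Fintype.orderIsoFinOfCardEq S hl
  let p : Fin (k + 1) →o S := ⟨fun j => ⟨f j, Finset.mem_image_of_mem _ (Finset.mem_univ _)⟩, fun _ _ h => hf h⟩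
  have hsurj : ∀ s : S, ∃ j, p j = s := fun s => by
    obtain ⟨i, -, h⟩ := Finset.mem_image.1 s.2
    exact ⟨i, Subtype.ext h⟩
  choose q hq using hsurj
  have hqm : Monotone q := by
    intro a b hab
    by_contra hlt
    have h1 := p.monotone (not_le.1 hlt).le
    rw [hq, hq] at h1
    have := le_antisymm hab h1
    subst this
    exact hlt le_rfl
  have key : ∀ j, f (q (p j)) = f j := fun j => congrArg Subtype.val (hq (p j))
  refine ⟨l, SimplexCategory.mkHom ((e.symm : S →o Fin (l + 1)).comp p),
    SimplexCategory.mkHom ((⟨q, hqm⟩ : S →o Fin (k + 1)).comp (e : Fin (l + 1) →o S)), ?_, ?_, ?_⟩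
  · have : Fintype.card S ≤ _ := Fintype.card_subtype_le (fun x => x ∈ S)
    rw [hl, Fintype.card_prod, Fintype.card_fin, Fintype.card_fin] at this
    exact this
  · refine SimplexCategory.Hom.ext _ _ (OrderHom.ext _ _ (funext fun j => ?_))
    show α.toOrderHom (q (e (e.symm (p j)))) = α.toOrderHom j
    rw [OrderIso.apply_symm_apply]
    exact congrArg Prod.fst (key j)
  · refine SimplexCategory.Hom.ext _ _ (OrderHom.ext _ _ (funext fun j => ?_))
    show β.toOrderHom (q (e (e.symm (p j)))) = β.toOrderHom j
    rw [OrderIso.apply_symm_apply]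
    exact congrArg Prod.snd (key j)

namespace IsSimplexQuotient

variable {X : SSet.{u}} {Y : Type u}
  {ch : ∀ n : ℕ, X.obj (op (SimplexCategory.mk n)) → Simplex n → Y}

/-- The witness `[k]` can be replaced by the chain of pairs that it hits in `[m] × [n]`. The
resulting bound on `l` makes the set of possible witnesses `(l, α, β)` finite, which is what the
topological arguments need. -/
theorem eq_iff (h : IsSimplexQuotient X ch) {m n : ℕ} (x : X.obj (op (SimplexCategory.mk m)))
    (x' : X.obj (op (SimplexCategory.mk n))) (s : Simplex m) (s' : Simplex n) :
    ch m x s = ch n x' s' ↔ ∃ l : Fin ((m + 1) * (n + 1)),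
      ∃ a : {a : (SimplexCategory.mk l ⟶ SimplexCategory.mk m) ×
        (SimplexCategory.mk l ⟶ SimplexCategory.mk n) // X.map a.1.op x = X.map a.2.op x'},
      ∃ r : Simplex l, (r.map a.1.1, r.map a.1.2) = (s, s') := by
  constructor
  · intro heq
    obtain ⟨k, α, β, r, rfl, rfl, hx⟩ := h.exact x x' s s' heq
    obtain ⟨l, π, σ, hl, hα, hβ⟩ := exists_jointly_injective α β
    refine ⟨⟨l, hl⟩, ⟨(σ ≫ α, σ ≫ β), ?_⟩, r.map π, ?_⟩
    · simp only [op_comp, Functor.map_comp_apply, hx]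
    · rw [← Simplex.map_comp, ← Simplex.map_comp, hα, hβ]
  · rintro ⟨l, ⟨⟨α, β⟩, hx⟩, r, hr⟩
    obtain ⟨rfl, rfl⟩ := Prod.mk_inj.1 hr
    rw [h.nat, h.nat]
    exact congrArg (fun z => ch l z r) hx

/-- By `eq_iff` the relation is a finite union of continuous images of compact simplices. -/
theorem isClosed_rel (h : IsSimplexQuotient X ch) {m n : ℕ} (x : X.obj (op (SimplexCategory.mk m)))
    (x' : X.obj (op (SimplexCategory.mk n))) :
    IsClosed {p : Simplex m × Simplex n | ch m x p.1 = ch n x' p.2} := by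
  have e : {p : Simplex m × Simplex n | ch m x p.1 = ch n x' p.2} =
      ⋃ l : Fin ((m + 1) * (n + 1)),
      ⋃ a : {a : (SimplexCategory.mk l ⟶ SimplexCategory.mk m) ×
        (SimplexCategory.mk l ⟶ SimplexCategory.mk n) // X.map a.1.op x = X.map a.2.op x'},
      Set.range fun r : Simplex l => (r.map a.1.1, r.map a.1.2) := by
    ext ⟨s, s'⟩
    simp only [Set.mem_iUnion, Set.mem_range, Set.mem_ofPred_eq]
    exact h.eq_iff x x' s s'
  rw [e]
  have : ∀ a b : SimplexCategory, Finite (a ⟶ b) := fun a b =>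
    Finite.of_injective (fun f => (f.toOrderHom : Fin (a.len + 1) → Fin (b.len + 1)))
      fun f g hfg => SimplexCategory.Hom.ext _ _ (OrderHom.ext _ _ hfg)
  refine isClosed_iUnion_of_finite fun l => isClosed_iUnion_of_finite fun a => ?_
  exact (isCompact_range ((Simplex.continuous_map _).prodMk (Simplex.continuous_map _))).isClosed

/-- The right-hand side of `eq_iff` involves only `X`, so all quotients make the same
identifications. -/
theorem exists_desc (h : IsSimplexQuotient X ch) {Z : Type u}
    {ch' : ∀ n : ℕ, X.obj (op (SimplexCategory.mk n)) → Simplex n → Z}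
    (h' : IsSimplexQuotient X ch') : ∃ θ : Y → Z, ∀ n x s, θ (ch n x s) = ch' n x s := by
  choose N x s hs using h.surj
  refine ⟨fun y => ch' (N y) (x y) (s y), fun n x₀ s₀ => ?_⟩
  obtain ⟨l, a, r, hr⟩ := (h.eq_iff _ _ _ _).1 (hs (ch n x₀ s₀))
  exact (h'.eq_iff _ _ _ _).2 ⟨l, a, r, hr⟩

/-- If one point of an open cell lies in the image of a simplex, then so does the whole cell. -/
theorem cell_subset (h : IsSimplexQuotient X ch) {k n : ℕ} {z : X.obj (op (SimplexCategory.mk k))}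
    {x : X.obj (op (SimplexCategory.mk n))} {p : Simplex k} (hp : p.IsInterior)
    (hpx : ch k z p ∈ Set.range (ch n x)) (q : Simplex k) : ch k z q ∈ Set.range (ch n x) := by
  obtain ⟨s, hs⟩ := hpx
  obtain ⟨l, α, β, r, hr, -, hx⟩ := h.exact z x p s hs.symm
  -- Since `p` is interior, `α` is surjective and has a section `σ`. From `X(α) z = X(β) x` it
  -- follows that `z = X(σ ≫ β) x`, so the whole simplex `z` is obtained from `x`.
  have hsurj := hp.surjective_of_map_eq hr
  obtain ⟨σ, hσ⟩ := exists_section_of_surjective hsurj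
  refine ⟨q.map (σ ≫ β), ?_⟩
  rw [h.nat]
  congr 1
  rw [op_comp, Functor.map_comp_apply, ← hx, ← Functor.map_comp_apply, ← op_comp,
    hσ, op_id, Functor.map_id_apply]

variable [tY : TopologicalSpace Y]

theorem isClosed_iff (hT : tY = ⨆ (n : ℕ) (x : X.obj (op (SimplexCategory.mk n))),
    TopologicalSpace.coinduced (ch n x) inferInstance) {A : Set Y} :
    IsClosed A ↔ ∀ n x, IsClosed (ch n x ⁻¹' A) := by
  subst hT
  simp only [isClosed_iSup_iff, isClosed_coinduced]

theorem continuous_ch (hT : tY = ⨆ (n : ℕ) (x : X.obj (op (SimplexCategory.mk n))),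
    TopologicalSpace.coinduced (ch n x) inferInstance) (n : ℕ)
    (x : X.obj (op (SimplexCategory.mk n))) : Continuous (ch n x) :=
  continuous_iff_isClosed.2 fun _ hA => (isClosed_iff hT).1 hA n x

/-- The preimage in another simplex of the image of `C` is a projection, along a compact factor, of
a closed part of the relation. -/
theorem isClosedMap_ch (h : IsSimplexQuotient X ch)
    (hT : tY = ⨆ (n : ℕ) (x : X.obj (op (SimplexCategory.mk n))),
      TopologicalSpace.coinduced (ch n x) inferInstance) (n : ℕ)
    (x : X.obj (op (SimplexCategory.mk n))) : IsClosedMap (ch n x) := by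
  intro C hC
  refine (isClosed_iff hT).2 fun m x' => ?_
  have e : ch m x' ⁻¹' (ch n x '' C) =
      Prod.fst '' ({p : Simplex m × Simplex n | ch m x' p.1 = ch n x p.2} ∩ Prod.snd ⁻¹' C) := by
    ext s
    constructor
    · rintro ⟨s', hs', hs⟩
      exact ⟨(s, s'), ⟨hs.symm, hs'⟩, rfl⟩
    · rintro ⟨⟨s, s'⟩, ⟨hs, hs'⟩, rfl⟩
      exact ⟨s', hs', hs.symm⟩
  rw [e]
  exact isClosedMap_fst_of_compactSpace _
    ((h.isClosed_rel x' x).inter (hC.preimage continuous_snd))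

theorem isClosed_singleton (h : IsSimplexQuotient X ch)
    (hT : tY = ⨆ (n : ℕ) (x : X.obj (op (SimplexCategory.mk n))),
      TopologicalSpace.coinduced (ch n x) inferInstance) (y : Y) : IsClosed ({y} : Set Y) := by
  obtain ⟨n, x, s, rfl⟩ := h.surj y
  have := h.isClosedMap_ch hT n x {s} _root_.isClosed_singleton
  rwa [Set.image_singleton] at this

/-- Properness, unlike closedness, survives taking the product with an arbitrary space; it serves
for products with `Aut S¹`. -/
theorem isProperMap_ch (h : IsSimplexQuotient X ch)
    (hT : tY = ⨆ (n : ℕ) (x : X.obj (op (SimplexCategory.mk n))),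
      TopologicalSpace.coinduced (ch n x) inferInstance) (n : ℕ)
    (x : X.obj (op (SimplexCategory.mk n))) : IsProperMap (ch n x) := by
  have hc := continuous_ch hT n x
  have hcl := h.isClosedMap_ch hT n x
  refine isProperMap_iff_isClosedMap_and_compact_fibers.2 ⟨hc, hcl, fun y => ?_⟩
  exact ((h.isClosed_singleton hT y).preimage hc).isCompact

/-- A compact subset is contained in the union of finitely many simplices. -/
theorem exists_finite_cover (h : IsSimplexQuotient X ch)
    (hT : tY = ⨆ (n : ℕ) (x : X.obj (op (SimplexCategory.mk n))),
      TopologicalSpace.coinduced (ch n x) inferInstance) {K : Set Y} (hK : IsCompact K) :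
    ∃ T : Finset (Σ n : ℕ, X.obj (op (SimplexCategory.mk n))),
      K ⊆ ⋃ i ∈ T, Set.range (ch i.1 i.2) := by
  classical
  by_contra hcon
  push Not at hcon
  have hex : ∀ T : Finset (Σ n : ℕ, X.obj (op (SimplexCategory.mk n))), ∃ y ∈ K, ∃ i : (Σ n : ℕ, X.obj (op (SimplexCategory.mk n))),
      y ∈ Set.range (ch i.1 i.2) ∧ ∀ j ∈ T, y ∉ Set.range (ch j.1 j.2) := fun T => by
    obtain ⟨y, hy, hyT⟩ := Set.not_subset.1 (hcon T)
    obtain ⟨n, x, s, hs⟩ := h.surj y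
    exact ⟨y, hy, ⟨n, x⟩, ⟨s, hs⟩, fun j hj hyj => hyT (Set.mem_biUnion hj hyj)⟩
  choose y hyK c hyc hyT using hex
  -- If no finite family covers `K`, one chooses inductively points `t j` of `K`, each outside the
  -- simplices that were picked for the earlier points.
  let T : ℕ → Finset (Σ n : ℕ, X.obj (op (SimplexCategory.mk n))) :=
    fun j => Nat.rec ∅ (fun _ T => insert (c T) T) j
  have hT1 : ∀ j, T (j + 1) = insert (c (T j)) (T j) := fun _ => rfl
  have hmono : Monotone T := monotone_nat_of_le_succ fun j => by
    rw [hT1]; exact Finset.subset_insert _ _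
  let t : ℕ → Y := fun j => y (T j)
  have hsep : ∀ i j, i < j → t j ∉ Set.range (ch (c (T i)).1 (c (T i)).2) := fun i j hij =>
    hyT (T j) _ (hmono hij (by rw [hT1]; exact Finset.mem_insert_self _ _))
  -- An open cell contains at most one `t j`: a simplex picked for one of its points contains the
  -- whole cell by `cell_subset`.
  have hinj : ∀ {k} (z : X.obj (op (SimplexCategory.mk k))) (p q : Simplex k), p.IsInterior →
      q.IsInterior → ∀ i j, t i = ch k z p → t j = ch k z q → i = j := by
    intro k z p q hp hq i j hi hj
    by_contra hne
    rcases lt_or_gt_of_ne hne with hlt | hlt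
    · refine hsep i j hlt (hj ▸ h.cell_subset hp (hi ▸ hyc (T i)) q)
    · refine hsep j i hlt (hi ▸ h.cell_subset hq (hj ▸ hyc (T j)) p)
  -- A simplex is the union of the images of finitely many open faces, each containing at most one
  -- `t j`.
  have hfin : ∀ n x, {j | t j ∈ Set.range (ch n x)}.Finite := by
    intro n x
    have : ∀ a b : SimplexCategory, Finite (a ⟶ b) := fun a b =>
      Finite.of_injective (fun f => (f.toOrderHom : Fin (a.len + 1) → Fin (b.len + 1)))
        fun f g hfg => SimplexCategory.Hom.ext _ _ (OrderHom.ext _ _ hfg)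
    have hf : (⋃ k : Fin (n + 1), ⋃ α : SimplexCategory.mk k ⟶ SimplexCategory.mk n,
        {j | ∃ p : Simplex k, p.IsInterior ∧ t j = ch k (X.map α.op x) p}).Finite := by
      refine Set.finite_iUnion fun k => Set.finite_iUnion fun α => Set.Subsingleton.finite ?_
      rintro i ⟨p, hp, hi⟩ j ⟨q, hq, hj⟩
      exact hinj _ p q hp hq i j hi hj
    refine hf.subset ?_
    rintro j ⟨s, hs⟩
    obtain ⟨k, hk, α, r, hr, rfl⟩ := s.exists_isInterior_map_eq
    rw [h.nat] at hs
    exact Set.mem_iUnion.2 ⟨⟨k, by omega⟩, Set.mem_iUnion.2 ⟨α, r, hr, hs.symm⟩⟩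
  -- Every set of the `t j` meets each simplex in a finite set of closed points, hence is closed.
  have hclosed : ∀ J : Set ℕ, IsClosed (t '' J) := by
    intro J
    refine (isClosed_iff hT).2 fun n x => ?_
    have e : ch n x ⁻¹' (t '' J) = ⋃ j ∈ J ∩ {j | t j ∈ Set.range (ch n x)}, ch n x ⁻¹' {t j} := by
      ext s
      simp only [Set.mem_preimage, Set.mem_image, Set.mem_iUnion, Set.mem_inter_iff,
        Set.mem_ofPred_eq, Set.mem_singleton_iff]
      constructor
      · rintro ⟨j, hj, hs⟩
        exact ⟨j, ⟨hj, s, hs.symm⟩, hs.symm⟩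
      · rintro ⟨j, ⟨hj, -⟩, hs⟩
        exact ⟨j, hj, hs.symm⟩
    rw [e]
    refine ((hfin n x).subset Set.inter_subset_right).isClosed_biUnion fun j _ => ?_
    exact (h.isClosed_singleton hT (t j)).preimage (continuous_ch hT n x)
  -- The complements of the tails form an increasing open cover, since the `t j` are distinct, and
  -- none of them contains `K`.
  obtain ⟨N, hN⟩ := hK.elim_directed_cover (fun N => (t '' Set.Ici N)ᶜ)
    (fun N => (hclosed _).isOpen_compl) (by
      intro y _
      by_cases hy : ∃ j, t j = y
      · obtain ⟨j, rfl⟩ := hy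
        refine Set.mem_iUnion.2 ⟨j + 1, ?_⟩
        rintro ⟨i, hi, hij⟩
        obtain ⟨s, hs⟩ := hyc (T j)
        have hlt : j < i := hi
        exact hsep j i hlt (hij ▸ ⟨s, hs⟩)
      · exact Set.mem_iUnion.2 ⟨0, fun ⟨i, _, hi⟩ => hy ⟨i, hi⟩⟩)
    (directed_of_isDirected_le fun a b hab => Set.compl_subset_compl.2
      (Set.image_mono (Set.Ici_subset_Ici.2 hab)))
  exact hN (hyK (T N)) ⟨N, Set.mem_Ici.2 le_rfl, rfl⟩

/-- A map on `A × Y` which is continuous on all `A × Δ^n` is continuous on `A × K` for compact `K`. -/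
theorem continuous_prod_of_isCompact (h : IsSimplexQuotient X ch)
    (hT : tY = ⨆ (n : ℕ) (x : X.obj (op (SimplexCategory.mk n))),
      TopologicalSpace.coinduced (ch n x) inferInstance) {A Z : Type*} [TopologicalSpace A]
    [TopologicalSpace Z] {f : A × Y → Z}
    (hf : ∀ n x, Continuous fun p : A × Simplex n => f (p.1, ch n x p.2)) {K : Set Y}
    (hK : IsCompact K) : Continuous fun p : A × K => f (p.1, p.2) := by
  obtain ⟨T, hTK⟩ := h.exists_finite_cover hT hK
  refine continuous_iff_isClosed.2 fun B hB => ?_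
  let W : (Σ n : ℕ, X.obj (op (SimplexCategory.mk n))) → Set (A × Y) := fun i =>
    Prod.map id (ch i.1 i.2) '' ((fun p : A × Simplex i.1 => f (p.1, ch i.1 i.2 p.2)) ⁻¹' B)
  -- The product of the identity of `A` with a proper map is proper, hence closed. On `A × K` the
  -- preimage of `B` is the trace of finitely many of these closed sets.
  have hW : ∀ i, IsClosed (W i) := fun i =>
    ((isProperMap_id (X := A)).prodMap (h.isProperMap_ch hT i.1 i.2)).isClosedMap _
      (hB.preimage (hf i.1 i.2))
  have e : (fun p : A × K => f (p.1, p.2)) ⁻¹' B =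
      (fun p : A × K => (p.1, (p.2 : Y))) ⁻¹' ⋃ i ∈ T, W i := by
    ext ⟨a, y, hy⟩
    simp only [Set.mem_preimage, Set.mem_iUnion]
    constructor
    · intro hB
      obtain ⟨i, hi, s, hs⟩ := Set.mem_iUnion₂.1 (hTK hy)
      refine ⟨i, hi, (a, s), ?_, by simp [hs]⟩
      show f (a, ch i.1 i.2 s) ∈ B
      rwa [hs]
    · rintro ⟨i, hi, ⟨a', s⟩, hs, heq⟩
      obtain ⟨rfl, rfl⟩ := Prod.mk_inj.1 heq
      exact hs
  rw [e]
  exact (T.finite_toSet.isClosed_biUnion fun i _ => hW i).preimage (by fun_prop)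

/-- Two quotients of the same simplicial set are homeomorphic. -/
theorem exists_homeomorph (h : IsSimplexQuotient X ch)
    (hT : tY = ⨆ (n : ℕ) (x : X.obj (op (SimplexCategory.mk n))),
      TopologicalSpace.coinduced (ch n x) inferInstance) {Z : Type u} [tZ : TopologicalSpace Z]
    {ch' : ∀ n : ℕ, X.obj (op (SimplexCategory.mk n)) → Simplex n → Z}
    (h' : IsSimplexQuotient X ch') (hT' : tZ = ⨆ (n : ℕ) (x : X.obj (op (SimplexCategory.mk n))),
      TopologicalSpace.coinduced (ch' n x) inferInstance) :
    ∃ Θ : Y ≃ₜ Z, ∀ n x s, Θ (ch n x s) = ch' n x s := by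
  obtain ⟨θ, hθ⟩ := h.exists_desc h'
  obtain ⟨η, hη⟩ := h'.exists_desc h
  refine ⟨⟨⟨θ, η, fun y => ?_, fun z => ?_⟩, ?_, ?_⟩, hθ⟩
  · obtain ⟨n, x, s, rfl⟩ := h.surj y
    rw [hθ, hη]
  · obtain ⟨n, x, s, rfl⟩ := h'.surj z
    rw [hη, hθ]
  · refine continuous_iff_isClosed.2 fun B hB => (isClosed_iff hT).2 fun n x => ?_
    have := (isClosed_iff hT').1 hB n x
    simpa only [← Set.preimage_comp, Function.comp_def, hθ] using this
  · refine continuous_iff_isClosed.2 fun B hB => (isClosed_iff hT').2 fun n x => ?_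
    have := (isClosed_iff hT).1 hB n x
    simpa only [← Set.preimage_comp, Function.comp_def, hη] using this

end IsSimplexQuotient

/-! ### Pullbacks of elements of a presheaf -/

section

variable {C D : Type*} [Category C] [Category D] (e : C ≌ D) (X : Cᵒᵖ ⥤ Type u)

theorem map_pullback {c : C} {d d' : D} (ψ : d' ⟶ d) (φ : d ⟶ e.functor.obj c)
    (x : X.obj (op c)) :
    (extendAlong e X).map ψ.op (pullback e X φ x) = pullback e X (ψ ≫ φ) x := by
  show X.map (e.inverse.map ψ).op (X.map _ x) = X.map _ x
  rw [← Functor.map_comp_apply, ← op_comp, Functor.map_comp, Category.assoc]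

theorem pullback_map {c c' : C} {d : D} (φ : d ⟶ e.functor.obj c) (θ : c ⟶ c')
    (x : X.obj (op c')) :
    pullback e X (φ ≫ e.functor.map θ) x = pullback e X φ (X.map θ.op x) := by
  unfold pullback
  rw [← Functor.map_comp_apply, ← op_comp]
  congr 3
  simp

/-- Whenever a step function is an isomorphism, this exchanges an element of `X(π₀)` for an actual
simplex of `X`. -/
theorem pullback_bijective {c : C} {d : D} (φ : d ⟶ e.functor.obj c) [IsIso φ] :
    Function.Bijective (pullback e X φ) := by
  have : IsIso (X.map (e.inverse.map φ ≫ e.unitInv.app c).op) := inferInstance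
  exact (isIso_iff_bijective _).1 this

end

/-! ### The realization of a simplicial set -/

/-- The restriction map `π₀(I ∖ F') → π₀(I ∖ F)` for `F ⊆ F'`. -/
noncomputable def intervalRes {F F' : Finset unitInterval} (h : F ≤ F') :
    intervalPi0 F' ⟶ intervalPi0 F :=
  intervalPi0Functor.map (homOfLE h).op

/-- The step function of `s` on `π₀(I ∖ G)`, where `G` contains the vertices of `s`. -/
noncomputable def Simplex.stepOn {n : ℕ} (s : Simplex n) {G : Finset unitInterval}
    (h : Finset.univ.image s.1 ≤ G) : intervalPi0 G ⟶
      SimplexCategory.skeletalEquivalence.functor.obj (SimplexCategory.mk n) :=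
  intervalRes h ≫ s.step

/-- This is `Simplex.index_map` read on components: a point outside `G` is not a vertex, so the
exceptional case does not occur. -/
theorem Simplex.stepOn_eq {k m : ℕ} (α : SimplexCategory.mk k ⟶ SimplexCategory.mk m)
    (r : Simplex k) {G : Finset unitInterval} (hr : Finset.univ.image r.1 ≤ G)
    (hs : Finset.univ.image (r.map α).1 ≤ G) :
    (r.map α).stepOn hs = r.stepOn hr ≫ SimplexCategory.skeletalEquivalence.functor.map α := by
  refine NonemptyFinLinOrd.hom_ext (OrderHom.ext _ _ (funext fun c => ?_))
  obtain ⟨y, rfl⟩ := ConnectedComponents.surjective_coe c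
  refine index_map α r (Or.inr fun i hi => y.2 ?_)
  rw [← hi]
  exact hs (Finset.mem_image_of_mem _ (Finset.mem_univ i))

/-- The points `0` and `1` may or may not lie in `G`, since removing an end of the interval creates
no new component. Two points with the same index are in one component because a point of `G` between
them would be a vertex of `r`. -/
theorem Simplex.isIso_stepOn {k : ℕ} {r : Simplex k} (hr : r.IsInterior)
    {G : Finset unitInterval} (h : ∀ y, (∃ i, r.1 i = y) ↔ y ∈ G ∧ y ≠ 0 ∧ y ≠ 1)
    (hG : Finset.univ.image r.1 ≤ G) : IsIso (r.stepOn hG) := by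
  let f : IntervalPi0 G →o Fin (k + 1) := (r.stepOn hG).hom.hom
  have hf : ∀ y : {y : unitInterval // y ∉ G}, f (y : IntervalPi0 G) = r.index y := fun _ => rfl
  have hsurj : Function.Surjective f := fun c => by
    obtain ⟨y, hy, -, -, hc⟩ := hr.exists_index_eq G.finite_toSet c
    exact ⟨((⟨y, hy⟩ : {y : unitInterval // y ∉ G}) : IntervalPi0 G), hc⟩
  have hinj : Function.Injective f := by
    have key : ∀ x y : {y : unitInterval // y ∉ G}, x ≤ y → r.index x = r.index y →
        (x : IntervalPi0 G) = (y : IntervalPi0 G) := by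
      intro x y hxy he
      refine intervalPi0_eq_of_index_eq hxy ?_
      unfold countBelow
      congr 1
      refine Finset.filter_congr fun z _ => ⟨fun hz => lt_of_lt_of_le hz hxy, fun hz => ?_⟩
      by_contra hzx
      have hzx' : (x : unitInterval) < z :=
        lt_of_le_of_ne (not_lt.1 hzx) (by rintro hxz; exact x.2 (hxz ▸ z.2))
      obtain ⟨i, hi⟩ := (h z).2 ⟨z.2, (unitInterval.nonneg'.trans_lt hzx').ne',
        (hz.trans_le unitInterval.le_one').ne⟩
      change (z : unitInterval) < y at hz
      change ¬ (z : unitInterval) < x at hzx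
      rw [← hi] at hz hzx
      have h1 := (lt_iff_lt_countBelow r.2 i _).1 hz
      have h2 := mt (lt_iff_lt_countBelow r.2 i _).2 hzx
      have h3 : countBelow r.1 x = countBelow r.1 y := congrArg Fin.val he
      omega
    intro a b
    obtain ⟨x, rfl⟩ := ConnectedComponents.surjective_coe a
    obtain ⟨y, rfl⟩ := ConnectedComponents.surjective_coe b
    intro hab
    rcases le_total x y with hxy | hxy
    · exact key x y hxy hab
    · exact (key y x hxy hab.symm).symm
  let e : IntervalPi0 G ≃o Fin (k + 1) :=
    (f.monotone.strictMono_of_injective hinj).orderIsoOfSurjective f hsurj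
  exact (NonemptyFinLinOrd.Iso.mk (α := intervalPi0 G)
    (β := SimplexCategory.skeletalEquivalence.functor.obj (SimplexCategory.mk k)) e).isIso_hom

namespace SimplicialRealization

variable (X : SSet.{u})

theorem mk_res {F F' : Finset unitInterval} (h : F ≤ F')
    (x : (simplicialBig X).obj (op (intervalPi0 F))) :
    mk X F' ((simplicialBig X).map (intervalRes h).op x) = mk X F x :=
  congrArg (fun f => f x)
    (Limits.colimit.w (intervalPi0Functor.rightOp ⋙ simplicialBig X) (homOfLE h))

theorem mk_surjective (y : SimplicialRealization X) : ∃ F x, mk X F x = y :=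
  Limits.Types.jointly_surjective' y

theorem mk_eq {F F' : Finset unitInterval} {x : (simplicialBig X).obj (op (intervalPi0 F))}
    {x' : (simplicialBig X).obj (op (intervalPi0 F'))} (h : mk X F x = mk X F' x') :
    ∃ (G : Finset unitInterval) (h : F ≤ G) (h' : F' ≤ G),
      (simplicialBig X).map (intervalRes h).op x = (simplicialBig X).map (intervalRes h').op x' := by
  obtain ⟨G, f, g, hfg⟩ := (Limits.Types.FilteredColimit.colimit_eq_iff _).1 h
  exact ⟨G, leOfHom f, leOfHom g, hfg⟩

theorem charMap_eq {n : ℕ} (x : X.obj (op (SimplexCategory.mk n))) (s : Simplex n)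
    {G : Finset unitInterval} (h : Finset.univ.image s.1 ≤ G) :
    charMap X x s = mk X G (pullback SimplexCategory.skeletalEquivalence X (s.stepOn h) x) := by
  rw [charMap, ← mk_res X h, map_pullback]
  rfl

/-- Representatives are moved to a common finite set, whose interior points are sorted into an
interior simplex point `r`. Its step function is an isomorphism, so equality over `π₀` of the
complement is equality in `X([k])`. -/
theorem isSimplexQuotient : IsSimplexQuotient X fun _ x s => charMap X x s where
  surj y := by
    obtain ⟨F, z, rfl⟩ := mk_surjective X y
    obtain ⟨k, r, hr, -, h⟩ := exists_isInterior F
    have hF : Finset.univ.image r.1 ≤ F := fun y hy => by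
      obtain ⟨i, -, hi⟩ := Finset.mem_image.1 hy
      exact ((h y).1 ⟨i, hi⟩).1
    have := Simplex.isIso_stepOn hr h hF
    obtain ⟨x, rfl⟩ := (pullback_bijective SimplexCategory.skeletalEquivalence X (r.stepOn hF)).2 z
    exact ⟨k, x, r, charMap_eq X x r hF⟩
  nat α x r := by
    rw [charMap_eq X x (r.map α) (Finset.subset_union_right (s₁ := Finset.univ.image r.1)),
      charMap_eq X _ r Finset.subset_union_left, Simplex.stepOn_eq, pullback_map]
  exact {m n} x x' s s' heq := by
    obtain ⟨G₀, h, h', hG⟩ := mk_eq X heq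
    obtain ⟨k, r, hr, -, hrG⟩ := exists_isInterior G₀
    obtain ⟨α, rfl⟩ := r.exists_map_eq s fun i => Simplex.exists_vertex_eq hrG
      (h (Finset.mem_image_of_mem _ (Finset.mem_univ i)))
    obtain ⟨β, rfl⟩ := r.exists_map_eq s' fun i => Simplex.exists_vertex_eq hrG
      (h' (Finset.mem_image_of_mem _ (Finset.mem_univ i)))
    refine ⟨k, α, β, r, rfl, rfl, ?_⟩
    have hF : Finset.univ.image r.1 ≤ G₀ := fun y hy => by
      obtain ⟨i, -, hi⟩ := Finset.mem_image.1 hy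
      exact ((hrG y).1 ⟨i, hi⟩).1
    have := Simplex.isIso_stepOn hr hrG hF
    refine (pullback_bijective SimplexCategory.skeletalEquivalence X (r.stepOn hF)).1 ?_
    rw [map_pullback, map_pullback] at hG
    rw [← pullback_map, ← pullback_map, ← Simplex.stepOn_eq, ← Simplex.stepOn_eq]
    exact hG

/-! ### The action of the homeomorphisms of the interval -/

theorem exists_desc {Z : Type*}
    (f : ∀ F : Finset unitInterval, (simplicialBig X).obj (op (intervalPi0 F)) → Z)
    (hf : ∀ (F F' : Finset unitInterval) (h : F ≤ F') x,
      f F' ((simplicialBig X).map (intervalRes h).op x) = f F x) :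
    ∃ φ : SimplicialRealization X → Z, ∀ F x, φ (mk X F x) = f F x := by
  choose F x hx using mk_surjective X
  refine ⟨fun y => f (F y) (x y), fun F' x' => ?_⟩
  obtain ⟨G, h, h', hG⟩ := mk_eq X (hx (mk X F' x'))
  show f _ (x _) = f F' x'
  rw [← hf _ _ h, hG, hf]

/-- Equal finite sets give different objects of the system; the passage between them is itself a
restriction. -/
theorem mk_congr {F F' : Finset unitInterval} (h : F' = F)
    (x : (simplicialBig X).obj (op (intervalPi0 F))) (φ : intervalPi0 F' ⟶ intervalPi0 F)
    (hφ : φ = intervalRes h.ge) : mk X F' ((simplicialBig X).map φ.op x) = mk X F x := by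
  rw [hφ, mk_res]

theorem exists_action (g : AutInterval) :
    ∃ φ : SimplicialRealization X → SimplicialRealization X, ∀ F x,
      φ (mk X F x) = mk X (intervalImage g F)
        ((simplicialBig X).map (intervalPi0Aut g⁻¹ (mem_intervalImage g F)).op x) := by
  refine exists_desc X _ fun F F' h x => ?_
  have h' : intervalImage g F ≤ intervalImage g F' := Finset.map_subset_map.2 h
  rw [← mk_res X h', ← Functor.map_comp_apply, ← Functor.map_comp_apply, ← op_comp, ← op_comp]
  congr 5
  refine NonemptyFinLinOrd.hom_ext (OrderHom.ext _ _ (funext fun c => ?_))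
  obtain ⟨y, rfl⟩ := ConnectedComponents.surjective_coe c
  rfl

noncomputable instance : MulAction AutInterval (SimplicialRealization X) where
  smul g := (exists_action X g).choose
  one_smul y := by
    obtain ⟨F, x, rfl⟩ := mk_surjective X y
    refine ((exists_action X 1).choose_spec F x).trans (mk_congr X ?_ x _ ?_)
    · ext z
      exact mem_intervalImage 1 F z
    · refine NonemptyFinLinOrd.hom_ext (OrderHom.ext _ _ (funext fun c => ?_))
      obtain ⟨y, rfl⟩ := ConnectedComponents.surjective_coe c
      rfl
  mul_smul g g' y := by
    obtain ⟨F, x, rfl⟩ := mk_surjective X y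
    have e : intervalImage g (intervalImage g' F) = intervalImage (g * g') F := by
      ext z
      rw [mem_intervalImage, mem_intervalImage, mem_intervalImage, mul_inv_rev]
      rfl
    refine ((exists_action X (g * g')).choose_spec F x).trans (Eq.symm ?_)
    refine (congrArg (exists_action X g).choose ((exists_action X g').choose_spec F x)).trans ?_
    refine ((exists_action X g).choose_spec _ _).trans ?_
    -- The two finite sets agree only by `e`, so one class is restricted along `e`. What remains is
    -- an equality of monotone maps of components, checked on points.
    rw [← mk_res X e.le, ← Functor.map_comp_apply, ← Functor.map_comp_apply, ← op_comp, ← op_comp]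
    congr 5
    refine NonemptyFinLinOrd.hom_ext (OrderHom.ext _ _ (funext fun c => ?_))
    obtain ⟨y, rfl⟩ := ConnectedComponents.surjective_coe c
    rfl

theorem smul_mk (g : AutInterval) (F : Finset unitInterval)
    (x : (simplicialBig X).obj (op (intervalPi0 F))) :
    g • mk X F x = mk X (intervalImage g F)
      ((simplicialBig X).map (intervalPi0Aut g⁻¹ (mem_intervalImage g F)).op x) :=
  (exists_action X g).choose_spec F x

end SimplicialRealization

/-! ### Step functions on the circle -/

theorem coe_intCast_circle (m : ℤ) : ((m : ℝ) : Circle1) = 0 :=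
  (AddCircle.coe_eq_zero_iff 1).2 ⟨m, by simp⟩

/-- The value of the step function at a point of the circle, modulo `n + 1`. -/
noncomputable def stepRes {n : ℕ} (x : SimLift n) (z : Circle1) : Fin (n + 1) :=
  finOfInt n (stepIndex x (AddCircle.equivIco 1 0 z))

theorem stepRes_coe {n : ℕ} (x : SimLift n) (y : ℝ) :
    stepRes x (y : Circle1) = finOfInt n (stepIndex x y) := by
  have h : (((AddCircle.equivIco 1 0 (y : Circle1) : ℝ)) : Circle1) = y := AddCircle.coe_equivIco
  obtain ⟨m, hm⟩ := exists_int_of_coe_eq h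
  rw [stepRes, hm, stepIndex_add_int, finOfInt_add]

theorem degShift_stepDeg_coe {n : ℕ} (x : SimLift n) (y : ℝ) :
    degShift (stepDeg x) (y : Circle1) = (stepIndex x y : ℝ) / (n + 1) - y :=
  degShift_coe _ _

/-- No translate of a point `x i` by an integer lies strictly between `y` and the next point of `G`,
and by left continuity that point itself gives the same value. -/
theorem stepIndex_add_gap {n : ℕ} (x : SimLift n) {G : CircleFinset} (h : simPoints x ≤ G) (y : ℝ) :
    stepIndex x (y + gap G (y : Circle1)) = stepIndex x y := by
  refine Finset.sum_congr rfl fun i _ => le_antisymm ?_ (Int.ceil_mono (by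
    linarith [gap_nonneg G (y : Circle1)]))
  rw [Int.ceil_le]
  by_contra hlt
  push Not at hlt
  have h2 := Int.le_ceil (y - x.1 i)
  have h3 : (y : Circle1) + ((x.1 i + ⌈y - x.1 i⌉ - y : ℝ) : Circle1) ∈ G.1 := by
    rw [← AddCircle.coe_add, add_sub_cancel, AddCircle.coe_add, coe_intCast_circle, add_zero]
    exact h (by simp [simPoints])
  have := gap_le (by linarith) h3
  linarith

/-- The underlying `ℤ₊`-functor of `stepMor`. -/
noncomputable def stepHom {n : ℕ} (x : SimLift n) (G : CircleFinset) :
    onCircle (fun c : CirclePi0 G => (endPoint G c : Circle1)) ⟶ cyc n :=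
  shiftFunctor (fun c : CirclePi0 G => stepRes x (endPoint G c))
    (fun c => degShift (stepDeg x) (endPoint G c))
    (fun c => by
      rw [stepRes, cycPoint_finOfInt, degShift, AddCircle.coe_sub, AddCircle.coe_equivIco,
        add_sub_cancel]
      rfl)
    fun _ _ _ ht h => degShift_le _ ht h

/-- The step function of `x` as a morphism from `π₀(S¹ ∖ G)`, for any `G`. -/
noncomputable def stepMor {n : ℕ} (x : SimLift n) (G : CircleFinset) :
    circlePi0 G ⟶ lambdaEquivalence.functor.obj n :=
  ObjectProperty.homMk (stepHom x G)

theorem simStep_eq {n : ℕ} (x : SimLift n) : simStep x = stepMor x (simPoints x) := rfl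

/-- Restriction moves an end point forward by a gap of `G`, over which the step function does not
change. -/
theorem map_stepMor {n : ℕ} (x : SimLift n) {G G' : CircleFinset} (h : G ≤ G')
    (hx : simPoints x ≤ G) : circlePi0Map h ≫ stepMor x G = stepMor x G' := by
  have key : ∀ c : CirclePi0 G', ∃ y : ℝ, (endPoint G' c : Circle1) = y ∧
      (endPoint G (circlePi0Incl h c) : Circle1) = ((y + gap G (y : Circle1) : ℝ) : Circle1) := by
    intro c
    obtain ⟨y, hy⟩ := QuotientAddGroup.mk_surjective (endPoint G' c : Circle1)
    refine ⟨y, hy.symm, ?_⟩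
    rw [endPoint_incl, ← hy]
    rfl
  refine ObjectProperty.hom_ext _ ?_
  show circlePi0MapHom h ≫ stepHom x G = stepHom x G'
  refine (shiftFunctor_comp ?_ ?_).symm
  · funext c
    obtain ⟨y, h1, h2⟩ := key c
    rw [Function.comp_apply, h1, h2, stepRes_coe, stepRes_coe, stepIndex_add_gap x hx]
  · intro a b
    obtain ⟨y, h1, h2⟩ := key a
    obtain ⟨z, h3, h4⟩ := key b
    simp only [h1, h2, h3, h4, degShift_stepDeg_coe, stepIndex_add_gap x hx]
    ring

/-- A nondecreasing map `ℤ → ℤ` compatible with the translations by `k + 1` and `n + 1`. -/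
structure CyclicMap (k n : ℕ) where
  toFun : ℤ → ℤ
  mono : Monotone toFun
  map_add : ∀ i, toFun (i + (k + 1)) = toFun i + (n + 1)

theorem CyclicMap.map_add_mul {k n : ℕ} (f : CyclicMap k n) (i m : ℤ) :
    f.toFun (i + m * (k + 1)) = f.toFun i + m * (n + 1) := by
  induction m using Int.induction_on with
  | zero => simp
  | succ m ih =>
    rw [show i + ((m : ℤ) + 1) * (k + 1) = i + m * (k + 1) + (k + 1) by ring, f.map_add, ih]
    ring
  | pred m ih =>
    have := f.map_add (i + (-(m : ℤ) - 1) * (k + 1))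
    rw [show i + (-(m : ℤ) - 1) * (k + 1) + (k + 1) = i + -(m : ℤ) * (k + 1) by ring, ih] at this
    linarith

theorem finOfInt_val (n : ℕ) (k : ℤ) : ((finOfInt n k : ℕ) : ℤ) = k % (n + 1) := by
  have := Int.emod_nonneg k (by omega : ((n + 1 : ℕ) : ℤ) ≠ 0)
  show (((k % (n + 1 : ℕ)).toNat : ℕ) : ℤ) = _
  rw [Int.toNat_of_nonneg this]
  push_cast
  rfl

theorem finOfInt_val_eq (n : ℕ) (k : ℤ) :
    ((finOfInt n k : ℕ) : ℤ) = k + -(k / (n + 1)) * (n + 1) := by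
  rw [finOfInt_val]
  have := Int.emod_add_mul_ediv k (n + 1)
  linarith

/-- The underlying `ℤ₊`-functor of `cycHom`. -/
noncomputable def cycFunctor {k n : ℕ} (f : CyclicMap k n) : cyc k ⟶ cyc n :=
  shiftFunctor (p := fun j : Fin (k + 1) => (cycPoint k j : Circle1))
    (q := fun j : Fin (n + 1) => (cycPoint n j : Circle1))
    (fun j : Fin (k + 1) => finOfInt n (f.toFun (j : ℕ)))
    (fun j => (f.toFun (j : ℕ) : ℝ) / (n + 1) - cycPoint k j)
    (fun j => by
      rw [cycPoint_finOfInt, AddCircle.coe_sub, add_sub_cancel])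
    (fun a b t ht h => by
      rw [← AddCircle.coe_add] at h
      obtain ⟨m, hm⟩ := exists_int_of_coe_eq h
      have h1 : t = cycPoint k b - cycPoint k a + m := by linarith
      have h2 : ((a : ℕ) : ℤ) ≤ (b : ℕ) + m * (k + 1) := by
        rw [h1, cycPoint, cycPoint] at ht
        have h3 : (0 : ℝ) ≤ ((b : ℕ) / ((k : ℝ) + 1) - (a : ℕ) / (k + 1) + m) * (k + 1) :=
          mul_nonneg ht (by positivity)
        have h4 : ((b : ℕ) / ((k : ℝ) + 1) - (a : ℕ) / (k + 1) + m) * (k + 1) =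
          (b : ℕ) + m * (k + 1) - (a : ℕ) := by field_simp; ring
        rw [h4] at h3
        have : ((a : ℕ) : ℝ) ≤ (b : ℕ) + m * (k + 1) := by linarith
        exact_mod_cast this
      have h5 := f.mono h2
      rw [f.map_add_mul] at h5
      have h6 : (f.toFun (a : ℕ) : ℝ) / (n + 1) ≤ (f.toFun (b : ℕ) : ℝ) / (n + 1) + m := by
        rw [div_le_iff₀ (by positivity), add_mul, div_mul_cancel₀ _ (by positivity)]
        exact_mod_cast h5
      linarith)

/-- The morphism of the cyclic category defined by a `CyclicMap`. -/
noncomputable def cycHom {k n : ℕ} (f : CyclicMap k n) : @Quiver.Hom Lambda _ k n :=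
  InducedCategory.homMk (cycFunctor f)

/-- Reduces factorizations of `ℤ₊`-functors to identities between integer-valued functions on the
line. The residues give the objects, and dividing by `n + 1` gives the displacements. -/
theorem stepMor_cycHom {k n : ℕ} (f : CyclicMap k n) {r : SimLift k} {s : SimLift n}
    (h : ∀ y, stepIndex s y = f.toFun (stepIndex r y)) (G : CircleFinset) :
    stepMor r G ≫ lambdaEquivalence.functor.map (cycHom f) = stepMor s G := by
  have key : ∀ N : ℤ, f.toFun ((finOfInt k N : Fin (k + 1)) : ℕ) =
      f.toFun N + -(N / (k + 1)) * (n + 1) := fun N => by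
    rw [finOfInt_val_eq, f.map_add_mul]
  refine ObjectProperty.hom_ext _ ?_
  show stepHom r G ≫ cycFunctor f = stepHom s G
  refine (shiftFunctor_comp ?_ ?_).symm
  · funext c
    obtain ⟨y, hy⟩ := QuotientAddGroup.mk_surjective (endPoint G c : Circle1)
    have hy' : (endPoint G c : Circle1) = y := hy.symm
    rw [Function.comp_apply, hy', stepRes_coe, stepRes_coe, key, finOfInt_add, h]
  · have key2 : ∀ c : CirclePi0 G, degShift (stepDeg s) (endPoint G c) =
        degShift (stepDeg r) (endPoint G c) +
        ((f.toFun ((stepRes r (endPoint G c) : Fin (k + 1)) : ℕ) : ℝ) / (n + 1) -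
          cycPoint k (stepRes r (endPoint G c))) := fun c => by
      obtain ⟨y, hy⟩ := QuotientAddGroup.mk_surjective (endPoint G c : Circle1)
      have hy' : (endPoint G c : Circle1) = y := hy.symm
      rw [hy', stepRes_coe, degShift_stepDeg_coe, degShift_stepDeg_coe, key, h, cycPoint]
      have h1 : ((finOfInt k (stepIndex r y) : ℕ) : ℝ) =
          stepIndex r y + -((stepIndex r y / (k + 1) : ℤ) : ℝ) * (k + 1) := by
        exact_mod_cast finOfInt_val_eq k (stepIndex r y)
      rw [h1]
      push_cast
      field_simp
      ring
    intro a b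
    rw [key2 a, key2 b]
    ring

/-! ### The cyclic and the simplicial step functions -/

/-- On `(0, 1]` the last point `1` contributes `0` and each other point contributes `1` or `0`. At
`y = 0` the last point would contribute `-1`. -/
theorem stepIndex_toSimLift {n : ℕ} (s : Simplex n) {y : unitInterval} (hy : 0 < y) :
    stepIndex s.toSimLift y = countBelow s.1 y := by
  have h0 : (0 : ℝ) < y := hy
  have h1 : ⌈(y : ℝ) - 1⌉ = 0 := by
    rw [Int.ceil_eq_iff]
    push_cast
    constructor <;> linarith [y.2.2]
  have h2 : ∀ i, ⌈(y : ℝ) - s.1 i⌉ = if s.1 i < y then 1 else 0 := fun i => by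
    have := (s.1 i).2.1
    have := (s.1 i).2.2
    split_ifs with h
    · have h' : (s.1 i : ℝ) < y := h
      rw [Int.ceil_eq_iff]
      push_cast
      constructor <;> linarith [y.2.2]
    · have h' : (y : ℝ) ≤ s.1 i := not_lt.1 h
      rw [Int.ceil_eq_iff]
      push_cast
      constructor <;> linarith
  show ∑ i, ⌈(y : ℝ) - (Fin.snoc (α := fun _ => ℝ) (fun i => (s.1 i : ℝ)) 1 : Fin (n + 1) → ℝ) i⌉ = _
  rw [Fin.sum_univ_castSucc]
  simp only [Fin.snoc_castSucc, Fin.snoc_last, h1, h2, add_zero]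
  rw [Finset.sum_boole]
  rfl

/-- The representative is taken in `(0, 1]` rather than `[0, 1)`, which is where
`stepIndex_toSimLift` applies. -/
theorem exists_unitInterval_add_int (y : ℝ) :
    ∃ (t : unitInterval) (a : ℤ), 0 < t ∧ y = t + a := by
  refine ⟨⟨y - (⌈y⌉ - 1), ?_, ?_⟩, ⌈y⌉ - 1, ?_, by push_cast; ring⟩
  · linarith [Int.ceil_lt_add_one y]
  · linarith [Int.le_ceil y]
  · show (0 : ℝ) < y - (⌈y⌉ - 1)
    linarith [Int.ceil_lt_add_one y]

/-- The `CyclicMap` of a morphism of the simplex category. -/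
noncomputable def simplexCyclicMap {k m : ℕ} (α : SimplexCategory.mk k ⟶ SimplexCategory.mk m) :
    CyclicMap k m where
  toFun N := ((α.toOrderHom (finOfInt k N) : Fin (m + 1)) : ℕ) + N / (k + 1) * (m + 1)
  mono := by
    intro a b hab
    have hk : (0 : ℤ) < k + 1 := by omega
    have h1 : a / (k + 1) ≤ b / (k + 1) := Int.ediv_le_ediv hk hab
    have ha : ((α.toOrderHom (finOfInt k a) : Fin (m + 1)) : ℕ) < m + 1 :=
      (α.toOrderHom (finOfInt k a) : Fin (m + 1)).2
    rcases eq_or_lt_of_le h1 with h1 | h1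
    · have h2 : finOfInt k a ≤ finOfInt k b := by
        rw [Fin.le_def]
        zify
        rw [finOfInt_val_eq, finOfInt_val_eq, h1]
        linarith
      have h3 : ((α.toOrderHom (finOfInt k a) : Fin (m + 1)) : ℕ) ≤
        ((α.toOrderHom (finOfInt k b) : Fin (m + 1)) : ℕ) := α.toOrderHom.monotone h2
      show _ + a / (k + 1) * (m + 1) ≤ _ + b / (k + 1) * (m + 1)
      rw [h1]
      exact add_le_add (by exact_mod_cast h3) le_rfl
    · have h2 : (a / (k + 1) + 1) * ((m : ℤ) + 1) ≤ b / (k + 1) * (m + 1) :=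
        mul_le_mul_of_nonneg_right h1 (by omega)
      show ((α.toOrderHom (finOfInt k a) : Fin (m + 1)) : ℕ) + a / (k + 1) * ((m : ℤ) + 1) ≤
        ((α.toOrderHom (finOfInt k b) : Fin (m + 1)) : ℕ) + b / (k + 1) * ((m : ℤ) + 1)
      rw [add_mul, one_mul] at h2
      omega
  map_add i := by
    have h1 : finOfInt k (i + (k + 1)) = finOfInt k i := by
      simpa using finOfInt_add k i 1
    have h2 : (i + (k + 1)) / ((k : ℤ) + 1) = i / (k + 1) + 1 := by
      rw [Int.add_ediv_of_dvd_right (dvd_refl _), Int.ediv_self (by omega)]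
    rw [h1, h2]
    ring

theorem finOfInt_natCast (k : ℕ) (j : Fin (k + 1)) (a : ℤ) :
    finOfInt k ((j : ℕ) + a * (k + 1)) = j ∧ (((j : ℕ) : ℤ) + a * (k + 1)) / (k + 1) = a := by
  have h := j.2
  constructor
  · rw [finOfInt_add]
    refine Fin.ext ?_
    zify
    rw [finOfInt_val]
    exact Int.emod_eq_of_lt (by omega) (by omega)
  · rw [Int.add_mul_ediv_right _ _ (by omega), Int.ediv_eq_zero_of_lt (by omega) (by omega), zero_add]

/-- On `(0, 1]` this is `Simplex.index_map`; elsewhere it follows by periodicity. -/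
theorem stepIndex_map {k m : ℕ} (α : SimplexCategory.mk k ⟶ SimplexCategory.mk m)
    (r : Simplex k) (y : ℝ) : stepIndex (r.map α).toSimLift y =
      (simplexCyclicMap α).toFun (stepIndex r.toSimLift y) := by
  obtain ⟨t, a, ht, rfl⟩ := exists_unitInterval_add_int y
  rw [stepIndex_add_int, stepIndex_add_int, stepIndex_toSimLift _ ht, stepIndex_toSimLift _ ht]
  have h := finOfInt_natCast k (r.index t) a
  show _ = (((α.toOrderHom (finOfInt k ((r.index t : ℕ) + a * (k + 1))) : Fin (m + 1)) : ℕ) : ℤ) +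
    ((r.index t : ℕ) + a * (k + 1)) / (k + 1) * (m + 1)
  rw [h.1, h.2, ← Simplex.index_map α r (Or.inl ht)]
  rfl

theorem simplexToLambda_map {k m : ℕ} (α : SimplexCategory.mk k ⟶ SimplexCategory.mk m) :
    simplexToLambda.map α = cycHom (simplexCyclicMap α) := by
  have h : ∀ j : Fin (k + 1), (simplexCyclicMap α).toFun (j : ℕ) =
      ((α.toOrderHom j : Fin (m + 1)) : ℕ) := fun j => by
    have := finOfInt_natCast k j 0
    rw [zero_mul, add_zero] at this
    show (((α.toOrderHom (finOfInt k (j : ℕ)) : Fin (m + 1)) : ℕ) : ℤ) + _ / _ * _ = _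
    rw [this.1, this.2, zero_mul, add_zero]
  refine InducedCategory.hom_ext ?_
  show monotoneFunctor (cycPoint k) (cycPoint m) (cycPoint_lt_add k) (cycPoint_lt_add m)
    α.toOrderHom (fun _ _ h => cycPoint_le_iff.2 (α.toOrderHom.monotone (cycPoint_le_iff.1 h))) =
      cycFunctor (simplexCyclicMap α)
  refine shiftFunctor_congr ?_ ?_
  · funext j
    refine (?_ : finOfInt m ((simplexCyclicMap α).toFun (j : ℕ)) = α.toOrderHom j).symm
    rw [h]
    have := (finOfInt_natCast m (α.toOrderHom j) 0).1
    rwa [zero_mul, add_zero] at this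
  · intro a b
    show cycPoint m (α.toOrderHom b) - cycPoint k b - (cycPoint m (α.toOrderHom a) - cycPoint k a) =
      ((simplexCyclicMap α).toFun (b : ℕ) : ℝ) / (m + 1) - cycPoint k b -
      (((simplexCyclicMap α).toFun (a : ℕ) : ℝ) / (m + 1) - cycPoint k a)
    rw [h, h]
    rfl

/-! ### The realization of a cyclic set as a quotient of simplices -/

theorem isIso_shiftFunctor {A B : Type} {p : A → Circle1} {q : B → Circle1} {φ : A → B} {ψ : B → A}
    {u : A → ℝ} {v : B → ℝ} {hφ hu hψ hv} (h : ∀ a, ψ (φ a) = a) (h' : ∀ b, φ (ψ b) = b)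
    (huv : ∀ a, u a + v (φ a) = 0) :
    (shiftFunctor φ u hφ hu : onCircle p ⟶ onCircle q) ≫ shiftFunctor ψ v hψ hv = 𝟙 _ ∧
      (shiftFunctor ψ v hψ hv : onCircle q ⟶ onCircle p) ≫ shiftFunctor φ u hφ hu = 𝟙 _ := by
  have huv' : ∀ b, v b + u (ψ b) = 0 := fun b => by
    have := huv (ψ b)
    rw [h'] at this
    linarith
  constructor
  · refine (shiftFunctor_comp (χ := id) (w := fun _ => 0) (hχ := by simp)
      (hw := fun _ _ _ ht _ => by simpa using ht) (funext fun a => (h a).symm) fun a b => ?_).symm.trans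
      (shiftFunctor_id rfl fun _ _ => sub_self _)
    linarith [huv a, huv b]
  · refine (shiftFunctor_comp (χ := id) (w := fun _ => 0) (hχ := by simp)
      (hw := fun _ _ _ ht _ => by simpa using ht) (funext fun a => (h' a).symm) fun a b => ?_).symm.trans
      (shiftFunctor_id rfl fun _ _ => sub_self _)
    linarith [huv' a, huv' b]

theorem exists_coe_unitInterval (z : Circle1) : ∃ y : unitInterval, 0 < y ∧ ((y : ℝ) : Circle1) = z := by
  obtain ⟨x, rfl⟩ := QuotientAddGroup.mk_surjective z
  obtain ⟨t, a, ht, rfl⟩ := exists_unitInterval_add_int x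
  refine ⟨t, ht, ?_⟩
  show ((t : ℝ) : Circle1) = ((t + a : ℝ) : Circle1)
  rw [AddCircle.coe_add, coe_intCast_circle, add_zero]

/-- The points of the interval over a finite subset of the circle. -/
theorem exists_interval_finset (G : CircleFinset) :
    ∃ F : Finset unitInterval, ∀ y : unitInterval, y ∈ F ↔ ((y : ℝ) : Circle1) ∈ G.1 := by
  classical
  have hfin : {y : unitInterval | ((y : ℝ) : Circle1) ∈ G.1}.Finite := by
    -- The projection to the circle is injective once the end `1` is removed.
    have h1 : ({y : unitInterval | ((y : ℝ) : Circle1) ∈ G.1} \ {1}).Finite := by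
      refine Set.Finite.of_finite_image (f := fun y : unitInterval => ((y : ℝ) : Circle1))
        (G.1.finite_toSet.subset ?_) ?_
      · rintro _ ⟨y, hy, rfl⟩
        exact hy.1
      · intro a ha b hb hab
        have ha1 : (a : ℝ) < 1 := unitInterval.lt_one_iff_ne_one.2 ha.2
        have hb1 : (b : ℝ) < 1 := unitInterval.lt_one_iff_ne_one.2 hb.2
        exact Subtype.ext ((AddCircle.coe_eq_coe_iff_of_mem_Ico (a := 0)
          ⟨a.2.1, by simpa using ha1⟩ ⟨b.2.1, by simpa using hb1⟩).1 hab)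
    exact (h1.union (Set.finite_singleton 1)).subset fun y hy => by
      by_cases h : y = 1
      · exact Or.inr h
      · exact Or.inl ⟨hy, h⟩
  exact ⟨hfin.toFinset, fun y => by simp⟩

/-- Sorting a finite subset of the circle which contains the base point. -/
theorem exists_isInterior_circle (G : CircleFinset) :
    ∃ (k : ℕ) (r : Simplex k), r.IsInterior ∧
      (∀ y : unitInterval, (∃ i, r.1 i = y) ↔ ((y : ℝ) : Circle1) ∈ G.1 ∧ y ≠ 0 ∧ y ≠ 1) ∧
      ∀ y : unitInterval, ((y : ℝ) : Circle1) ∈ G.1 → ∃ l, y = r.vertex l := by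
  obtain ⟨F, hF⟩ := exists_interval_finset G
  obtain ⟨k, r, hr, -, h⟩ := exists_isInterior F
  refine ⟨k, r, hr, fun y => ?_, fun y hy => ?_⟩
  · rw [h, hF]
  · exact Simplex.exists_vertex_eq h ((hF y).2 hy)

theorem simPoints_toSimLift {n : ℕ} (s : Simplex n) (G : CircleFinset) :
    simPoints s.toSimLift ≤ G ↔ (0 : Circle1) ∈ G.1 ∧ ∀ i, ((s.1 i : ℝ) : Circle1) ∈ G.1 := by
  have h : ((1 : ℝ) : Circle1) = 0 := AddCircle.coe_period 1
  constructor
  · intro hs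
    refine ⟨?_, fun i => ?_⟩
    · refine hs (Finset.mem_image.2 ⟨Fin.last n, Finset.mem_univ _, ?_⟩)
      simp [Simplex.toSimLift, h]
    · refine hs (Finset.mem_image.2 ⟨i.castSucc, Finset.mem_univ _, ?_⟩)
      simp [Simplex.toSimLift]
  · rintro ⟨h0, hi⟩ z hz
    obtain ⟨i, -, rfl⟩ := Finset.mem_image.1 hz
    induction i using Fin.lastCases with
    | last => simpa [Simplex.toSimLift, h] using h0
    | cast i => simpa [Simplex.toSimLift] using hi i

theorem stepRes_toSimLift {n : ℕ} (s : Simplex n) {y : unitInterval} (hy : 0 < y) :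
    stepRes s.toSimLift ((y : ℝ) : Circle1) = s.index y := by
  rw [stepRes_coe, stepIndex_toSimLift s hy]
  have h := (finOfInt_natCast n (s.index y) 0).1
  rw [zero_mul, add_zero] at h
  exact h

theorem stepRes_endPoint {n : ℕ} (x : SimLift n) {G : CircleFinset} (h : simPoints x ≤ G)
    (z : {z : Circle1 // z ∉ G.1}) : stepRes x (endPoint G (z : CirclePi0 G)) = stepRes x z := by
  obtain ⟨y, hy⟩ := QuotientAddGroup.mk_surjective (z : Circle1)
  have hy' : (z : Circle1) = y := hy.symm
  rw [endPoint_coe, hy', ← AddCircle.coe_add, stepRes_coe, stepRes_coe, stepIndex_add_gap x h]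

/-- Since the base point is in `G`, no component passes through it and indices can be compared
inside the interval. If `x ≤ y` had the same index but lay in different components, the first point
of `G` after `x` would be a vertex of `r` between them. -/
theorem stepRes_endPoint_bijective {k : ℕ} {r : Simplex k} (hr : r.IsInterior) {G : CircleFinset}
    (hG : simPoints r.toSimLift ≤ G)
    (h : ∀ y : unitInterval, (∃ i, r.1 i = y) ↔ ((y : ℝ) : Circle1) ∈ G.1 ∧ y ≠ 0 ∧ y ≠ 1) :
    Function.Bijective fun c : CirclePi0 G => stepRes r.toSimLift (endPoint G c) := by
  have h0 := ((simPoints_toSimLift r G).1 hG).1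
  constructor
  · have key : ∀ (x y : unitInterval) (hx : ((x : ℝ) : Circle1) ∉ G.1)
        (hy : ((y : ℝ) : Circle1) ∉ G.1), x ≤ y → r.index x = r.index y →
        ((⟨_, hx⟩ : {z : Circle1 // z ∉ G.1}) : CirclePi0 G) =
          ((⟨_, hy⟩ : {z : Circle1 // z ∉ G.1}) : CirclePi0 G) := by
      intro x y hx hy hxy hxy'
      have hxy1 : (x : ℝ) ≤ y := hxy
      refine circlePi0_eq_of_lt_gap G _ _ (t := y - x) (by linarith) ?_ ?_
      · show ((x : ℝ) : Circle1) + _ = _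
        rw [← AddCircle.coe_add, add_sub_cancel]
      · by_contra hlt
        push Not at hlt
        change gap G ((x : ℝ) : Circle1) ≤ y - x at hlt
        have hg := gap_pos hx
        let z : unitInterval := ⟨x + gap G ((x : ℝ) : Circle1), by linarith [x.2.1],
          by linarith [y.2.2]⟩
        have hzG : ((z : ℝ) : Circle1) ∈ G.1 := by
          show ((x + gap G ((x : ℝ) : Circle1) : ℝ) : Circle1) ∈ G.1
          rw [AddCircle.coe_add]
          exact add_gap_mem G _
        have hxz : x < z := by
          show (x : ℝ) < x + gap G ((x : ℝ) : Circle1)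
          linarith
        have hzy : z < y := by
          refine lt_of_le_of_ne ?_ (fun hzy => hy (hzy ▸ hzG))
          show (x : ℝ) + gap G ((x : ℝ) : Circle1) ≤ y
          linarith
        obtain ⟨i, hi⟩ := (h z).2 ⟨hzG, (unitInterval.nonneg'.trans_lt hxz).ne',
          (hzy.trans_le unitInterval.le_one').ne⟩
        rw [← hi] at hxz hzy
        have h1 := (lt_iff_lt_countBelow r.2 i _).1 hzy
        have h2 := mt (lt_iff_lt_countBelow r.2 i _).2 (not_lt_of_gt hxz)
        have h3 : countBelow r.1 x = countBelow r.1 y := congrArg Fin.val hxy'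
        omega
    intro a b
    obtain ⟨⟨x, hx⟩, rfl⟩ := ConnectedComponents.surjective_coe a
    obtain ⟨⟨y, hy⟩, rfl⟩ := ConnectedComponents.surjective_coe b
    obtain ⟨x, hx0, rfl⟩ := exists_coe_unitInterval x
    obtain ⟨y, hy0, rfl⟩ := exists_coe_unitInterval y
    simp only
    rw [stepRes_endPoint _ hG, stepRes_endPoint _ hG, stepRes_toSimLift r hx0,
      stepRes_toSimLift r hy0]
    intro hxy
    rcases le_total x y with hle | hle
    · exact key x y hx hy hle hxy
    · exact (key y x hy hx hle hxy.symm).symm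
  · intro c
    obtain ⟨F, hF⟩ := exists_interval_finset G
    obtain ⟨y, hyF, hy0, -, hy⟩ := hr.exists_index_eq F.finite_toSet c
    have hyG : ((y : ℝ) : Circle1) ∉ G.1 := fun h => hyF ((hF y).2 h)
    refine ⟨((⟨_, hyG⟩ : {z : Circle1 // z ∉ G.1}) : CirclePi0 G), ?_⟩
    simp only
    rw [stepRes_endPoint _ hG, stepRes_toSimLift r hy0, hy]

theorem isIso_stepMor {k : ℕ} {r : Simplex k} (hr : r.IsInterior) {G : CircleFinset}
    (hG : simPoints r.toSimLift ≤ G)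
    (h : ∀ y : unitInterval, (∃ i, r.1 i = y) ↔ ((y : ℝ) : Circle1) ∈ G.1 ∧ y ≠ 0 ∧ y ≠ 1) :
    IsIso (stepMor r.toSimLift G) := by
  let e := Equiv.ofBijective _ (stepRes_endPoint_bijective hr hG h)
  choose p hp0 hp using fun c : CirclePi0 G => exists_coe_unitInterval (endPoint G c : Circle1)
  have he : ∀ c, e c = r.index (p c) := fun c => by
    show stepRes _ _ = _
    rw [← hp, stepRes_toSimLift r (hp0 c)]
  have hpos : ∀ c, (0 : ℝ) < p c := hp0
  let g : cyc k ⟶ onCircle (fun c : CirclePi0 G => (endPoint G c : Circle1)) :=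
    shiftFunctor (p := fun j : Fin (k + 1) => (cycPoint k j : Circle1)) e.symm
      (fun j => p (e.symm j) - cycPoint k j)
      (fun j => by rw [← hp, AddCircle.coe_sub, add_sub_cancel])
      (fun a b t ht hab => by
        rw [← AddCircle.coe_add] at hab
        obtain ⟨m, hm⟩ := exists_int_of_coe_eq hab
        have e1 : t + (p (e.symm b) - cycPoint k b - (p (e.symm a) - cycPoint k a)) =
            m + (p (e.symm b) - p (e.symm a)) := by linarith
        rw [e1]
        have h1 := (p (e.symm b)).2.1
        have h2 := (p (e.symm a)).2.2
        -- Here `m` counts full turns. Negative values contradict `t ≥ 0`, for `m = 0` the order of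
        -- the vertices decides, and for `m ≥ 1` the representatives `p` in the unit interval leave
        -- enough room.
        rcases lt_trichotomy m 0 with hm0 | hm0 | hm0
        · have : (m : ℝ) ≤ -1 := by exact_mod_cast (by omega : m ≤ -1)
          have := cycPoint_lt_add k b a
          linarith
        · subst hm0
          have hab' : a ≤ b := by
            rw [← cycPoint_le_iff]
            push_cast at hm
            linarith
          have h3 : p (e.symm a) ≤ p (e.symm b) := by
            by_contra hlt
            have h4 : r.index (p (e.symm b)) ≤ r.index (p (e.symm a)) :=
              countBelow_mono r.1 (not_le.1 hlt).le
            rw [← he, ← he, e.apply_symm_apply, e.apply_symm_apply] at h4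
            have := le_antisymm hab' h4
            subst this
            exact hlt le_rfl
          have h3' : (p (e.symm a) : ℝ) ≤ p (e.symm b) := h3
          push_cast
          linarith
        · have : (1 : ℝ) ≤ m := by exact_mod_cast (by omega : 1 ≤ m)
          linarith)
  have hinv : stepHom r.toSimLift G ≫ g = 𝟙 _ ∧ g ≫ stepHom r.toSimLift G = 𝟙 _ := by
    refine isIso_shiftFunctor (fun c => e.symm_apply_apply c) (fun j => e.apply_symm_apply j)
      fun c => ?_
    have h1 : e.symm (stepRes r.toSimLift (endPoint G c)) = c := e.symm_apply_apply c
    rw [h1, ← hp, degShift_stepDeg_coe, stepRes_toSimLift r (hp0 c), stepIndex_toSimLift r (hp0 c)]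
    show ((countBelow r.1 (p c) : ℤ) : ℝ) / (k + 1) - p c + (p c - (countBelow r.1 (p c) : ℝ) / (k + 1)) = 0
    push_cast
    ring
  exact ⟨ObjectProperty.homMk g, ObjectProperty.hom_ext _ hinv.1, ObjectProperty.hom_ext _ hinv.2⟩

instance : IsDirectedOrder CircleFinset := by
  classical
  exact ⟨fun F F' => ⟨⟨F.1 ∪ F'.1, F.2.mono Finset.subset_union_left⟩,
    Finset.subset_union_left, Finset.subset_union_right⟩⟩

instance : Nonempty CircleFinset := ⟨⟨{0}, Finset.singleton_nonempty _⟩⟩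

/-- A finite subset of the circle together with the base point. -/
theorem exists_ge_zero_mem (F : CircleFinset) : ∃ G, F ≤ G ∧ (0 : Circle1) ∈ G.1 := by
  obtain ⟨G, h, h'⟩ := exists_ge_ge F ⟨{0}, Finset.singleton_nonempty _⟩
  exact ⟨G, h, h' (by simp)⟩

namespace CyclicRealization

variable (X : CyclicSet.{u})

theorem mk_res {F F' : CircleFinset} (h : F ≤ F')
    (x : (cyclicBig X).obj (op (circlePi0 F))) :
    mk X F' ((cyclicBig X).map (circlePi0Map h).op x) = mk X F x :=
  congrArg (fun f => f x)
    (Limits.colimit.w (circlePi0Functor.rightOp ⋙ cyclicBig X) (homOfLE h))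

theorem mk_surjective (y : CyclicRealization X) : ∃ F x, mk X F x = y :=
  Limits.Types.jointly_surjective' y

theorem mk_eq {F F' : CircleFinset} {x : (cyclicBig X).obj (op (circlePi0 F))}
    {x' : (cyclicBig X).obj (op (circlePi0 F'))} (h : mk X F x = mk X F' x') :
    ∃ (G : CircleFinset) (h : F ≤ G) (h' : F' ≤ G),
      (cyclicBig X).map (circlePi0Map h).op x = (cyclicBig X).map (circlePi0Map h').op x' := by
  obtain ⟨G, f, g, hfg⟩ := (Limits.Types.FilteredColimit.colimit_eq_iff _).1 h
  exact ⟨G, leOfHom f, leOfHom g, hfg⟩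

theorem charMap_eq {n : ℕ} (x : X.obj (op (n : Lambda))) (s : SimLift n) {G : CircleFinset}
    (h : simPoints s ≤ G) : charMap X x s = mk X G (pullback lambdaEquivalence X (stepMor s G) x) := by
  rw [charMap, ← mk_res X h, map_pullback, simStep_eq, map_stepMor s h le_rfl]

/-- The general naturality of characteristic maps; the simplicial operators and the rolling of
tuples are both instances of it. -/
theorem charMap_cycHom {k n : ℕ} (f : CyclicMap k n) {r : SimLift k} {s : SimLift n}
    (h : ∀ y, stepIndex s y = f.toFun (stepIndex r y)) (x : X.obj (op (n : Lambda))) :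
    charMap X x s = charMap X (X.map (cycHom f).op x) r := by
  obtain ⟨G, h1, h2⟩ := exists_ge_ge (simPoints s) (simPoints r)
  rw [charMap_eq X x s h1, charMap_eq X _ r h2, ← stepMor_cycHom f h G, pullback_map]

theorem map_simStep_toSimLift {k m : ℕ} (α : SimplexCategory.mk k ⟶ SimplexCategory.mk m)
    (r : Simplex k) {G : CircleFinset} (h : simPoints (r.map α).toSimLift ≤ G)
    (x : X.obj (op (m : Lambda))) : (cyclicBig X).map (circlePi0Map h).op
        (pullback lambdaEquivalence X (simStep (r.map α).toSimLift) x) =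
      pullback lambdaEquivalence X (stepMor r.toSimLift G) (X.map (simplexToLambda.map α).op x) := by
  rw [map_pullback, simStep_eq, map_stepMor _ h le_rfl, simplexToLambda_map,
    ← stepMor_cycHom (simplexCyclicMap α) (stepIndex_map α r), pullback_map]
  rfl

/-- Adding the base point to a finite set does not change classes in the limit, and the circle cut
there is an interval. The proof for simplicial sets then carries over, with `isIso_stepMor` in place
of `Simplex.isIso_stepOn`. -/
theorem isSimplexQuotient : IsSimplexQuotient (underlyingSSet X)
    fun n x s => charMap X (n := n) x s.toSimLift where
  surj y := by
    obtain ⟨F, z, rfl⟩ := mk_surjective X y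
    obtain ⟨G, hFG, h0⟩ := exists_ge_zero_mem F
    rw [← mk_res X hFG]
    generalize (cyclicBig X).map (circlePi0Map hFG).op z = z
    obtain ⟨k, r, hr, h, -⟩ := exists_isInterior_circle G
    have hG : simPoints r.toSimLift ≤ G :=
      (simPoints_toSimLift r G).2 ⟨h0, fun i => ((h _).1 ⟨i, rfl⟩).1⟩
    have := isIso_stepMor hr hG h
    obtain ⟨x, rfl⟩ := (pullback_bijective lambdaEquivalence X (stepMor r.toSimLift G)).2 z
    exact ⟨k, x, r, charMap_eq X x r.toSimLift hG⟩
  nat {k m} α x r := by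
    refine (charMap_cycHom X (simplexCyclicMap α) (stepIndex_map α r) x).trans ?_
    rw [← simplexToLambda_map]
    rfl
  exact {m n} x x' s s' heq := by
    obtain ⟨G, h, h', hG⟩ := mk_eq X heq
    have hs := (simPoints_toSimLift s G).1 h
    have hs' := (simPoints_toSimLift s' G).1 h'
    obtain ⟨k, r, hr, hrG, hv⟩ := exists_isInterior_circle G
    obtain ⟨α, rfl⟩ := r.exists_map_eq s fun i => hv _ (hs.2 i)
    obtain ⟨β, rfl⟩ := r.exists_map_eq s' fun i => hv _ (hs'.2 i)
    refine ⟨k, α, β, r, rfl, rfl, ?_⟩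
    have hrG' : simPoints r.toSimLift ≤ G :=
      (simPoints_toSimLift r G).2 ⟨hs.1, fun i => ((hrG _).1 ⟨i, rfl⟩).1⟩
    have := isIso_stepMor hr hrG' hrG
    refine (pullback_bijective lambdaEquivalence X (stepMor r.toSimLift G)).1 ?_
    exact (map_simStep_toSimLift X α r h x).symm.trans (hG.trans (map_simStep_toSimLift X β r h' x'))

end CyclicRealization

/-! ### The action of the homeomorphisms of the circle -/

/-- The difference is continuous with integer values on a connected space. Lifts of group elements
are chosen arbitrarily, so they respect the group law only up to such constants. -/
theorem exists_int_lift_eq {f f' : ℝ → ℝ} (hf : Continuous f) (hf' : Continuous f')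
    (h : ∀ x, (f x : Circle1) = f' x) : ∃ m : ℤ, ∀ x, f x = f' x + m := by
  choose m hm using fun x => exists_int_of_coe_eq (h x)
  have hc : Continuous m := by
    rw [Int.isClosedEmbedding_coe_real.isInducing.continuous_iff]
    have : ((↑) ∘ m : ℝ → ℝ) = fun x => f x - f' x := by
      funext x
      show (m x : ℝ) = _
      rw [hm x]; ring
    rw [this]
    exact hf.sub hf'
  exact ⟨m 0, fun x => by rw [hm x, PreconnectedSpace.constant inferInstance hc (x := x) (y := 0)]⟩

theorem degShift_circleLiftDeg_coe (g : AutCircle) (x : ℝ) :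
    degShift (circleLiftDeg g) (x : Circle1) = circleLift g x - x := degShift_coe _ _

theorem degShift_one : ∃ m : ℤ, ∀ z, degShift (circleLiftDeg 1) z = m := by
  obtain ⟨m, hm⟩ := exists_int_lift_eq (f := circleLift 1) (f' := id) (circleLift 1).continuous
    continuous_id fun x => (circleLift_coe 1 x).symm
  refine ⟨m, fun z => ?_⟩
  obtain ⟨x, rfl⟩ := QuotientAddGroup.mk_surjective z
  refine (degShift_circleLiftDeg_coe 1 x).trans ?_
  rw [hm]
  simp

/-- The constant `m` cancels in `shiftFunctor`, which depends only on differences of displacements.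
-/
theorem degShift_mul (g g' : AutCircle) : ∃ m : ℤ, ∀ z, degShift (circleLiftDeg (g * g')) z =
    degShift (circleLiftDeg g') z + degShift (circleLiftDeg g) (g'.1 z) + m := by
  obtain ⟨m, hm⟩ := exists_int_lift_eq (f := circleLift (g * g'))
    (f' := fun x => circleLift g (circleLift g' x)) (circleLift (g * g')).continuous
    ((circleLift g).continuous.comp (circleLift g').continuous) fun x => by
      rw [← circleLift_coe, ← circleLift_coe, ← circleLift_coe]
      rfl
  refine ⟨m, fun z => ?_⟩
  obtain ⟨x, rfl⟩ := QuotientAddGroup.mk_surjective z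
  show degShift _ ((x : ℝ) : Circle1) = degShift _ ((x : ℝ) : Circle1) +
    degShift _ (g'.1 ((x : ℝ) : Circle1)) + m
  rw [circleLift_coe, degShift_circleLiftDeg_coe, degShift_circleLiftDeg_coe,
    degShift_circleLiftDeg_coe, hm]
  ring

theorem circleLift_inv (g : AutCircle) : ∃ m : ℤ, ∀ x, circleLift g⁻¹ x = (circleLift g).symm x + m :=
  exists_int_lift_eq (circleLift g⁻¹).continuous (circleLift g).symm.continuous fun x => by
    rw [← circleLift_coe]
    refine g.1.injective ?_
    rw [circleLift_coe g, OrderIso.apply_symm_apply]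
    exact g.1.apply_symm_apply _

theorem endPoint_aut' (g : AutCircle) {F F' : CircleFinset} (h : ∀ z, z ∈ F.1 ↔ g.1 z ∈ F'.1)
    (c : CirclePi0 F) : (endPoint F' (circlePi0AutFun g h c) : Circle1) = g.1 (endPoint F c) := by
  rw [endPoint_aut, autCircle_apply]

/-- The underlying `ℤ₊`-functor of `circlePi0Aut`. -/
noncomputable def circlePi0AutHom (g : AutCircle) {F F' : CircleFinset}
    (h : ∀ z, z ∈ F.1 ↔ g.1 z ∈ F'.1) :
    onCircle (fun c : CirclePi0 F => (endPoint F c : Circle1)) ⟶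
      onCircle fun c : CirclePi0 F' => (endPoint F' c : Circle1) :=
  shiftFunctor (circlePi0AutFun g h)
    (fun c => degShift (circleLiftDeg g) (endPoint F c)) (endPoint_aut g h)
    fun _ _ _ ht h => degShift_le _ ht h

theorem circlePi0Map_refl (F : CircleFinset) : circlePi0Map (le_refl F) = 𝟙 (circlePi0 F) :=
  ObjectProperty.hom_ext _ (circlePi0MapHom_refl F)

theorem circlePi0Map_aut (g : AutCircle) {F F' G G' : CircleFinset}
    (h : ∀ z, z ∈ F.1 ↔ g.1 z ∈ F'.1) (h' : ∀ z, z ∈ G.1 ↔ g.1 z ∈ G'.1) (hFG : F ≤ G)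
    (hFG' : F' ≤ G') : circlePi0Map hFG ≫ circlePi0Aut g h =
      circlePi0Aut g h' ≫ circlePi0Map hFG' := by
  refine ObjectProperty.hom_ext _ ?_
  show circlePi0MapHom hFG ≫ circlePi0AutHom g h = circlePi0AutHom g h' ≫ circlePi0MapHom hFG'
  -- Both composites move an end point by the same real number: go to the next point of `F` and
  -- apply the lift, or apply the lift and go to the next point of `F'`.
  have key : ∀ c : CirclePi0 G, gap F (endPoint G c) +
      degShift (circleLiftDeg g) (endPoint F (circlePi0Incl hFG c)) =
      degShift (circleLiftDeg g) (endPoint G c) + gap F' (endPoint G' (circlePi0AutFun g h' c)) := by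
    intro c
    rw [endPoint_aut', gap_autCircle g h, endPoint_incl]
    ring
  have hobj : circlePi0AutFun g h ∘ circlePi0Incl hFG =
      circlePi0Incl hFG' ∘ circlePi0AutFun g h' := by
    funext c
    obtain ⟨x, rfl⟩ := ConnectedComponents.surjective_coe c
    rfl
  refine (shiftFunctor_comp (χ := circlePi0AutFun g h ∘ circlePi0Incl hFG)
    (w := fun c => gap F (endPoint G c) +
      degShift (circleLiftDeg g) (endPoint F (circlePi0Incl hFG c))) (hχ := fun c => ?_)
    (hw := fun a b t ht hab => ?_) rfl fun a b => by ring).symm.trans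
    (shiftFunctor_comp hobj fun a b => ?_)
  · rw [Function.comp_apply, endPoint_aut, endPoint_incl, AddCircle.coe_add, add_assoc]
  · rw [key, key]
    have h1 := degShift_le (circleLiftDeg g) ht hab
    have h2 := gap_le_add F' h1 (x := endPoint G' (circlePi0AutFun g h' a))
      (y := endPoint G' (circlePi0AutFun g h' b)) (by
        rw [endPoint_aut, endPoint_aut, ← hab, AddCircle.coe_add, AddCircle.coe_sub]; abel)
    linarith
  · simp only [key]
    ring

/-- Stated for any `g` with a proof of `g = 1` because the action involves `1⁻¹`; the same device
serves for products below. -/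
theorem circlePi0Aut_of_eq_one {g : AutCircle} (hg : g = 1) {F F' : CircleFinset}
    (h : ∀ z, z ∈ F.1 ↔ g.1 z ∈ F'.1) (hF : F' ≤ F) : circlePi0Aut g h = circlePi0Map hF := by
  subst hg
  refine ObjectProperty.hom_ext _ ?_
  show circlePi0AutHom 1 h = circlePi0MapHom hF
  obtain ⟨m, hm⟩ := degShift_one
  refine shiftFunctor_congr ?_ fun a b => ?_
  · funext c
    obtain ⟨x, rfl⟩ := ConnectedComponents.surjective_coe c
    rfl
  · have : ∀ c : CirclePi0 F, gap F' (endPoint F c) = 0 := fun c =>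
      le_antisymm (gap_le le_rfl (by simpa using (h _).1 (endPoint F c).2)) (gap_nonneg _ _)
    rw [hm, hm, this, this]
    ring

theorem circlePi0Aut_of_eq_mul {a g g' : AutCircle} (ha : a = g * g') {F F' F'' : CircleFinset}
    (h : ∀ z, z ∈ F.1 ↔ g'.1 z ∈ F'.1) (h' : ∀ z, z ∈ F'.1 ↔ g.1 z ∈ F''.1)
    (h'' : ∀ z, z ∈ F.1 ↔ a.1 z ∈ F''.1) :
    circlePi0Aut a h'' = circlePi0Aut g' h ≫ circlePi0Aut g h' := by
  subst ha
  refine ObjectProperty.hom_ext _ ?_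
  show circlePi0AutHom (g * g') h'' = circlePi0AutHom g' h ≫ circlePi0AutHom g h'
  obtain ⟨m, hm⟩ := degShift_mul g g'
  refine shiftFunctor_comp ?_ fun a b => ?_
  · funext c
    obtain ⟨x, rfl⟩ := ConnectedComponents.surjective_coe c
    rfl
  · rw [hm, hm, endPoint_aut', endPoint_aut']
    ring

/-- The image of a cyclically ordered tuple under an increasing lift. -/
noncomputable def SimLift.mapAut {n : ℕ} (g : AutCircle) (s : SimLift n) : SimLift n :=
  ⟨fun i => circleLift g (s.1 i), fun _ _ h => (circleLift g).monotone (s.2.1 h),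
    ((circleLift g).monotone s.2.2).trans_eq (g.2.choose_spec.1 _)⟩

/-- `⌈y - x⌉ ≤ m` means `y ≤ x + m`, which an increasing lift commuting with integral translations
preserves. -/
theorem stepIndex_mapAut {n : ℕ} (g : AutCircle) (s : SimLift n) (y : ℝ) :
    stepIndex (s.mapAut g) (circleLift g y) = stepIndex s y := by
  refine Finset.sum_congr rfl fun i _ => ?_
  have h1 : ∀ m : ℤ, ⌈circleLift g y - circleLift g (s.1 i)⌉ ≤ m ↔ ⌈y - s.1 i⌉ ≤ m := fun m => by
    rw [Int.ceil_le, Int.ceil_le, sub_le_iff_le_add', sub_le_iff_le_add',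
      show circleLift g (s.1 i) + m = circleLift g (s.1 i + m) from
        ((circleLiftDeg g).map_add_int (s.1 i) m).symm]
    exact (circleLift g).le_iff_le
  exact le_antisymm ((h1 _).2 le_rfl) ((h1 _).1 le_rfl)

/-- The term with `m` absorbs the ambiguity between the chosen lift of `g⁻¹` and the inverse of the
chosen lift of `g`. -/
theorem circlePi0Aut_stepMor (g : AutCircle) {F F' : CircleFinset}
    (h : ∀ z, z ∈ F.1 ↔ g.1 z ∈ F'.1) {n : ℕ} {s s' : SimLift n} {m : ℤ}
    (hs : ∀ y, stepIndex s' (circleLift g y) = stepIndex s y + m * (n + 1)) :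
    circlePi0Aut g h ≫ stepMor s' F' = stepMor s F := by
  refine ObjectProperty.hom_ext _ ?_
  show circlePi0AutHom g h ≫ stepHom s' F' = stepHom s F
  refine (shiftFunctor_comp ?_ fun a b => ?_).symm
  · funext c
    obtain ⟨y, hy⟩ := QuotientAddGroup.mk_surjective (endPoint F c : Circle1)
    have hy' : (endPoint F c : Circle1) = y := hy.symm
    rw [Function.comp_apply, endPoint_aut', hy', circleLift_coe, stepRes_coe, stepRes_coe, hs,
      finOfInt_add]
  · have key : ∀ c : CirclePi0 F, degShift (stepDeg s) (endPoint F c) + m =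
        degShift (circleLiftDeg g) (endPoint F c) +
          degShift (stepDeg s') (endPoint F' (circlePi0AutFun g h c)) := fun c => by
      obtain ⟨y, hy⟩ := QuotientAddGroup.mk_surjective (endPoint F c : Circle1)
      have hy' : (endPoint F c : Circle1) = y := hy.symm
      rw [endPoint_aut', hy', circleLift_coe, degShift_stepDeg_coe, degShift_stepDeg_coe,
        degShift_circleLiftDeg_coe, hs]
      push_cast
      field_simp
      ring
    linarith [key a, key b]

namespace CyclicRealization

variable (X : CyclicSet.{u})

theorem exists_desc {Z : Type*} (f : ∀ F : CircleFinset, (cyclicBig X).obj (op (circlePi0 F)) → Z)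
    (hf : ∀ (F F' : CircleFinset) (h : F ≤ F') x,
      f F' ((cyclicBig X).map (circlePi0Map h).op x) = f F x) :
    ∃ φ : CyclicRealization X → Z, ∀ F x, φ (mk X F x) = f F x := by
  choose F x hx using mk_surjective X
  refine ⟨fun y => f (F y) (x y), fun F' x' => ?_⟩
  obtain ⟨G, h, h', hG⟩ := mk_eq X (hx (mk X F' x'))
  show f _ (x _) = f F' x'
  rw [← hf _ _ h, hG, hf]

theorem exists_action (g : AutCircle) :
    ∃ φ : CyclicRealization X → CyclicRealization X, ∀ F x,
      φ (mk X F x) = mk X (circleImage g F)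
        ((cyclicBig X).map (circlePi0Aut g⁻¹ (mem_circleImage g F)).op x) := by
  refine exists_desc X _ fun F F' h x => ?_
  have h' : circleImage g F ≤ circleImage g F' := Finset.map_subset_map.2 h
  rw [← mk_res X h', ← Functor.map_comp_apply, ← Functor.map_comp_apply, ← op_comp, ← op_comp,
    circlePi0Map_aut]

noncomputable instance : MulAction AutCircle (CyclicRealization X) where
  smul g := (exists_action X g).choose
  one_smul y := by
    obtain ⟨F, x, rfl⟩ := mk_surjective X y
    refine ((exists_action X 1).choose_spec F x).trans ?_
    have h : F ≤ circleImage 1 F := fun z hz => (mem_circleImage 1 F z).2 hz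
    rw [← mk_res X h]
    rw [circlePi0Aut_of_eq_one inv_one (mem_circleImage 1 F) h]
  mul_smul g g' y := by
    obtain ⟨F, x, rfl⟩ := mk_surjective X y
    have e : circleImage g (circleImage g' F) = circleImage (g * g') F := by
      refine Subtype.ext (Finset.ext fun z => ?_)
      rw [mem_circleImage, mem_circleImage, mem_circleImage, mul_inv_rev]
      rfl
    -- Rewriting the membership statement, rather than the elements, gives a version of
    -- `circlePi0Aut` whose source is already the image under `g * g'`.
    have h1 := mem_circleImage g (circleImage g' F)
    rw [e] at h1
    refine ((exists_action X (g * g')).choose_spec F x).trans (Eq.symm ?_)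
    refine (congrArg (exists_action X g).choose ((exists_action X g').choose_spec F x)).trans ?_
    refine ((exists_action X g).choose_spec _ _).trans ?_
    rw [← mk_res X e.le, ← Functor.map_comp_apply, ← Functor.map_comp_apply, ← op_comp, ← op_comp,
      circlePi0Map_aut _ _ h1 _ le_rfl, circlePi0Map_refl, Category.comp_id,
      circlePi0Aut_of_eq_mul (mul_inv_rev g g') h1 (mem_circleImage g' F)]

theorem smul_mk (g : AutCircle) (F : CircleFinset) (x : (cyclicBig X).obj (op (circlePi0 F))) :
    g • mk X F x = mk X (circleImage g F)
      ((cyclicBig X).map (circlePi0Aut g⁻¹ (mem_circleImage g F)).op x) :=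
  (exists_action X g).choose_spec F x

/-- The definition by direct limits becomes a formula in coordinates: transporting the step function
along `g⁻¹` is moving its jumps by `g`. -/
theorem smul_charMap (g : AutCircle) {n : ℕ} (x : X.obj (op (n : Lambda))) (s : SimLift n) :
    g • charMap X x s = charMap X x (s.mapAut g) := by
  have h : simPoints (s.mapAut g) ≤ circleImage g (simPoints s) := by
    intro z hz
    obtain ⟨i, -, rfl⟩ := Finset.mem_image.1 hz
    refine Finset.mem_map.2 ⟨(s.1 i : Circle1), ?_, circleLift_coe g (s.1 i)⟩
    exact Finset.mem_image_of_mem _ (Finset.mem_univ i)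
  rw [charMap_eq X x _ h, charMap_eq X x s le_rfl, smul_mk, map_pullback]
  obtain ⟨m, hm⟩ := circleLift_inv g
  rw [circlePi0Aut_stepMor g⁻¹ (mem_circleImage g _) (s := s.mapAut g) (m := m)]
  intro y
  rw [hm, stepIndex_add_int, ← stepIndex_mapAut g s, OrderIso.apply_symm_apply]

end CyclicRealization

/-! ### Continuity of the maps from cyclically ordered tuples -/

/-- The extension of `x₀, …, x_n` to a sequence with `x_{i + n + 1} = x_i + 1`. -/
noncomputable def SimLift.seq {n : ℕ} (s : SimLift n) (i : ℤ) : ℝ :=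
  s.1 (finOfInt n i) + ((i / (n + 1) : ℤ) : ℝ)

theorem SimLift.seq_add_mul {n : ℕ} (s : SimLift n) (j : Fin (n + 1)) (a : ℤ) :
    s.seq ((j : ℕ) + a * (n + 1)) = s.1 j + a := by
  have h := finOfInt_natCast n j a
  rw [seq, h.1, h.2]

theorem SimLift.seq_coe {n : ℕ} (s : SimLift n) (j : Fin (n + 1)) : s.seq (j : ℕ) = s.1 j := by
  simpa using s.seq_add_mul j 0

theorem exists_fin_add_mul (n : ℕ) (i : ℤ) : ∃ (j : Fin (n + 1)) (a : ℤ), i = (j : ℕ) + a * (n + 1) :=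
  ⟨finOfInt n i, i / (n + 1), by rw [finOfInt_val_eq]; ring⟩

theorem SimLift.seq_add {n : ℕ} (s : SimLift n) (i : ℤ) (m : ℤ) :
    s.seq (i + m * (n + 1)) = s.seq i + m := by
  obtain ⟨j, a, rfl⟩ := exists_fin_add_mul n i
  rw [show ((j : ℕ) : ℤ) + a * (n + 1) + m * (n + 1) = (j : ℕ) + (a + m) * (n + 1) by ring,
    seq_add_mul, seq_add_mul]
  push_cast
  ring

theorem SimLift.le_add_one {n : ℕ} (s : SimLift n) (i j : Fin (n + 1)) : s.1 i ≤ s.1 j + 1 :=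
  (s.2.1 (Fin.le_last i)).trans (s.2.2.trans (by linarith [s.2.1 (Fin.zero_le j)]))

theorem SimLift.seq_mono {n : ℕ} (s : SimLift n) : Monotone s.seq := by
  intro a b hab
  have hk : (0 : ℤ) < n + 1 := by omega
  have h1 : a / (n + 1) ≤ b / (n + 1) := Int.ediv_le_ediv hk hab
  unfold seq
  rcases eq_or_lt_of_le h1 with h1 | h1
  · have h2 : finOfInt n a ≤ finOfInt n b := by
      rw [Fin.le_def]
      zify
      rw [finOfInt_val_eq, finOfInt_val_eq, h1]
      linarith
    have := s.2.1 h2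
    rw [h1]
    linarith
  · have h2 : ((a / (n + 1) : ℤ) : ℝ) + 1 ≤ ((b / (n + 1) : ℤ) : ℝ) := by exact_mod_cast h1
    have := s.le_add_one (finOfInt n a) (finOfInt n b)
    linarith

theorem SimLift.continuous_seq (n : ℕ) (i : ℤ) : Continuous fun s : SimLift n => s.seq i :=
  ((continuous_apply (finOfInt n i)).comp continuous_subtype_val).add continuous_const

/-- The step function and the extended sequence are adjoint, so each determines the other. After a
translation `i` is an index `j` in `[n]`, and the ceilings are compared with the indicator of `l <
j`, whose sum is `j`. -/
theorem stepIndex_le_iff {n : ℕ} (s : SimLift n) (y : ℝ) (i : ℤ) :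
    stepIndex s y ≤ i ↔ y ≤ s.seq i := by
  obtain ⟨j, a, rfl⟩ := exists_fin_add_mul n i
  obtain ⟨y, rfl⟩ : ∃ z : ℝ, y = z + a := ⟨y - a, by ring⟩
  rw [stepIndex_add_int, s.seq_add_mul, add_le_add_iff_right, add_le_add_iff_right]
  have hcard : ∀ j : Fin (n + 1), ∑ l : Fin (n + 1), (if l < j then (1 : ℤ) else 0) = (j : ℕ) := by
    intro j
    rw [Finset.sum_boole, Finset.filter_gt_eq_Iio, Fin.card_Iio]
  constructor
  · intro h
    by_contra hlt
    push Not at hlt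
    have h1 : ∑ l : Fin (n + 1), (if l < j then (1 : ℤ) else 0) <
        ∑ l : Fin (n + 1), ⌈y - s.1 l⌉ := by
      refine Finset.sum_lt_sum (fun l _ => ?_) ⟨j, Finset.mem_univ _, ?_⟩
      · split_ifs with hl
        · have := s.2.1 hl.le
          rw [Int.one_le_ceil_iff]
          linarith
        · have h1 := s.le_add_one l j
          have : (-1 : ℤ) < ⌈y - s.1 l⌉ := by
            rw [Int.lt_ceil]
            push_cast
            linarith
          omega
      · rw [if_neg (lt_irrefl _), Int.lt_ceil]
        push_cast
        linarith
    rw [hcard] at h1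
    exact absurd h (not_le_of_gt h1)
  · intro h
    rw [← hcard j]
    refine Finset.sum_le_sum fun l _ => ?_
    rw [Int.ceil_le]
    split_ifs with hl
    · have := s.le_add_one j l
      push_cast
      linarith
    · have := s.2.1 (not_lt.1 hl)
      push_cast
      linarith

/-- Tuples whose extension changes sign at the index `k`. -/
def SimLift.window (n : ℕ) (k : ℤ) : Set (SimLift n) := {s | s.seq (k - 1) ≤ 0 ∧ 0 ≤ s.seq k}

theorem SimLift.isClosed_window (n : ℕ) (k : ℤ) : IsClosed (window n k) :=
  (isClosed_le (continuous_seq n _) continuous_const).inter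
    (isClosed_le continuous_const (continuous_seq n _))

theorem SimLift.mem_window (n : ℕ) (s : SimLift n) : s ∈ window n (stepIndex s 0) := by
  constructor
  · by_contra h
    have := (stepIndex_le_iff s 0 (stepIndex s 0 - 1)).2 (not_le.1 h).le
    omega
  · exact (stepIndex_le_iff s 0 _).1 le_rfl

theorem SimLift.bounds_of_mem_window {n : ℕ} {k : ℤ} {s : SimLift n} (h : s ∈ window n k) :
    stepIndex s 0 ≤ k ∧ k ≤ stepIndex s 1 := by
  refine ⟨(stepIndex_le_iff s 0 k).2 h.2, ?_⟩
  by_contra hlt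
  have := (stepIndex_le_iff s 1 (k - 1)).1 (by omega)
  linarith [h.1]

/-- If each coordinate moves by less than `1`, the values of the step function at `0` and `1` stay
between those of `s` at `-1` and `2`, and these values bound `k`. -/
theorem SimLift.locallyFinite_window (n : ℕ) : LocallyFinite (window n) := by
  intro s
  refine ⟨{t | ∀ i, |t.1 i - s.1 i| < 1}, ?_,
    (Set.finite_Icc (stepIndex s (-1)) (stepIndex s 2)).subset ?_⟩
  · refine IsOpen.mem_nhds ?_ (by simp)
    rw [Set.ofPred_forall]
    refine isOpen_iInter_of_finite fun i => ?_
    have : Continuous fun t : SimLift n => t.1 i := (continuous_apply i).comp continuous_subtype_val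
    exact isOpen_lt (this.sub continuous_const).abs continuous_const
  · rintro k ⟨t, ht, hts⟩
    obtain ⟨h1, h2⟩ := bounds_of_mem_window ht
    constructor
    · refine le_trans (Finset.sum_le_sum fun i _ => Int.ceil_mono ?_) h1
      linarith [(abs_lt.1 (hts i)).2]
    · refine h2.trans (Finset.sum_le_sum fun i _ => Int.ceil_mono ?_)
      linarith [(abs_lt.1 (hts i)).1]

/-- The point of the standard simplex formed by `x_k ≤ … ≤ x_{k + n}`. -/
noncomputable def SimLift.roll {n : ℕ} (k : ℤ) (s : SimLift n) : Simplex (n + 1) :=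
  ⟨fun j => Set.projIcc 0 1 zero_le_one (s.seq (k + (j : ℕ))), fun _ _ h =>
    Set.monotone_projIcc _ (s.seq_mono (by simpa using h))⟩

theorem SimLift.continuous_roll (n : ℕ) (k : ℤ) : Continuous (roll k : SimLift n → Simplex (n + 1)) :=
  Continuous.subtype_mk (continuous_pi fun _ => continuous_projIcc.comp (continuous_seq n _)) _

/-- On the window the `n + 1` points starting at `x_k` lie in `[0, 1]`, because `x_{k+n} = x_{k-1} +
1 ≤ 1`; the projection that makes `roll` continuous everywhere has no effect there. -/
theorem SimLift.roll_coe {n : ℕ} {k : ℤ} {s : SimLift n} (h : s ∈ window n k) (j : Fin (n + 1)) :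
    (((s.roll k).1 j : unitInterval) : ℝ) = s.seq (k + (j : ℕ)) := by
  have h1 := s.seq_mono (by omega : k ≤ k + (j : ℕ))
  have h2 := s.seq_mono (by have := j.2; omega : k + (j : ℕ) ≤ k - 1 + 1 * (n + 1))
  rw [s.seq_add] at h2
  push_cast at h2
  have hmem : s.seq (k + (j : ℕ)) ∈ Set.Icc (0 : ℝ) 1 :=
    ⟨h.2.trans h1, by linarith [h.1]⟩
  show ((Set.projIcc (0 : ℝ) 1 zero_le_one _ : Set.Icc (0 : ℝ) 1) : ℝ) = _
  rw [Set.projIcc_of_mem _ hmem]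

/-- The `CyclicMap` which forgets the last vertex and translates by `k`. -/
def rollMap (n : ℕ) (k : ℤ) : CyclicMap (n + 1) n where
  -- The rolled simplex has the base point as an additional jump, once in every `n + 2`. The
  -- quotient counts how often it has been passed.
  toFun N := N - N / (n + 2) + k
  mono := monotone_int_of_le_succ fun N => by
    have h1 : (N + 1) / (n + 2) ≤ (N + 1 * (n + 2)) / (n + 2) :=
      Int.ediv_le_ediv (by omega) (by omega)
    rw [Int.add_mul_ediv_right _ _ (by omega)] at h1
    omega
  map_add i := by
    have : (i + (((n + 1 : ℕ) : ℤ) + 1)) / (n + 2) = i / (n + 2) + 1 := by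
      rw [show i + (((n + 1 : ℕ) : ℤ) + 1) = i + 1 * (n + 2) by push_cast; ring,
        Int.add_mul_ediv_right _ _ (by omega)]
    rw [this]
    push_cast
    ring

/-- Forgetting the additional jump at the base point and restoring the indexing turns the rolled
simplex back into `s`. -/
theorem stepIndex_roll {n : ℕ} {k : ℤ} {s : SimLift n} (h : s ∈ SimLift.window n k) (y : ℝ) :
    stepIndex s y = (rollMap n k).toFun (stepIndex (s.roll k).toSimLift y) := by
  obtain ⟨t, a, ht, rfl⟩ := exists_unitInterval_add_int y
  have ht0 : (0 : ℝ) < t := ht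
  rw [stepIndex_add_int, stepIndex_add_int, stepIndex_toSimLift _ ht]
  have hle : countBelow (s.roll k).1 t ≤ n + 1 := countBelow_le _ _
  have hlt := fun j => lt_iff_lt_countBelow (s.roll k).2 j t
  generalize countBelow (s.roll k).1 t = c at hle hlt
  have h1 : ((c : ℤ) + a * (((n + 1 : ℕ) : ℤ) + 1)) / (n + 2) = a := by
    rw [show (c : ℤ) + a * (((n + 1 : ℕ) : ℤ) + 1) = c + a * (n + 2) by push_cast; ring,
      Int.add_mul_ediv_right _ _ (by omega), Int.ediv_eq_zero_of_lt (by omega) (by omega), zero_add]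
  have h2 : stepIndex s t = c + k := by
    have hcoe : ∀ j : Fin (n + 1), s.seq (k + (j : ℕ)) < t ↔ (j : ℕ) < c := fun j => by
      rw [← hlt, ← SimLift.roll_coe h]
      rfl
    refine le_antisymm ((stepIndex_le_iff s t _).2 ?_) ?_
    · rcases eq_or_lt_of_le hle with hc | hc
      · rw [hc, show ((n + 1 : ℕ) : ℤ) + k = k + 1 * (n + 1) by push_cast; ring, s.seq_add]
        push_cast
        linarith [h.2, t.2.2]
      · have := mt (hcoe ⟨c, hc⟩).1 (lt_irrefl _)
        rw [add_comm]
        exact not_lt.1 this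
    · by_contra hcon
      have h3 := (stepIndex_le_iff s t (c + k - 1)).1 (by omega)
      rcases Nat.eq_zero_or_pos c with hc | hc
      · subst hc
        rw [Nat.cast_zero, zero_add] at h3
        linarith [h.1]
      · have h4 := (hcoe ⟨c - 1, by omega⟩).2 (show c - 1 < c by omega)
        have h5 : k + ((c - 1 : ℕ) : ℤ) = c + k - 1 := by omega
        rw [show k + (((⟨c - 1, by omega⟩ : Fin (n + 1)) : ℕ) : ℤ) = c + k - 1 from h5] at h4
        linarith
  show _ = (c : ℤ) + a * (((n + 1 : ℕ) : ℤ) + 1) -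
    ((c : ℤ) + a * (((n + 1 : ℕ) : ℤ) + 1)) / (n + 2) + k
  rw [h1, h2]
  push_cast
  ring

namespace CyclicRealization

variable (X : CyclicSet.{u})

theorem topology_eq : (inferInstance : TopologicalSpace (CyclicRealization X)) =
    ⨆ (n : ℕ) (x : (underlyingSSet X).obj (op (SimplexCategory.mk n))),
      TopologicalSpace.coinduced (fun s : Simplex n => charMap X (n := n) x s.toSimLift)
        inferInstance := rfl

theorem charMap_roll {n : ℕ} (x : X.obj (op (n : Lambda))) {k : ℤ} {s : SimLift n}
    (h : s ∈ SimLift.window n k) : charMap X x s =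
      charMap X (X.map (cycHom (rollMap n k)).op x) (s.roll k).toSimLift :=
  charMap_cycHom X _ (stepIndex_roll h) x

theorem continuous_charMap_toSimLift {n : ℕ} (x : X.obj (op (n : Lambda))) :
    Continuous fun s : Simplex n => charMap X x s.toSimLift :=
  IsSimplexQuotient.continuous_ch (X := underlyingSSet X) (topology_eq X) n x

/-- The topology only concerns tuples ending at the base point. The closed windows are a locally
finite cover, and on each the map factors through the continuous `roll` and the characteristic map
of an `(n + 1)`-simplex. -/
theorem continuous_charMap {n : ℕ} (x : X.obj (op (n : Lambda))) : Continuous (charMap X x) := by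
  refine (SimLift.locallyFinite_window n).continuous (Set.iUnion_eq_univ_iff.2 fun s =>
    ⟨_, SimLift.mem_window n s⟩) (SimLift.isClosed_window n) fun k => ?_
  exact (((continuous_charMap_toSimLift X _).comp (SimLift.continuous_roll n k)).continuousOn).congr
    fun s hs => charMap_roll X x hs

end CyclicRealization

/-! ### Continuity of the action -/

theorem continuous_autCircle_apply : Continuous fun p : AutCircle × Circle1 => p.1.1 p.2 := by
  have h : Continuous fun g : AutCircle => (⟨g.1, g.1.continuous⟩ : C(Circle1, Circle1)) :=
    continuous_induced_dom
  exact ContinuousEval.continuous_eval.comp (h.prodMap continuous_id)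

/-- The increment of a lift is a continuous function on `Aut S¹ × [0, 1]`. -/
theorem continuous_circleLift_sub :
    Continuous fun p : unitInterval × AutCircle => circleLift p.2 p.1 - circleLift p.2 0 := by
  let f : C(unitInterval × AutCircle, Circle1) :=
    ⟨fun p => p.2.1 ((p.1 : ℝ) : Circle1) - p.2.1 ((0 : ℝ) : Circle1),
      (continuous_autCircle_apply.comp (continuous_snd.prodMk ((AddCircle.continuous_mk' 1).comp
        (continuous_subtype_val.comp continuous_fst)))).sub
      (continuous_autCircle_apply.comp (continuous_snd.prodMk continuous_const))⟩
  have cov : IsCoveringMap ((↑) : ℝ → Circle1) := AddCircle.isCoveringMap_coe 1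
  -- The chosen lift need not depend continuously on `g`, but its increment from `0` lifts a
  -- continuous map to the circle, vanishes at `0` for every `g`, and is continuous along each
  -- interval. The lifting property of coverings gives joint continuity.
  refine cov.isLocalHomeomorph.continuous_lift cov.isSeparatedMap f ?_ ?_ fun g => ?_
  · funext p
    show ((circleLift p.2 p.1 - circleLift p.2 0 : ℝ) : Circle1) = p.2.1 _ - p.2.1 _
    rw [AddCircle.coe_sub, circleLift_coe, circleLift_coe]
  · simp only [Set.Icc.coe_zero, sub_self]
    exact continuous_const
  · show Continuous fun t : unitInterval => circleLift g t - circleLift g 0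
    exact ((circleLift g).continuous.comp continuous_subtype_val).sub continuous_const

/-- Translation of a cyclically ordered tuple. -/
def SimLift.translate {n : ℕ} (b : ℝ) (s : SimLift n) : SimLift n :=
  ⟨fun i => s.1 i + b, fun _ _ h => add_le_add (s.2.1 h) le_rfl, by linarith [s.2.2]⟩

theorem SimLift.continuous_translate (n : ℕ) :
    Continuous fun p : ℝ × SimLift n => p.2.translate p.1 :=
  Continuous.subtype_mk (continuous_pi fun i =>
    ((continuous_apply i).comp (continuous_subtype_val.comp continuous_snd)).add continuous_fst) _

theorem stepMor_congr {n : ℕ} {s s' : SimLift n} {m : ℤ}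
    (h : ∀ y, stepIndex s' y = stepIndex s y + m * (n + 1)) (G : CircleFinset) :
    stepMor s' G = stepMor s G := by
  refine ObjectProperty.hom_ext _ ?_
  show stepHom s' G = stepHom s G
  refine shiftFunctor_congr ?_ fun a b => ?_
  · funext c
    obtain ⟨y, hy⟩ := QuotientAddGroup.mk_surjective (endPoint G c : Circle1)
    have hy' : (endPoint G c : Circle1) = y := hy.symm
    rw [hy', stepRes_coe, stepRes_coe, h, finOfInt_add]
  · have key : ∀ c : CirclePi0 G, degShift (stepDeg s') (endPoint G c) =
        degShift (stepDeg s) (endPoint G c) + m := fun c => by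
      obtain ⟨y, hy⟩ := QuotientAddGroup.mk_surjective (endPoint G c : Circle1)
      have hy' : (endPoint G c : Circle1) = y := hy.symm
      rw [hy', degShift_stepDeg_coe, degShift_stepDeg_coe, h]
      push_cast
      field_simp
      ring
    rw [key, key]
    ring

theorem stepIndex_of_add_int {n : ℕ} {s s' : SimLift n} {m : ℤ} (h : ∀ i, s'.1 i = s.1 i + m)
    (y : ℝ) : stepIndex s' y = stepIndex s y + (-m : ℤ) * (n + 1) := by
  rw [← stepIndex_add_int]
  refine Finset.sum_congr rfl fun i _ => ?_
  rw [h]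
  congr 1
  push_cast
  ring

theorem Simplex.toSimLift_castSucc {n : ℕ} (s : Simplex n) (i : Fin n) :
    s.toSimLift.1 i.castSucc = s.1 i := by
  simp [toSimLift]

theorem Simplex.toSimLift_last {n : ℕ} (s : Simplex n) : s.toSimLift.1 (Fin.last n) = 1 := by
  simp [toSimLift]

/-- The increments of a lift along the vertices of a simplex, as a tuple ending at `1`. -/
noncomputable def autTuple {n : ℕ} (p : AutCircle × Simplex n) : SimLift n :=
  (p.2.toSimLift.mapAut p.1).translate (-circleLift p.1 0)

theorem continuous_autTuple (n : ℕ) : Continuous (autTuple : AutCircle × Simplex n → SimLift n) := by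
  refine Continuous.subtype_mk (continuous_pi fun i => ?_) _
  show Continuous fun p : AutCircle × Simplex n =>
    circleLift p.1 (p.2.toSimLift.1 i) + -circleLift p.1 0
  simp only [← sub_eq_add_neg]
  induction i using Fin.lastCases with
  | last =>
    refine (continuous_circleLift_sub.comp
      (continuous_const (y := (1 : unitInterval)) |>.prodMk continuous_fst)).congr fun p => ?_
    rw [p.2.toSimLift_last]
    rfl
  | cast i =>
    refine (continuous_circleLift_sub.comp (((continuous_apply i).comp
      (continuous_subtype_val.comp continuous_snd)).prodMk continuous_fst)).congr fun p => ?_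
    rw [p.2.toSimLift_castSucc]
    rfl

namespace CyclicRealization

variable (X : CyclicSet.{u})

theorem charMap_eq_of_add_int {n : ℕ} (x : X.obj (op (n : Lambda))) {s s' : SimLift n} {m : ℤ}
    (h : ∀ i, s'.1 i = s.1 i + m) : charMap X x s' = charMap X x s := by
  obtain ⟨G, h1, h2⟩ := exists_ge_ge (simPoints s) (simPoints s')
  rw [charMap_eq X x s h1, charMap_eq X x s' h2, stepMor_congr (stepIndex_of_add_int h)]

/-- The value of a lift at `0` is continuous in `g` only modulo integers, so translations must be
parametrized by the circle. This is possible because integral translations do not change the class,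
and continuity descends along the open quotient map from the line. -/
theorem exists_charMap_translate {n : ℕ} (x : X.obj (op (n : Lambda))) :
    ∃ E : Circle1 × SimLift n → CyclicRealization X, Continuous E ∧
      ∀ (b : ℝ) s, E ((b : Circle1), s) = charMap X x (s.translate b) := by
  let E : Circle1 × SimLift n → CyclicRealization X := fun p =>
    charMap X x (p.2.translate (AddCircle.equivIco 1 0 p.1 : ℝ))
  have hE : ∀ (b : ℝ) s, E ((b : Circle1), s) = charMap X x (s.translate b) := by
    intro b s
    have h : (((AddCircle.equivIco 1 0 (b : Circle1) : ℝ)) : Circle1) = b := AddCircle.coe_equivIco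
    obtain ⟨m, hm⟩ := exists_int_of_coe_eq h
    refine charMap_eq_of_add_int X x (m := m) fun i => ?_
    show s.1 i + (AddCircle.equivIco 1 0 (b : Circle1) : ℝ) = s.1 i + b + m
    rw [hm]
    ring
  refine ⟨E, ?_, hE⟩
  have hq : IsOpenQuotientMap (Prod.map ((↑) : ℝ → Circle1) (id : SimLift n → SimLift n)) :=
    IsOpenQuotientMap.prodMap QuotientAddGroup.isOpenQuotientMap_mk .id
  rw [hq.isQuotientMap.continuous_iff]
  exact ((continuous_charMap X x).comp (SimLift.continuous_translate n)).congr fun p =>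
    (hE p.1 p.2).symm

/-- The moved tuple is the tuple of increments `autTuple`, translated by `g(0)`; both are
continuous. -/
theorem continuous_smul_charMap {n : ℕ} (x : X.obj (op (n : Lambda))) :
    Continuous fun p : AutCircle × Simplex n => p.1 • charMap X x p.2.toSimLift := by
  obtain ⟨E, hE, hEb⟩ := exists_charMap_translate X x
  have h0 : Continuous fun p : AutCircle × Simplex n => p.1.1 ((0 : ℝ) : Circle1) :=
    continuous_autCircle_apply.comp (continuous_fst.prodMk continuous_const)
  refine (hE.comp (h0.prodMk (continuous_autTuple n))).congr fun p => ?_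
  show E (p.1.1 ((0 : ℝ) : Circle1), autTuple p) = _
  rw [circleLift_coe, hEb, smul_charMap]
  congr 1
  refine Subtype.ext (funext fun i => ?_)
  show circleLift p.1 (p.2.toSimLift.1 i) + -circleLift p.1 0 + circleLift p.1 0 =
    circleLift p.1 (p.2.toSimLift.1 i)
  ring

theorem continuous_smul_of_isCompact {K : Set (CyclicRealization X)} (hK : IsCompact K) :
    Continuous fun p : AutCircle × K => p.1 • (p.2 : CyclicRealization X) :=
  (isSimplexQuotient X).continuous_prod_of_isCompact (topology_eq X)
    (f := fun p : AutCircle × CyclicRealization X => p.1 • p.2)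
    (fun _ x => continuous_smul_charMap X x) hK

/-- A test map from a compact Hausdorff space has compact second projection `K`, so it factors
through `Aut S¹ × K`. -/
theorem continuous_smul_compactlyGenerated :
    @Continuous (AutCircle × CyclicRealization X) (CyclicRealization X)
      (TopologicalSpace.compactlyGenerated.{u} (AutCircle × CyclicRealization X)) inferInstance
      fun p => p.1 • p.2 := by
  refine continuous_from_compactlyGenerated _ fun S f => ?_
  let K := Set.range fun s => (f s).2
  have hK : IsCompact K := isCompact_range (continuous_snd.comp f.continuous)
  have hf : Continuous fun s => ((f s).1, (⟨(f s).2, s, rfl⟩ : K)) :=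
    (continuous_fst.comp f.continuous).prodMk ((continuous_snd.comp f.continuous).subtype_mk _)
  have h : ((fun p : AutCircle × CyclicRealization X => p.1 • p.2) ∘ f) =
      (fun p : AutCircle × K => p.1 • (p.2 : CyclicRealization X)) ∘
        fun s => ((f s).1, (⟨(f s).2, s, rfl⟩ : K)) := rfl
  rw [h]
  exact (continuous_smul_of_isCompact X hK).comp hf

theorem continuous_smul_of_locallyCompact [LocallyCompactSpace (CyclicRealization X)] :
    Continuous fun p : AutCircle × CyclicRealization X => p.1 • p.2 := by
  rw [continuous_iff_continuousAt]
  rintro ⟨g, y⟩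
  obtain ⟨K, hK, hy⟩ := exists_compact_mem_nhds y
  have h : ContinuousOn (fun p : AutCircle × CyclicRealization X => p.1 • p.2) (Set.univ ×ˢ K) := by
    rw [continuousOn_iff_continuous_domRestrict]
    have hj : Continuous fun p : (Set.univ ×ˢ K : Set (AutCircle × CyclicRealization X)) =>
        (p.1.1, (⟨p.1.2, p.2.2⟩ : K)) :=
      (continuous_fst.comp continuous_subtype_val).prodMk
        ((continuous_snd.comp continuous_subtype_val).subtype_mk _)
    have h := (continuous_smul_of_isCompact X hK).comp hj
    have e : (Set.univ ×ˢ K).domRestrict (fun p : AutCircle × CyclicRealization X => p.1 • p.2) =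
      (fun p : AutCircle × K => p.1 • (p.2 : CyclicRealization X)) ∘
        fun p : (Set.univ ×ˢ K : Set (AutCircle × CyclicRealization X)) =>
          (p.1.1, (⟨p.1.2, p.2.2⟩ : K)) := rfl
    rw [e]
    exact h
  refine h.continuousAt ?_
  exact prod_mem_nhds Filter.univ_mem hy

end CyclicRealization

/-! ### The realization of the cyclic simplices -/

/-- Lengthening a path by a full turn is composing it with the endomorphism `1`, which a
`ℤ₊`-functor preserves. -/
theorem len_map_add_nat {A B : Type} {p : A → Circle1} {q : B → Circle1}
    (Φ : onCircle p ⟶ onCircle q) {a b : OnCircle p} (γ δ : a ⟶ b) (m : ℕ)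
    (h : OrientedClass.len δ = OrientedClass.len γ + m) :
    OrientedClass.len (Φ.functor.map δ) = OrientedClass.len (Φ.functor.map γ) + m := by
  induction m generalizing δ with
  | zero => rw [show δ = γ from OrientedClass.ext (by simpa using h)]; simp
  | succ m ih =>
    let ε : a ⟶ b := (⟨OrientedClass.len γ + m, add_nonneg (OrientedClass.nonneg γ) m.cast_nonneg, by
      rw [AddCircle.coe_add, ← add_assoc, OrientedClass.add_eq γ]
      have := coe_intCast_circle m
      push_cast at this
      rw [this, add_zero]⟩ : OrientedClass (p a.pt) (p b.pt))
    have h1 : δ = ε ≫ (onCircle p).one.app b := OrientedClass.ext (by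
      refine h.trans ?_
      show OrientedClass.len γ + ((m + 1 : ℕ) : ℝ) = OrientedClass.len γ + m + 1
      push_cast
      ring)
    have h2 : Φ.functor.map δ = Φ.functor.map ε ≫ (onCircle q).one.app (Φ.functor.obj b) :=
      (congrArg _ h1).trans ((Φ.functor.map_comp ε ((onCircle p).one.app b)).trans
        (congrArg (Φ.functor.map ε ≫ ·) (Φ.map_one b)))
    have h3 : OrientedClass.len (Φ.functor.map δ) = OrientedClass.len (Φ.functor.map ε) + 1 :=
      congrArg OrientedClass.len h2
    rw [h3, ih ε rfl]
    push_cast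
    ring

/-- Every `ℤ₊`-functor between subsets of the circle is given by a displacement function. -/
theorem exists_eq_shiftFunctor {A B : Type} [Nonempty A] {p : A → Circle1} {q : B → Circle1}
    (Φ : onCircle p ⟶ onCircle q) : ∃ (φ : A → B) (u : A → ℝ) (hφ : _) (hu : _),
      Φ = shiftFunctor φ u hφ hu := by
  obtain ⟨a₀⟩ := ‹Nonempty A›
  let φ : A → B := fun a => (Φ.functor.obj ⟨a⟩).pt
  -- The displacement at `a₀` may be any real lift; at the other points it is determined by the
  -- lengths of the images of the shortest paths from `a₀`.
  obtain ⟨c, hc⟩ : ∃ c : ℝ, (c : Circle1) = q (φ a₀) - p a₀ := QuotientAddGroup.mk_surjective _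
  let γ : ∀ a, (⟨a₀⟩ : OnCircle p) ⟶ ⟨a⟩ := fun a =>
    (⟨fwd (p a₀) (p a), fwd_nonneg _ _, add_fwd _ _⟩ : OrientedClass (p a₀) (p a))
  let l : A → ℝ := fun a => OrientedClass.len (Φ.functor.map (γ a))
  let u : A → ℝ := fun a => l a - fwd (p a₀) (p a) + c
  have hl : ∀ a, q (φ a₀) + (l a : Circle1) = q (φ a) := fun a =>
    OrientedClass.add_eq (Φ.functor.map (γ a))
  have hφ : ∀ a, q (φ a) = p a + (u a : Circle1) := fun a => by
    have h1 : ((fwd (p a₀) (p a) : ℝ) : Circle1) = p a - p a₀ :=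
      eq_sub_of_add_eq' (add_fwd (p a₀) (p a))
    rw [← hl a, AddCircle.coe_add, AddCircle.coe_sub, hc, h1]
    abel
  have key : ∀ (a b : A) (δ : (⟨a⟩ : OnCircle p) ⟶ ⟨b⟩),
      OrientedClass.len (Φ.functor.map δ) = OrientedClass.len δ + (u b - u a) := by
    intro a b δ
    have h1 : fwd (p a₀) (p b) ≤ fwd (p a₀) (p a) + OrientedClass.len δ :=
      OrientedClass.nonneg (γ a ≫ δ) |> fun h => fwd_le h (OrientedClass.add_eq (γ a ≫ δ))
    have h2 : ((fwd (p a₀) (p a) + OrientedClass.len δ : ℝ) : Circle1) =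
        ((fwd (p a₀) (p b) : ℝ) : Circle1) := by
      apply add_left_cancel (a := p a₀)
      rw [add_fwd]
      exact OrientedClass.add_eq (γ a ≫ δ)
    -- The path through `a` differs from the shortest path to `b` by `m ≥ 0` full turns, and the
    -- functor preserves their number.
    obtain ⟨m, hm⟩ := exists_int_of_coe_eq h2
    have hm0 : 0 ≤ m := by
      have : (0 : ℝ) ≤ m := by linarith
      exact_mod_cast this
    lift m to ℕ using hm0
    have h3 := len_map_add_nat Φ (γ b) (γ a ≫ δ) m (by
      show fwd (p a₀) (p a) + OrientedClass.len δ = fwd (p a₀) (p b) + m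
      rw [hm]; simp)
    have h4 : OrientedClass.len (Φ.functor.map (γ a ≫ δ)) =
        l a + OrientedClass.len (Φ.functor.map δ) :=
      congrArg OrientedClass.len (Φ.functor.map_comp (γ a) δ)
    have h5 : l a + _ = l b + _ := h4.symm.trans h3
    simp only [Int.cast_natCast] at hm
    show _ = _ + (l b - fwd (p a₀) (p b) + c - (l a - fwd (p a₀) (p a) + c))
    linarith
  refine ⟨φ, u, hφ, fun a b t ht hab => ?_, ?_⟩
  · rw [← key a b (⟨t, ht, hab⟩ : OrientedClass (p a) (p b))]
    exact OrientedClass.nonneg _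
  · refine ZPlusFunctor.ext ?_
    refine CategoryTheory.Functor.hext (fun _ => rfl) fun a b δ => heq_of_eq ?_
    exact OrientedClass.ext (key a.pt b.pt δ)

/-- Every morphism of the cyclic category is given by a `CyclicMap`. -/
theorem exists_cycHom_eq {k n : ℕ} (z : @Quiver.Hom Lambda _ k n) :
    ∃ f : CyclicMap k n, cycHom f = z := by
  obtain ⟨φ, u, hφ, hu, hz⟩ := exists_eq_shiftFunctor
    (p := fun j : Fin (k + 1) => (cycPoint k j : Circle1))
    (q := fun j : Fin (n + 1) => (cycPoint n j : Circle1)) z.hom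
  have h1 : ∀ j, ∃ m : ℤ, cycPoint k j + u j = cycPoint n (φ j) + m := fun j =>
    exists_int_of_coe_eq (by rw [hφ, AddCircle.coe_add])
  choose m hm using h1
  -- The lift of `φ` to the integers, normalized so that `F N / (n + 1)` is `N / (k + 1)` moved by
  -- the displacement `u`.
  let F : ℤ → ℤ := fun N => (φ (finOfInt k N) : ℕ) + m (finOfInt k N) * (n + 1) + N / (k + 1) * (n + 1)
  have hF : ∀ N : ℤ, (F N : ℝ) / (n + 1) = (N : ℝ) / (k + 1) + u (finOfInt k N) := fun N => by
    have h2 := hm (finOfInt k N)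
    have h3 : ((finOfInt k N : ℕ) : ℝ) = N + -((N / (k + 1) : ℤ) : ℝ) * (k + 1) := by
      exact_mod_cast finOfInt_val_eq k N
    rw [cycPoint, cycPoint, h3] at h2
    have h4 : (F N : ℝ) = (φ (finOfInt k N) : ℕ) + m (finOfInt k N) * (n + 1) +
        ((N / (k + 1) : ℤ) : ℝ) * (n + 1) := by
      exact_mod_cast rfl
    rw [h4]
    field_simp at h2 ⊢
    linarith
  have hcoe : ∀ N : ℤ, (cycPoint k (finOfInt k N) : Circle1) = ((N / (k + 1) : ℝ) : Circle1) :=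
    cycPoint_finOfInt k
  refine ⟨⟨F, fun a b hab => ?_, fun i => ?_⟩, ?_⟩
  · have hab' : (a : ℝ) ≤ b := by exact_mod_cast hab
    have h2 := hu (finOfInt k a) (finOfInt k b) (b / (k + 1) - a / (k + 1))
      (sub_nonneg.2 (div_le_div_of_nonneg_right hab' (by positivity))) (by
        show (cycPoint k (finOfInt k a) : Circle1) + _ = (cycPoint k (finOfInt k b) : Circle1)
        rw [hcoe, hcoe, ← AddCircle.coe_add, add_sub_cancel])
    have h3 : (F a : ℝ) / (n + 1) ≤ (F b : ℝ) / (n + 1) := by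
      rw [hF, hF]; linarith
    rw [div_le_div_iff_of_pos_right (by positivity)] at h3
    exact_mod_cast h3
  · have h1 : finOfInt k (i + (k + 1)) = finOfInt k i := by
      simpa using finOfInt_add k i 1
    have h2 : (i + (k + 1)) / ((k : ℤ) + 1) = i / (k + 1) + 1 := by
      rw [Int.add_ediv_of_dvd_right (dvd_refl _), Int.ediv_self (by omega)]
    show _ + _ / _ * _ = _ + _ / _ * _ + _
    rw [h1, h2]
    ring
  · refine InducedCategory.hom_ext (Eq.trans ?_ hz.symm)
    have hj : ∀ j : Fin (k + 1), finOfInt k (j : ℕ) = j ∧ ((j : ℕ) : ℤ) / (k + 1) = 0 := fun j => by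
      have := finOfInt_natCast k j 0
      rwa [zero_mul, add_zero] at this
    show cycFunctor _ = _
    refine shiftFunctor_congr ?_ fun a b => ?_
    · funext j
      show finOfInt n (F (j : ℕ)) = φ j
      have h2 : F (j : ℕ) = (φ j : ℕ) + m j * (n + 1) := by
        show _ + _ + _ / _ * _ = _
        rw [(hj j).1, (hj j).2]
        ring
      rw [h2, (finOfInt_natCast n (φ j) (m j)).1]
    · have h2 : ∀ j : Fin (k + 1), (F (j : ℕ) : ℝ) / (n + 1) - cycPoint k j = u j := fun j => by
        rw [hF, (hj j).1, cycPoint]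
        push_cast
        ring
      show (F (b : ℕ) : ℝ) / (n + 1) - cycPoint k b - ((F (a : ℕ) : ℝ) / (n + 1) - cycPoint k a) = _
      rw [h2, h2]

/-- The image of a cyclically ordered tuple under a `CyclicMap`. -/
theorem exists_stepIndex_eq {k n : ℕ} (f : CyclicMap k n) (r : SimLift k) :
    ∃ s : SimLift n, ∀ y, stepIndex s y = f.toFun (stepIndex r y) := by
  have hf0 : ∀ N, f.toFun (N * (k + 1)) = f.toFun 0 + N * (n + 1) := fun N => by
    simpa using f.map_add_mul 0 N
  -- The right adjoint `b` of `f`. It exists because each period raises `f` by `n + 1 ≥ 1`, so `|i -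
  -- f(0)| + 1` periods suffice to pass `i`.
  have hadj : ∀ i, ∃ b : ℤ, ∀ N, f.toFun N ≤ i ↔ N ≤ b := by
    intro i
    obtain ⟨b, hb, hb'⟩ := Int.exists_greatest_of_bdd (P := fun N => f.toFun N ≤ i)
      ⟨(|i - f.toFun 0| + 1) * (k + 1), fun N hN => by
        by_contra hlt
        have h1 := f.mono (not_le.1 hlt).le
        rw [hf0] at h1
        have h2 : (|i - f.toFun 0| + 1) * 1 ≤ (|i - f.toFun 0| + 1) * ((n : ℤ) + 1) :=
          mul_le_mul_of_nonneg_left (by omega) (by positivity)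
        have h3 := le_abs_self (i - f.toFun 0)
        linarith⟩
      ⟨-|i - f.toFun 0| * (k + 1), by
        show f.toFun _ ≤ i
        rw [hf0]
        have h2 : |i - f.toFun 0| * 1 ≤ |i - f.toFun 0| * ((n : ℤ) + 1) :=
          mul_le_mul_of_nonneg_left (by omega) (by positivity)
        have h3 := neg_abs_le (i - f.toFun 0)
        linarith⟩
    exact ⟨b, fun N => ⟨hb' N, fun h => (f.mono h).trans hb⟩⟩
  choose b hb using hadj
  have hmono : Monotone b := fun i j hij => (hb j _).1 (((hb i _).2 le_rfl).trans hij)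
  have hadd : ∀ i m, b (i + m * (n + 1)) = b i + m * (k + 1) := fun i m => by
    refine eq_of_forall_le_iff fun N => ?_
    have h1 : N ≤ b i + m * (k + 1) ↔ N + -m * (k + 1) ≤ b i := by
      constructor <;> intro h <;> linarith
    rw [← hb, h1, ← hb, f.map_add_mul]
    constructor <;> intro h <;> linarith
  -- Composing the step function with `f` corresponds, under `stepIndex_le_iff`, to reindexing the
  -- points of `r` by the adjoint `b`.
  let s : SimLift n := ⟨fun j => r.seq (b (j : ℕ)), fun i j hij =>
    r.seq_mono (hmono (by exact_mod_cast hij)), by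
      have h1 : b (n : ℕ) ≤ b 0 + 1 * (k + 1) := by
        rw [← hadd]; exact hmono (by omega)
      have h2 := r.seq_mono h1
      rw [r.seq_add] at h2
      simpa using h2⟩
  have hs : ∀ i, s.seq i = r.seq (b i) := fun i => by
    obtain ⟨j, a, rfl⟩ := exists_fin_add_mul n i
    rw [s.seq_add_mul, hadd, r.seq_add]
  refine ⟨s, fun y => eq_of_forall_ge_iff fun i => ?_⟩
  rw [stepIndex_le_iff, hs, ← stepIndex_le_iff, hb]

theorem exists_int_of_finOfInt_eq {n : ℕ} {a b : ℤ} (h : finOfInt n a = finOfInt n b) :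
    ∃ m : ℤ, a = b + m * (n + 1) := by
  have h1 := finOfInt_val_eq n a
  rw [h, finOfInt_val_eq] at h1
  exact ⟨a / (n + 1) - b / (n + 1), by linarith⟩

theorem exists_between_notMem (G : CircleFinset) {a b : ℝ} (h : a < b) :
    ∃ y : ℝ, a < y ∧ y < b ∧ (y : Circle1) ∉ G.1 := by
  by_contra hcon
  push Not at hcon
  -- On an interval of length at most one the projection to the circle is injective.
  have h1 : a < min b (a + 1) := lt_min h (by linarith)
  refine (Set.Ioo_infinite h1) (Set.Finite.of_finite_image (f := ((↑) : ℝ → Circle1))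
    (G.1.finite_toSet.subset ?_) ?_)
  · rintro _ ⟨y, hy, rfl⟩
    exact hcon y hy.1 (hy.2.trans_le (min_le_left _ _))
  · intro x hx y hy hxy
    exact (AddCircle.coe_eq_coe_iff_of_mem_Ico (a := a) (p := 1)
      ⟨hx.1.le, hx.2.trans_le (min_le_right _ _)⟩ ⟨hy.1.le, hy.2.trans_le (min_le_right _ _)⟩).1 hxy

/-- The objects give the step function modulo `n + 1` and the paths give its differences, so the two
step functions differ by a constant `m * (n + 1)` away from `G`. As the complement of `G` is dense,
the adjunction turns this into an integral translation of the points. -/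
theorem exists_int_of_stepMor_eq {n : ℕ} {s s' : SimLift n} {G : CircleFinset}
    (hs : simPoints s ≤ G) (hs' : simPoints s' ≤ G) (h : stepMor s G = stepMor s' G) :
    ∃ m : ℤ, ∀ i, s'.1 i = s.1 i + m := by
  have h' : stepHom s G = stepHom s' G := congrArg (fun f => f.hom) h
  let c : ∀ y : ℝ, (y : Circle1) ∉ G.1 → CirclePi0 G := fun y hy =>
    ((⟨y, hy⟩ : {z : Circle1 // z ∉ G.1}) : CirclePi0 G)
  have hc : ∀ y hy, (endPoint G (c y hy) : Circle1) = ((y + gap G (y : Circle1) : ℝ) : Circle1) :=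
    fun y hy => by
      rw [AddCircle.coe_add]
      rfl
  have hobj : ∀ y : ℝ, (y : Circle1) ∉ G.1 → finOfInt n (stepIndex s y) = finOfInt n (stepIndex s' y) :=
    fun y hy => by
      have h1 : stepRes s (endPoint G (c y hy)) = stepRes s' (endPoint G (c y hy)) :=
        congrArg (fun Φ : onCircle (fun c : CirclePi0 G => (endPoint G c : Circle1)) ⟶ cyc n =>
          (Φ.functor.obj ⟨c y hy⟩).pt) h'
      rwa [hc, stepRes_coe, stepRes_coe, stepIndex_add_gap s hs, stepIndex_add_gap s' hs'] at h1
  have hdiff : ∀ a b : CirclePi0 G,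
      degShift (stepDeg s) (endPoint G b) - degShift (stepDeg s) (endPoint G a) =
      degShift (stepDeg s') (endPoint G b) - degShift (stepDeg s') (endPoint G a) := fun a b => by
    let γ : (⟨a⟩ : OnCircle fun c : CirclePi0 G => (endPoint G c : Circle1)) ⟶ ⟨b⟩ :=
      (⟨fwd _ _, fwd_nonneg _ _, add_fwd _ _⟩ :
        OrientedClass (endPoint G a : Circle1) (endPoint G b : Circle1))
    have h1 : OrientedClass.len γ +
        (degShift (stepDeg s) (endPoint G b) - degShift (stepDeg s) (endPoint G a)) =
        OrientedClass.len γ +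
        (degShift (stepDeg s') (endPoint G b) - degShift (stepDeg s') (endPoint G a)) :=
      congrArg (fun Φ : onCircle (fun c : CirclePi0 G => (endPoint G c : Circle1)) ⟶ cyc n =>
        OrientedClass.len (Φ.functor.map γ)) h'
    exact add_left_cancel h1
  obtain ⟨y₀, -, -, hy₀⟩ := exists_between_notMem G zero_lt_one
  obtain ⟨m, hm⟩ := exists_int_of_finOfInt_eq (hobj y₀ hy₀)
  have key : ∀ y : ℝ, (y : Circle1) ∉ G.1 → stepIndex s y = stepIndex s' y + m * (n + 1) := by
    intro y hy
    have h1 := hdiff (c y₀ hy₀) (c y hy)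
    simp only [hc, degShift_stepDeg_coe, stepIndex_add_gap s hs, stepIndex_add_gap s' hs', hm] at h1
    push_cast at h1
    field_simp at h1
    have h2 : (stepIndex s y : ℝ) = stepIndex s' y + m * (n + 1) := by linarith
    exact_mod_cast h2
  have hseq : ∀ i, s'.seq i = s.seq (i + m * (n + 1)) := by
    intro i
    have h1 : ∀ y : ℝ, (y : Circle1) ∉ G.1 → (y ≤ s'.seq i ↔ y ≤ s.seq (i + m * (n + 1))) := fun y hy => by
      rw [← stepIndex_le_iff, ← stepIndex_le_iff, key y hy, add_le_add_iff_right]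
    refine le_antisymm (le_of_not_gt fun hlt => ?_) (le_of_not_gt fun hlt => ?_)
    · obtain ⟨y, h2, h3, h4⟩ := exists_between_notMem G hlt
      exact absurd ((h1 y h4).1 h3.le) (not_le_of_gt h2)
    · obtain ⟨y, h2, h3, h4⟩ := exists_between_notMem G hlt
      exact absurd ((h1 y h4).2 h3.le) (not_le_of_gt h2)
  exact ⟨m, fun i => by rw [← s'.seq_coe, hseq, s.seq_add, s.seq_coe]⟩

namespace CyclicRealization

/-- A simplex of the represented set is a morphism to `[n]_cyc`, hence comes from a `CyclicMap`, and
pushing the tuple forward along it gives a tuple for the identity. -/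
theorem exists_charMap_id_eq {n : ℕ} (y : CyclicRealization (cyclicSimplex n)) :
    ∃ s : SimLift n, charMap (cyclicSimplex n) (cyclicSimplexId n) s = y := by
  obtain ⟨k, z, r, rfl⟩ := (isSimplexQuotient (cyclicSimplex n)).surj y
  obtain ⟨f, hf⟩ := exists_cycHom_eq (k := k) (n := n) z
  obtain ⟨s, hs⟩ := exists_stepIndex_eq f r.toSimLift
  refine ⟨s, (charMap_cycHom (cyclicSimplex n) f hs (cyclicSimplexId n)).trans ?_⟩
  have h : (cyclicSimplex n).map (cycHom f).op (cyclicSimplexId n) = z := by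
    rw [hf]
    exact @Category.comp_id Lambda _ _ _ z
  rw [h]

theorem exists_int_of_charMap_id_eq {n : ℕ} {s s' : SimLift n}
    (h : charMap (cyclicSimplex n) (cyclicSimplexId n) s =
      charMap (cyclicSimplex n) (cyclicSimplexId n) s') : ∃ m : ℤ, ∀ i, s'.1 i = s.1 i + m := by
  obtain ⟨G, hs, hs', hG⟩ := mk_eq _ h
  refine exists_int_of_stepMor_eq hs hs' ?_
  rw [map_pullback, map_pullback, simStep_eq, simStep_eq, map_stepMor _ hs le_rfl,
    map_stepMor _ hs' le_rfl] at hG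
  -- For a represented functor, pulling the identity back along a morphism gives the morphism
  -- itself, up to the equivalence.
  have h1 : lambdaEquivalence.inverse.map (stepMor s G) ≫ lambdaEquivalence.unitInv.app n =
      lambdaEquivalence.inverse.map (stepMor s' G) ≫ lambdaEquivalence.unitInv.app n :=
    (@Category.comp_id Lambda _ _ _ _).symm.trans (hG.trans (@Category.comp_id Lambda _ _ _ _))
  exact lambdaEquivalence.inverse.map_injective ((cancel_mono _).1 h1)

/-- The map `Sim^n_cyc → |[n]_cyc|` attached to the identity. -/
noncomputable def simCycMap (n : ℕ) : SimCyc n → CyclicRealization (cyclicSimplex n) :=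
  Quotient.lift (s := simSetoid n) (charMap (cyclicSimplex n) (cyclicSimplexId n))
    fun _ _ ⟨_, hm⟩ => (charMap_eq_of_add_int _ _ hm).symm

theorem simCycMap_bijective (n : ℕ) : Function.Bijective (simCycMap n) := by
  constructor
  · intro a b
    induction a using Quotient.inductionOn with | h s => ?_
    induction b using Quotient.inductionOn with | h s' => ?_
    intro h
    exact Quotient.sound (exists_int_of_charMap_id_eq h)
  · intro y
    obtain ⟨s, hs⟩ := exists_charMap_id_eq y
    exact ⟨Quotient.mk (simSetoid n) s, hs⟩

theorem continuous_simCycMap (n : ℕ) : Continuous (simCycMap n) :=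
  (continuous_charMap (cyclicSimplex n) (cyclicSimplexId n)).quotient_lift _

/-- A compact set of lifts meets every class of tuples and only finitely many windows, so the image
of a closed set is a finite union of images of compact sets under the closed characteristic maps. -/
theorem isClosedMap_simCycMap (n : ℕ) : IsClosedMap (simCycMap n) := by
  intro C hC
  let π : SimLift n → SimCyc n := Quotient.mk (simSetoid n)
  have hC' : IsClosed (π ⁻¹' C) := hC.preimage continuous_quotient_mk'
  -- Subtracting the integral part of `x₀` gives `0 ≤ x₀ < 1`, and all points lie between `x₀` and
  -- `x₀ + 1`, hence in `[0, 2]`.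
  let D : Set (SimLift n) := {s | ∀ i, s.1 i ∈ Set.Icc (0 : ℝ) 2}
  have hD : IsCompact D := by
    have hcl : IsClosed {x : Fin (n + 1) → ℝ | Monotone x ∧ x (Fin.last n) ≤ x 0 + 1} :=
      isClosed_monotone.inter (isClosed_le (continuous_apply _) ((continuous_apply _).add continuous_const))
    have := (hcl.isClosedEmbedding_subtypeVal).isCompact_preimage
      (isCompact_univ_pi fun _ : Fin (n + 1) => isCompact_Icc (a := (0 : ℝ)) (b := 2))
    have e : D = (Subtype.val : SimLift n → _) ⁻¹' Set.pi Set.univ fun _ => Set.Icc (0 : ℝ) 2 := by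
      ext s
      exact ⟨fun h i _ => h i, fun h i => h i trivial⟩
    rw [e]
    exact this
  let K := {k | (SimLift.window n k ∩ D).Nonempty}
  have hK : K.Finite := (SimLift.locallyFinite_window n).finite_nonempty_inter_compact hD
  let z : ℤ → (cyclicSimplex n).obj (op ((n + 1 : ℕ) : Lambda)) := fun k =>
    (cyclicSimplex n).map (cycHom (rollMap n k)).op (cyclicSimplexId n)
  have e : simCycMap n '' C = ⋃ k ∈ K,
      (fun r : Simplex (n + 1) => charMap (cyclicSimplex n) (z k) r.toSimLift) ''
        (SimLift.roll k '' (π ⁻¹' C ∩ SimLift.window n k ∩ D)) := by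
    ext y
    simp only [Set.mem_iUnion]
    constructor
    · rintro ⟨c, hc, rfl⟩
      obtain ⟨s, rfl⟩ := Quotient.exists_rep c
      let s' := s.translate (-(⌊s.1 0⌋ : ℝ))
      have hss : π s' = Quotient.mk (simSetoid n) s := Quotient.sound ⟨⌊s.1 0⌋, fun i => by
        show s.1 i = s.1 i + -(⌊s.1 0⌋ : ℝ) + ⌊s.1 0⌋
        ring⟩
      have hsD : s' ∈ D := fun i => by
        have h1 := Int.floor_le (s.1 0)
        have h2 := (Int.lt_floor_add_one (s.1 0)).le
        have h3 := s.2.1 (Fin.zero_le i)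
        have h4 := s.le_add_one i 0
        constructor
        · show 0 ≤ s.1 i + -(⌊s.1 0⌋ : ℝ)
          linarith
        · show s.1 i + -(⌊s.1 0⌋ : ℝ) ≤ 2
          linarith
      have hw := SimLift.mem_window n s'
      refine ⟨_, ⟨s', hw, hsD⟩, _, ⟨s', ⟨⟨?_, hw⟩, hsD⟩, rfl⟩, ?_⟩
      · show π s' ∈ C
        rwa [hss]
      · rw [← hss]
        exact (charMap_roll (cyclicSimplex n) (cyclicSimplexId n) hw).symm
    · rintro ⟨k, -, _, ⟨s, ⟨⟨hs, hw⟩, -⟩, rfl⟩, rfl⟩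
      exact ⟨π s, hs, charMap_roll (cyclicSimplex n) (cyclicSimplexId n) hw⟩
  rw [e]
  refine hK.isClosed_biUnion fun k _ => ?_
  refine (isSimplexQuotient (cyclicSimplex n)).isClosedMap_ch (topology_eq _) (n + 1) (z k) _ ?_
  exact ((hD.inter_left (hC'.inter (SimLift.isClosed_window n k))).image
    (SimLift.continuous_roll n k)).isClosed

end CyclicRealization

end Realization

theorem mainTheorem3 :
    (∀ X : SSet.{u}, ∃ ρ : AutInterval →* Equiv.Perm (SimplicialRealization X),
      ∀ (g : AutInterval) (F : Finset unitInterval)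
        (x : (simplicialBig X).obj (op (intervalPi0 F))),
        ρ g (SimplicialRealization.mk X F x) =
          SimplicialRealization.mk X (intervalImage g F)
            ((simplicialBig X).map (intervalPi0Aut g⁻¹ (mem_intervalImage g F)).op x)) ∧
    (∀ X : CyclicSet.{u},
      (∃ Θ : SimplicialRealization (underlyingSSet X) ≃ₜ CyclicRealization X,
        ∀ (n : ℕ) (x : X.obj (op (n : Lambda))) (s : Simplex n),
          Θ (SimplicialRealization.charMap (underlyingSSet X) (n := n) x s) =
              CyclicRealization.charMap X x s.toSimLift) ∧
      ∃ ρ : AutCircle →* Equiv.Perm (CyclicRealization X),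
        (∀ (g : AutCircle) (F : CircleFinset) (x : (cyclicBig X).obj (op (circlePi0 F))),
          ρ g (CyclicRealization.mk X F x) =
            CyclicRealization.mk X (circleImage g F)
              ((cyclicBig X).map (circlePi0Aut g⁻¹ (mem_circleImage g F)).op x)) ∧
        @Continuous (AutCircle × CyclicRealization X) (CyclicRealization X)
          (TopologicalSpace.compactlyGenerated.{u} (AutCircle × CyclicRealization X)) inferInstance
          (fun p => ρ p.1 p.2) ∧
        (∀ K : Set (CyclicRealization X), IsCompact K →
          Continuous fun p : AutCircle × K => ρ p.1 p.2) ∧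
        (LocallyCompactSpace (CyclicRealization X) →
          Continuous fun p : AutCircle × CyclicRealization X => ρ p.1 p.2)) ∧
    (∀ n : ℕ, ∃ h : SimCyc n ≃ₜ CyclicRealization (cyclicSimplex n),
      ∀ s : SimLift n, h (Quotient.mk (simSetoid n) s) =
        CyclicRealization.charMap (cyclicSimplex n) (cyclicSimplexId n) s) :=
  ⟨fun X => ⟨MulAction.toPermHom AutInterval (SimplicialRealization X),
      SimplicialRealization.smul_mk X⟩,
    fun X => ⟨(SimplicialRealization.isSimplexQuotient (underlyingSSet X)).exists_homeomorph rfl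
        (CyclicRealization.isSimplexQuotient X) (CyclicRealization.topology_eq X),
      MulAction.toPermHom AutCircle (CyclicRealization X), CyclicRealization.smul_mk X,
      CyclicRealization.continuous_smul_compactlyGenerated X,
      fun _ hK => CyclicRealization.continuous_smul_of_isCompact X hK,
      fun _ => CyclicRealization.continuous_smul_of_locallyCompact X⟩,
    fun n => ⟨(Equiv.ofBijective _ (CyclicRealization.simCycMap_bijective n)).toHomeomorphOfContinuousClosed
        (CyclicRealization.continuous_simCycMap n) (CyclicRealization.isClosedMap_simCycMap n),
      fun _ => rfl⟩⟩
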